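/- **Setting.** For $i=1,2,\dots$ let $b_i,h_i>0$ and let $\sigma_{p,i},\sigma_{f,i}>0$ be known variances; put $\tilde b_i=b_i/(b_i+h_i)$. For a mean sequence $\theta=(\theta_i)_{i\ge1}$ and $n\ge 1$, the observed past is $X=(X_1,\dots,X_n)$ with independent $X_i\sim N(\theta_i,\sigma_{p,i})$ (mean, variance), and the future is $Y_i\sim N(\theta_i,\sigma_{f,i})$. For a prediction $q=(q_1,\dots,q_n)$ let $$l_i(\theta_i,q_i)=\mathbb E_{Y_i\sim N(\theta_i,\sigma_{f,i})}\big[b_i(Y_i-q_i)^++h_i(q_i-Y_i)^+\big],\qquad L_n(\theta,q)=\frac1n\sum_{i=1}^n l_i(\theta_i,q_i),$$ and for a predictor $\hat q=\hat q(X)$ let $R_n(\theta,\hat q)=\mathbb E\,L_n(\theta,\hat q(X))$. Let $\phi,\Phi$ be the standard normal density and distribution function. For $\eta\in\mathbb R$, $\tau\in[0,\infty]$ put $\alpha_i(\tau)=\tau/(\tau+\sigma_{p,i})$ (with $\alpha_i(\infty)=1$) and $$\hat q_i(\eta,\tau)=\alpha_i(\tau)X_i+(1-\alpha_i(\tau))\eta+\sqrt{\sigma_{f,i}+\alpha_i(\tau)\sigma_{p,i}}\;\Phi^{-1}(\tilde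 b_i).$$ **Assumptions.** (A1) $0<\inf_i\tilde b_i\le\sup_i\tilde b_i<1$ and $\sup_i(b_i+h_i)<\infty$. (A2) $\limsup_n\frac1n\sum_{i\le n}|\theta_i|<\infty$. (A3) $\sup_i\sigma_{p,i}/\sigma_{f,i}<1/(4e)$, $\sup_i\sigma_{f,i}<\infty$, $\inf_i\sigma_{p,i}>0$. Moreover, the ratios $\tilde b_i$ are not all equal. **Risk estimate.** Fix $\gamma(i)$ with $\inf_i\gamma(i)>0$ and $\gamma(i)<1/\sqrt{4e}-\sqrt{\sigma_{p,i}/\sigma_{f,i}}$ for all $i$, and put $\lambda_n(i)=\gamma(i)\sqrt{2\log n}$, $K_n(i)=1+\lceil e^2(\gamma(i)+\sqrt{2\sigma_{p,i}/\sigma_{f,i}})^2\,2\log n\rceil$. Let $G(w,\beta)=\phi(w)+w\Phi(w)-\beta w$, with $G'=\partial_wG$, let $H_k$ be the probabilists' Hermite polynomials, and let $$c_i(\tau)=\sqrt{\frac{\sigma_{f,i}+\alpha_i(\tau)\sigma_{p,i}}{\sigma_{f,i}+\alpha_i(\tau)^2\sigma_{p,i}}}\;\Phi^{-1}(\tilde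 b_i),\qquad d_i(\tau)=-\frac{1-\alpha_i(\tau)}{\sqrt{\sigma_{f,i}+\sigma_{p,i}\alpha_i(\tau)^2}},\qquad s_i(\tau)=\sqrt{2\sigma_{p,i}d_i(\tau)^2}.$$ For real $x,z$ put $U=c_i(\tau)+d_i(\tau)(x+\sqrt{\sigma_{p,i}}z)$ and $V=c_i(\tau)+d_i(\tau)(x-\sqrt{\sigma_{p,i}}z)$, and $$S_i(U)=G(0,\tilde b_i)+G'(0,\tilde b_i)U+\phi(0)\sum_{k=0}^{K_n(i)-2}\frac{(-1)^kH_k(0)}{(k+2)!}\,s_i(\tau)^{k+2}H_{k+2}\big(U/s_i(\tau)\big)$$ (where $s^kH_k(U/s)$ means $U^k$ if $s=0$). Let $\tilde S_i(U)$ be $S_i(U)$ truncated to $[-n,n]$, and let $\hat T_i(x,z,\tau)$ equal $-\tilde b_iU$ if $V<-\lambda_n(i)$, $\tilde S_i(U)$ if $|V|\le\lambda_n(i)$, and $(1-\tilde b_i)U$ if $V>\lambda_n(i)$. With $\hat T_i(x,\tau)=\mathbb E_{Z\sim N(0,1)}\hat T_i(x,Z,\tau)$ define $$\widehat{\mathrm{ARE}}{}^D_n(\eta,\tau)=\frac1n\sum_{i=1}^n(b_i+h_i)\sqrt{\sigma_{f,i}+\sigma_{p,i}\alpha_i(\tau)^2}\;\hat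 T_i(X_i-\eta,\tau).$$ **Tuned hyperparameters.** Let $\hat m_n(\alpha)=\inf\{t:\frac1n\#\{i\le n:X_i\le t\}\ge\alpha\}$ be the sample quantile and let $\hat M_n=[\hat m_n(\min_{i\le n}\tilde b_i),\hat m_n(\max_{i\le n}\tilde b_i)]$ be the data-quantile interval. Let $a_n=\log\log n$, and let $C_1,\dots,C_4$ be constants with $b_i+h_i\le C_1$ and $\max(\sigma_{p,i},\sigma_{p,i}^{-1})\le C_2$ for all $i$, $\sup_i(\sigma_{p,i}/\sigma_{f,i})\cdot\sup_i|\Phi^{-1}(\tilde b_i)|\le C_3$, and $C_4>0$. Put $\delta_{n,1}=(2C_1a_n)^{-1}$ and $\delta_{n,2}=\{2C_1C_2(2\phi(0)+C_3+\sqrt{a_n}\,C_4+a_n+a_n^2)\}^{-1}$. Let $\Lambda_{n,1}$ be the set of the points $-a_n+k\delta_{n,1}$, $k=0,1,2,\dots$, that lie in $[-a_n,a_n]$, and let $\Lambda_{n,2}$ be the set of the $\tau\in[0,\infty)$ for which $\tau/(\tau+1)=k\delta_{n,2}$ for some integer $0\le k<\lceil1/\delta_{n,2}\rceil$. Let $(\hat\eta^D_n,\hat\tau^D_n)\in\hat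 M_n\times[0,\infty]$ be any measurable function of $X$ that is a minimizer of $\widehat{\mathrm{ARE}}{}^D_n$ over $(\Lambda_{n,1}\cap\hat M_n)\times\Lambda_{n,2}$ whenever this set is not empty. **Claim.** Under (A1), (A3) and the above, for every $\theta$ satisfying (A2) and for all estimators (measurable functions of $X$) $\hat\tau_n\in[0,\infty]$ and $\hat\eta_n\in\hat M_n$: I. for every $\varepsilon>0$, $$\lim_{n\to\infty}P\big\{L_n(\theta,\hat q(\hat\eta^D_n,\hat\tau^D_n))\ge L_n(\theta,\hat q(\hat\eta_n,\hat\tau_n))+\varepsilon\big\}=0;$$ II. all the risks $R_n(\theta,\hat q(\hat\eta^D_n,\hat\tau^D_n))$ and $R_n(\theta,\hat q(\hat\eta_n,\hat\tau_n))$ are finite, and $$\limsup_{n\to\infty}\Big[R_n\big(\theta,\hat q(\hat\eta^D_n,\hat\tau^D_n)\big)-R_n\big(\theta,\hat q(\hat\eta_n,\hat\tau_n)\big)\Big]\le0.$$ -/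

import Mathlib

open MeasureTheory ProbabilityTheory Filter Topology
open scoped ENNReal

noncomputable section

namespace CheckLoss

/-- The known quantities of the one-step Gaussian predictive model: for every coordinate `i` the
underestimation weight `b i` and the overestimation weight `h i` of the check loss, the variance
`varP i` of the past `X_i` and the variance `varF i` of the future `Y_i`. -/
structure Model where
  b : ℕ → ℝ
  h : ℕ → ℝ
  varP : ℕ → ℝ
  varF : ℕ → ℝ
  b_pos : ∀ i, 0 < b i
  h_pos : ∀ i, 0 < h i
  varP_pos : ∀ i, 0 < varP i
  varF_pos : ∀ i, 0 < varF i

/-- The standard normal density. -/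
def phi (x : ℝ) : ℝ := gaussianPDFReal 0 1 x

/-- The standard normal distribution function. -/
def Phi (x : ℝ) : ℝ := cdf (gaussianReal 0 1) x

/-- The standard normal quantile function (the inverse of `Phi` on `(0, 1)`). -/
def PhiInv (β : ℝ) : ℝ := sInf {x : ℝ | β ≤ Phi x}

/-- `G(w, β) = φ(w) + w Φ(w) - β w`. -/
def G (w β : ℝ) : ℝ := phi w + w * Phi w - β * w

/-- The `k`-th probabilists' Hermite polynomial as a real function. -/
def H (k : ℕ) (x : ℝ) : ℝ := Polynomial.aeval x (Polynomial.hermite k)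

/-- `a_n = log log n`. -/
def aSeq (n : ℕ) : ℝ := Real.log (Real.log n)

namespace Model

variable (M : Model)

/-- The critical ratio `b_i / (b_i + h_i)`. -/
def bt (i : ℕ) : ℝ := M.b i / (M.b i + M.h i)

/-- Bounded weights of the loss: the critical ratios stay away from `0` and `1`, and
`sup_i (b_i + h_i)` is finite. -/
def AssumptionA1 : Prop :=
  (∃ β₀ : ℝ, 0 < β₀ ∧ ∀ i, β₀ ≤ M.bt i) ∧
  (∃ β₁ : ℝ, β₁ < 1 ∧ ∀ i, M.bt i ≤ β₁) ∧
  (∃ B : ℝ, ∀ i, M.b i + M.h i ≤ B)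

/-- Sufficient historical data: `sup_i varP i / varF i < 1 / (4 e)`, `sup_i varF i < ∞` and
`inf_i varP i > 0`. -/
def AssumptionA3 : Prop :=
  (∃ ρ : ℝ, ρ < 1 / (4 * Real.exp 1) ∧ ∀ i, M.varP i / M.varF i ≤ ρ) ∧
  (∃ B : ℝ, ∀ i, M.varF i ≤ B) ∧
  (∃ s : ℝ, 0 < s ∧ ∀ i, s ≤ M.varP i)

/-- The law of the observed past: independent `X_i ∼ N(θ_i, varP i)`, `i < n`. -/
def dataLaw (θ : ℕ → ℝ) (n : ℕ) : Measure (Fin n → ℝ) :=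
  Measure.pi fun i : Fin n => gaussianReal (θ i) (M.varP i).toNNReal

/-- The predictive loss of the prediction `q` in coordinate `i`, the expected check loss over
the future `Y_i ∼ N(t, varF i)`. -/
def coordLoss (i : ℕ) (t q : ℝ) : ℝ :=
  ∫ y, (M.b i * max (y - q) 0 + M.h i * max (q - y) 0) ∂(gaussianReal t (M.varF i).toNNReal)

/-- The average loss `L_n(θ, q)`. -/
def loss (θ : ℕ → ℝ) (n : ℕ) (q : Fin n → ℝ) : ℝ :=
  (1 / (n : ℝ)) * ∑ i : Fin n, M.coordLoss i (θ i) (q i)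

/-- The predictive risk `R_n(θ, q)` of a predictor `q`, a function of the past data. -/
def risk (θ : ℕ → ℝ) (n : ℕ) (q : (Fin n → ℝ) → Fin n → ℝ) : ℝ :=
  ∫ x, M.loss θ n (q x) ∂(M.dataLaw θ n)

/-- The shrinkage factor `α_i(τ) = τ / (τ + varP i)` for `τ ∈ [0, ∞]`, with `α_i(∞) = 1`. -/
def shrink (i : ℕ) (τ : ℝ≥0∞) : ℝ :=
  if τ = ∞ then 1 else τ.toReal / (τ.toReal + M.varP i)

/-- The predictor with location hyperparameter `η` and scale hyperparameter `τ`, evaluated at the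
data `x`. -/
def qhat {n : ℕ} (η : ℝ) (τ : ℝ≥0∞) (x : Fin n → ℝ) (i : Fin n) : ℝ :=
  M.shrink i τ * x i + (1 - M.shrink i τ) * η +
    √(M.varF i + M.shrink i τ * M.varP i) * PhiInv (M.bt i)

/-- The intercept `c_i(τ)`. -/
def cCoef (i : ℕ) (τ : ℝ≥0∞) : ℝ :=
  √((M.varF i + M.shrink i τ * M.varP i) / (M.varF i + M.shrink i τ ^ 2 * M.varP i)) *
    PhiInv (M.bt i)

/-- The slope `d_i(τ)`. -/
def dCoef (i : ℕ) (τ : ℝ≥0∞) : ℝ :=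
  -(1 - M.shrink i τ) / √(M.varF i + M.varP i * M.shrink i τ ^ 2)

/-- The admissible threshold constants: `γ i` is less than `1/√(4e) - √(varP i / varF i)`, and
positive, uniformly in `i`. -/
def AdmissibleGamma (γ : ℕ → ℝ) : Prop :=
  (∃ γ₀ : ℝ, 0 < γ₀ ∧ ∀ i, γ₀ ≤ γ i) ∧
  ∀ i, γ i < 1 / √(4 * Real.exp 1) - √(M.varP i / M.varF i)

/-- The threshold `λ_n(i) = γ(i) √(2 log n)`. -/
def thr (γ : ℕ → ℝ) (n i : ℕ) : ℝ := γ i * √(2 * Real.log n)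

/-- The truncation order `K_n(i) = 1 + ⌈e² (γ(i) + √(2 varP i / varF i))² (2 log n)⌉`. -/
def order (γ : ℕ → ℝ) (n i : ℕ) : ℕ :=
  1 + ⌈Real.exp 1 ^ 2 * (γ i + √(2 * M.varP i / M.varF i)) ^ 2 * (2 * Real.log n)⌉₊

end Model

/-- `s^k H_k(u / s)`, read as its limit `u^k` when `s = 0`. -/
def scaledH (k : ℕ) (s u : ℝ) : ℝ := if s = 0 then u ^ k else s ^ k * H k (u / s)

namespace Model

variable (M : Model)

/-- The Hermite estimate `S_i` of the Taylor polynomial of `G(·, bt i)` of order `K_n(i)`, at the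
value `u` of `U_i(τ)`; the standard deviation of `U_i(τ)` is `√(2 varP i d_i(τ)²)`. -/
def hermiteEst (γ : ℕ → ℝ) (n i : ℕ) (τ : ℝ≥0∞) (u : ℝ) : ℝ :=
  G 0 (M.bt i) + deriv (fun w => G w (M.bt i)) 0 * u +
    phi 0 * ∑ k ∈ Finset.range (M.order γ n i - 1),
      (-1) ^ k * H k 0 / ((k + 2).factorial : ℝ) *
        scaledH (k + 2) √(2 * M.varP i * M.dCoef i τ ^ 2) u

/-- The Hermite estimate truncated to `[-n, n]`. -/
def truncEst (γ : ℕ → ℝ) (n i : ℕ) (τ : ℝ≥0∞) (u : ℝ) : ℝ :=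
  max (-(n : ℝ)) (min (M.hermiteEst γ n i τ u) n)

/-- `U_i(τ) = c_i(τ) + d_i(τ) (x + √varP_i z)`. -/
def uStat (i : ℕ) (τ : ℝ≥0∞) (x z : ℝ) : ℝ :=
  M.cCoef i τ + M.dCoef i τ * (x + √(M.varP i) * z)

/-- `V_i(τ) = c_i(τ) + d_i(τ) (x - √varP_i z)`. -/
def vStat (i : ℕ) (τ : ℝ≥0∞) (x z : ℝ) : ℝ :=
  M.cCoef i τ + M.dCoef i τ * (x - √(M.varP i) * z)

/-- The randomized threshold estimate of coordinate `i`, with added noise `z`. -/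
def thrEst (γ : ℕ → ℝ) (n i : ℕ) (τ : ℝ≥0∞) (x z : ℝ) : ℝ :=
  if M.vStat i τ x z < -thr γ n i then -M.bt i * M.uStat i τ x z
  else if M.vStat i τ x z ≤ thr γ n i then M.truncEst γ n i τ (M.uStat i τ x z)
  else (1 - M.bt i) * M.uStat i τ x z

/-- The threshold estimate averaged over the added standard normal noise. -/
def rbEst (γ : ℕ → ℝ) (n i : ℕ) (τ : ℝ≥0∞) (x : ℝ) : ℝ :=
  ∫ z, M.thrEst γ n i τ x z ∂(gaussianReal 0 1)

/-- The asymptotic risk estimate of the predictors that shrink towards the origin. -/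
def ARE (γ : ℕ → ℝ) (n : ℕ) (τ : ℝ≥0∞) (x : Fin n → ℝ) : ℝ :=
  (1 / (n : ℝ)) * ∑ i : Fin n, (M.b i + M.h i) *
    √(M.varF i + M.varP i * M.shrink i τ ^ 2) * M.rbEst γ n i τ (x i)

/-- The asymptotic risk estimate of the predictors that shrink towards `η`. -/
def ARED (γ : ℕ → ℝ) (n : ℕ) (η : ℝ) (τ : ℝ≥0∞) (x : Fin n → ℝ) : ℝ :=
  M.ARE γ n τ (fun i => x i - η)

/-- The sample quantile `inf {t : F_n(t) ≥ α}`, with `F_n` the empirical distribution function. -/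
def sampleQuantile {n : ℕ} (x : Fin n → ℝ) (α : ℝ) : ℝ :=
  sInf {t : ℝ | α ≤ (Nat.card {i : Fin n // x i ≤ t} : ℝ) / n}

/-- The data-quantile interval `[m_n(α₁), m_n(α₂)]`, where `α₁` and `α₂` are the smallest and the
largest critical ratio among the first `n` coordinates. -/
def quantileInterval {n : ℕ} (x : Fin n → ℝ) : Set ℝ :=
  Set.Icc (sampleQuantile x (⨅ i : Fin n, M.bt i)) (sampleQuantile x (⨆ i : Fin n, M.bt i))

/-- The constants that enter the mesh of the grids. -/
structure GridConstants where
  C₁ : ℝ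
  C₂ : ℝ
  C₃ : ℝ
  C₄ : ℝ
  weight_le : ∀ i, M.b i + M.h i ≤ C₁
  varP_le : ∀ i, M.varP i ≤ C₂
  inv_varP_le : ∀ i, (M.varP i)⁻¹ ≤ C₂
  ratio_le : ∀ i j, M.varP i / M.varF i * |PhiInv (M.bt j)| ≤ C₃
  C₄_pos : 0 < C₄

namespace GridConstants

variable {M : Model} (C : M.GridConstants)

/-- The mesh of the location grid. -/
def mesh1 (n : ℕ) : ℝ := (2 * C.C₁ * aSeq n)⁻¹

/-- The mesh of the scale grid, in the variable `τ / (τ + 1)`. -/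
def mesh2 (n : ℕ) : ℝ :=
  (2 * C.C₁ * C.C₂ * (2 * phi 0 + C.C₃ + √(aSeq n) * C.C₄ + aSeq n + aSeq n ^ 2))⁻¹

/-- The location grid, equispaced in `[-a_n, a_n]`. -/
def grid1 (n : ℕ) : Set ℝ :=
  {η | η ∈ Set.Icc (-aSeq n) (aSeq n) ∧ ∃ k : ℕ, η = -aSeq n + k * C.mesh1 n}

/-- The scale grid: the `τ` for which `τ / (τ + 1)` is one of the points `k δ`, where
`0 ≤ k < ⌈1 / δ⌉` and `δ` is the mesh. -/
def grid2 (n : ℕ) : Set ℝ≥0∞ :=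
  {τ | ∃ k : ℕ, k < ⌈1 / C.mesh2 n⌉₊ ∧
    τ = ENNReal.ofReal (k * C.mesh2 n / (1 - k * C.mesh2 n))}

/-- The data-dependent set of grid points over which the risk estimate is minimized. -/
def searchSet {n : ℕ} (x : Fin n → ℝ) : Set (ℝ × ℝ≥0∞) :=
  (C.grid1 n ∩ M.quantileInterval x) ×ˢ C.grid2 n

/-- `(ηD, τD)` are the tuned hyperparameters: `ηD` lies in the data-quantile interval, and
whenever the search set is not empty `(ηD, τD)` minimizes the risk estimate over it. (The search
set can be empty; then nothing else is required.) -/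
def IsTuned (γ : ℕ → ℝ) (ηD : ∀ n : ℕ, (Fin n → ℝ) → ℝ)
    (τD : ∀ n : ℕ, (Fin n → ℝ) → ℝ≥0∞) : Prop :=
  ∀ (n : ℕ) (x : Fin n → ℝ), ηD n x ∈ M.quantileInterval x ∧
    ((C.searchSet x).Nonempty →
      (ηD n x, τD n x) ∈ C.searchSet x ∧
      ∀ p ∈ C.searchSet x, M.ARED γ n (ηD n x) (τD n x) x ≤ M.ARED γ n p.1 p.2 x)

end GridConstants

end Model

/-- Bounded parametric space: `limsup_n (1/n) ∑_{i<n} |θ_i| < ∞`. -/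
def AssumptionA2 (θ : ℕ → ℝ) : Prop :=
  ∃ C : ℝ, ∀ᶠ n : ℕ in atTop, (1 / (n : ℝ)) * ∑ i ∈ Finset.range n, |θ i| ≤ C

end CheckLoss

end

namespace CheckLoss

/-! The tuned pair minimizes an estimate of the loss. It therefore suffices that the estimate is
close to the loss at all grid points simultaneously, and that every competitor has a grid point of
the search set nearby at which the loss is almost the same.

One coordinate. Averaged over the data, the loss of a fixed predictor is a scale factor times G(ω,
β), where ω is the mean of U and β the critical ratio (`integral_coordLoss_qcoord`). The added noise
makes U and V independent copies with mean ω (`map_rotation_std`): V selects the regime and U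
supplies the estimate. In the outer regimes G is close to one of its linear asymptotes. In the
middle regime Hermite polynomials estimate the powers of ω without bias (`normalMean_hermiteVar`),
so the estimate has a Taylor polynomial of G as its mean; the bound 1/(4e) on the variance ratio
controls its second moment (`taylorCoef_sq_mul_normalMean_le`). With L = √(2 log n), the resulting
bias is O(1/L) and the mean square error is O(n/L), uniformly in θ, η and τ (`ruleOf_bounds`).

Average. The coordinates are independent, so by Chebyshev an error of size ε at a fixed (η, τ) has
probability O(1/L). The number of grid points is polynomial in a_n = log log n, while L ≥ exp(a_n /
2), so a union bound over the grid still tends to zero (`tendsto_gridBound_mul`).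

Discretization. The loss is Lipschitz in η and in τ/(τ+1), with constants governed by the average of
|X_i|. With high probability the data-quantile interval lies in [-a_n, a_n], by Markov's inequality,
and is longer than two meshes: as the critical ratios differ, a fixed fraction of the data lies in
or near it, whereas bounded densities allow only few close pairs (`measure_short_interval_le`). On
these events `loss_lt_of_isTuned` gives the comparison for all (η, τ) at once, so the competitor may
depend on the data.

Risk. The second moments of the losses are eventually bounded in n, so convergence in probability
passes to expectations (`integral_le_of_sq_le`). -/

/-! ### The standard normal law and the function G -/

lemma phi_eq (x : ℝ) : phi x = (√(2 * Real.pi))⁻¹ * Real.exp (-x ^ 2 / 2) := by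
  simp [phi, gaussianPDFReal_def]

lemma phi_eq_phi_zero_mul (x : ℝ) : phi x = phi 0 * Real.exp (-x ^ 2 / 2) := by
  simp [phi_eq]

lemma phi_pos (x : ℝ) : 0 < phi x := gaussianPDFReal_pos _ _ _ one_ne_zero

lemma phi_neg (x : ℝ) : phi (-x) = phi x := by simp [phi_eq]

lemma phi_zero_le : phi 0 ≤ 1 / 2 := by
  rw [phi_eq]
  have : (2 : ℝ) ≤ √(2 * Real.pi) := Real.le_sqrt_of_sq_le (by nlinarith [Real.pi_gt_three])
  simpa using inv_anti₀ (by norm_num) this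

lemma phi_le_phi_zero (x : ℝ) : phi x ≤ phi 0 := by
  rw [phi_eq_phi_zero_mul]
  exact mul_le_of_le_one_right (phi_pos 0).le (Real.exp_le_one_iff.2 (by nlinarith [sq_nonneg x]))

lemma hasDerivAt_phi (x : ℝ) : HasDerivAt phi (-x * phi x) x := by
  have h : phi = fun x => (√(2 * Real.pi))⁻¹ * Real.exp (-x ^ 2 / 2) := funext phi_eq
  rw [h]
  have h1 : HasDerivAt (fun x : ℝ => -x ^ 2 / 2) (-x) x := by
    have := ((hasDerivAt_pow 2 x).neg).div_const 2
    exact this.congr_deriv (by norm_num; ring)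
  exact (h1.exp.const_mul (√(2 * Real.pi))⁻¹).congr_deriv (by ring)

lemma continuous_phi : Continuous phi :=
  continuous_iff_continuousAt.2 fun x => (hasDerivAt_phi x).continuousAt

lemma integrable_phi : Integrable phi := integrable_gaussianPDFReal 0 1

lemma integral_gaussian_eq (f : ℝ → ℝ) : ∫ z, f z ∂(gaussianReal 0 1) = ∫ z, phi z * f z := by
  rw [integral_gaussianReal_eq_integral_smul one_ne_zero]; rfl

lemma integrable_gaussian_iff (f : ℝ → ℝ) :
    Integrable f (gaussianReal 0 1) ↔ Integrable (fun z => phi z * f z) := by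
  rw [gaussianReal_of_var_ne_zero _ one_ne_zero,
    integrable_withDensity_iff_integrable_smul' (measurable_gaussianPDF _ _)
      (ae_of_all _ fun _ => gaussianPDF_lt_top)]
  simp only [toReal_gaussianPDF, smul_eq_mul, phi]

lemma integrable_pow_gaussian (n : ℕ) (m : ℝ) (v : NNReal) :
    Integrable (fun z : ℝ => z ^ n) (gaussianReal m v) := by
  have h := (memLp_id_gaussianReal (μ := m) (v := v) (n : NNReal)).integrable_norm_pow'
  refine h.mono' (by fun_prop) (ae_of_all _ fun z => ?_)
  simp

lemma integrable_polynomial_gaussian (p : Polynomial ℝ) (m : ℝ) (v : NNReal) :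
    Integrable (fun z : ℝ => p.eval z) (gaussianReal m v) := by
  simp only [Polynomial.eval_eq_sum_range]
  exact integrable_finsetSum _ fun i _ => (integrable_pow_gaussian i m v).const_mul _

/-- Gaussian integration by parts for polynomials. -/
lemma integral_mul_polynomial (p : Polynomial ℝ) :
    ∫ z, z * p.eval z ∂(gaussianReal 0 1) =
      ∫ z, (Polynomial.derivative p).eval z ∂(gaussianReal 0 1) := by
  have hp := (integrable_gaussian_iff _).1 (integrable_polynomial_gaussian p 0 1)
  have hd := (integrable_gaussian_iff _).1
    (integrable_polynomial_gaussian (Polynomial.derivative p) 0 1)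
  have hx : Integrable (fun z => phi z * (z * p.eval z)) := by
    have := (integrable_gaussian_iff _).1 (integrable_polynomial_gaussian (Polynomial.X * p) 0 1)
    simpa using this
  have h0 := integral_eq_zero_of_hasDerivAt_of_integrable
    (f := fun z => phi z * p.eval z)
    (f' := fun z => phi z * (Polynomial.derivative p).eval z - phi z * (z * p.eval z))
    (fun z => ((hasDerivAt_phi z).mul (p.hasDerivAt z)).congr_deriv (by ring)) (hd.sub hx) hp
  rw [integral_sub hd hx] at h0
  rw [integral_gaussian_eq, integral_gaussian_eq]
  linarith

lemma Phi_eq_integral (x : ℝ) : Phi x = ∫ t in Set.Iic x, phi t := by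
  rw [Phi, cdf_eq_real, measureReal_def, gaussianReal_apply_eq_integral _ one_ne_zero,
    ENNReal.toReal_ofReal (setIntegral_nonneg measurableSet_Iic
      fun _ _ => gaussianPDFReal_nonneg _ _ _)]
  rfl

lemma hasDerivAt_Phi (x : ℝ) : HasDerivAt Phi (phi x) x := by
  have h : Phi = fun x => Phi 0 + ∫ t in (0 : ℝ)..x, phi t := by
    ext x
    rw [Phi_eq_integral, Phi_eq_integral, ← intervalIntegral.integral_Iic_sub_Iic
      integrable_phi.integrableOn integrable_phi.integrableOn]
    ring
  rw [h]
  exact (intervalIntegral.integral_hasDerivAt_right (integrable_phi.intervalIntegrable)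
    (continuous_phi.stronglyMeasurableAtFilter _ _) continuous_phi.continuousAt).const_add _

lemma Phi_nonneg (x : ℝ) : 0 ≤ Phi x := cdf_nonneg _ _

lemma Phi_le_one (x : ℝ) : Phi x ≤ 1 := cdf_le_one _ _

lemma integral_Ioi_phi (x : ℝ) : ∫ t in Set.Ioi x, phi t = Phi (-x) := by
  rw [Phi_eq_integral, ← integral_comp_neg_Ioi]
  simp [phi_neg]

lemma integral_phi : ∫ t, phi t = 1 := integral_gaussianPDFReal_eq_one 0 one_ne_zero

lemma Phi_add_Phi_neg (x : ℝ) : Phi x + Phi (-x) = 1 := by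
  rw [Phi_eq_integral, ← integral_Ioi_phi, ← integral_phi,
    ← intervalIntegral.integral_Iic_add_Ioi integrable_phi.integrableOn
      integrable_phi.integrableOn]

lemma integrable_mul_phi : Integrable (fun t => phi t * t) := by
  have := (integrable_gaussian_iff _).1 (integrable_pow_gaussian 1 0 1)
  simpa using this

lemma tendsto_phi_atTop : Tendsto phi atTop (𝓝 0) := by
  have h : phi = fun x => (√(2 * Real.pi))⁻¹ * Real.exp (-x ^ 2 / 2) := funext phi_eq
  rw [h, ← mul_zero (√(2 * Real.pi))⁻¹]
  refine Tendsto.const_mul _ (Real.tendsto_exp_atBot.comp ?_)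
  have : Tendsto (fun x : ℝ => x ^ 2 / 2) atTop atTop :=
    (tendsto_pow_atTop two_ne_zero).atTop_div_const two_pos
  refine (tendsto_neg_atTop_atBot.comp this).congr fun x => ?_
  simp [neg_div]

lemma integral_Ioi_mul_phi (t : ℝ) : ∫ z in Set.Ioi t, phi z * z = phi t := by
  have := integral_Ioi_of_hasDerivAt_of_tendsto' (a := t) (f := fun z => -phi z)
    (f' := fun z => phi z * z) (m := 0)
    (fun z _ => (hasDerivAt_phi z).neg.congr_deriv (by ring))
    integrable_mul_phi.integrableOn (by simpa using tendsto_phi_atTop.neg)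
  simpa using this

/-- The mean of the positive part of a normal variable with unit variance. -/
noncomputable def normalExcess (w : ℝ) : ℝ := phi w + w * Phi w

/-- Only z > -w contributes, which leaves w P(Z > -w) plus the mean of Z on that event; the latter
is φ(w), because -φ is a primitive of zφ(z). -/
lemma integral_max_add (w : ℝ) : ∫ z, max (w + z) 0 ∂(gaussianReal 0 1) = normalExcess w := by
  rw [integral_gaussian_eq]
  have h : (fun z => phi z * max (w + z) 0) =
      (Set.Ioi (-w)).indicator (fun z => w * phi z + phi z * z) := by
    ext z
    by_cases hz : -w < z
    · rw [Set.indicator_of_mem (by exact hz), max_eq_left (by linarith)]; ring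
    · rw [Set.indicator_of_notMem (by exact hz), max_eq_right (by linarith), mul_zero]
  rw [h, integral_indicator measurableSet_Ioi, integral_add
    (integrable_phi.const_mul w).integrableOn integrable_mul_phi.integrableOn,
    integral_const_mul, integral_Ioi_phi, integral_Ioi_mul_phi, phi_neg, normalExcess, neg_neg]
  ring

lemma normalExcess_nonneg (w : ℝ) : 0 ≤ normalExcess w := by
  rw [← integral_max_add]
  exact integral_nonneg fun z => le_max_right _ _

/-- The mean of the identity y⁺ - y⁻ = y. It shows that the asymptotes -βw and (1-β)w miss G by
exactly `normalExcess w` and `normalExcess (-w)`. -/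
lemma normalExcess_sub_neg (w : ℝ) : normalExcess w - normalExcess (-w) = w := by
  have := Phi_add_Phi_neg w
  simp only [normalExcess, phi_neg]
  linear_combination w * this

lemma normalExcess_le (w : ℝ) : normalExcess w ≤ phi w + max w 0 := by
  have := Phi_nonneg w
  have := Phi_le_one w
  rw [normalExcess]
  rcases le_total w 0 with h | h
  · rw [max_eq_right h]; nlinarith
  · rw [max_eq_left h]; nlinarith

lemma G_eq (w β : ℝ) : G w β = normalExcess w - β * w := rfl

lemma hasDerivAt_G (w β : ℝ) : HasDerivAt (fun w => G w β) (Phi w - β) w := by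
  have := ((hasDerivAt_phi w).add ((hasDerivAt_id w).mul (hasDerivAt_Phi w))).sub
    ((hasDerivAt_id w).const_mul β)
  exact this.congr_deriv (by simp)

lemma deriv_G (w β : ℝ) : deriv (fun w => G w β) w = Phi w - β := (hasDerivAt_G w β).deriv

/-- The Mills bound: beyond t the constant t is at most z, and zφ(z) integrates to φ(t). -/
lemma measure_Ici_le {t : ℝ} (ht : 0 < t) :
    (gaussianReal 0 1).real (Set.Ioi t) ≤ phi t / t := by
  rw [le_div_iff₀ ht, measureReal_def, gaussianReal_apply_eq_integral _ one_ne_zero,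
    ENNReal.toReal_ofReal (setIntegral_nonneg measurableSet_Ioi
      fun _ _ => gaussianPDFReal_nonneg _ _ _), ← integral_Ioi_mul_phi, ← integral_mul_const]
  refine setIntegral_mono_on (integrable_phi.mul_const t).integrableOn
    integrable_mul_phi.integrableOn measurableSet_Ioi fun z hz => ?_
  exact mul_le_mul_of_nonneg_left (le_of_lt hz) (phi_pos z).le

/-! ### Hermite polynomials with a variance parameter -/

open Polynomial in
/-- The Hermite polynomials of variance `v`. -/
noncomputable def hermiteVar (v : ℝ) : ℕ → Polynomial ℝ
  | 0 => 1
  | k + 1 => X * hermiteVar v k - C v * derivative (hermiteVar v k)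

lemma hermiteVar_zero (v : ℝ) : hermiteVar v 0 = 1 := rfl

open Polynomial in
lemma hermiteVar_succ (v : ℝ) (k : ℕ) :
    hermiteVar v (k + 1) = X * hermiteVar v k - C v * derivative (hermiteVar v k) := rfl

open Polynomial in
-- The Appell property. It turns the derivative left by Gaussian integration by parts into a Hermite
-- polynomial of lower degree.
lemma derivative_hermiteVar_succ (v : ℝ) (k : ℕ) :
    derivative (hermiteVar v (k + 1)) = C ((k : ℝ) + 1) * hermiteVar v k := by
  induction k with
  | zero => simp [hermiteVar_succ, hermiteVar_zero]
  | succ k ih =>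
    rw [hermiteVar_succ v (k + 1), derivative_sub, derivative_mul, derivative_C_mul, ih,
      derivative_C_mul, hermiteVar_succ v k]
    simp only [derivative_X, map_add, Nat.cast_add, Nat.cast_one, C_1, map_natCast]
    ring

/-- Absorbing the scale into the variance makes s = 0, which occurs for τ = ∞, an ordinary member of
one polynomial family. -/
lemma scaledH_eq_eval (k : ℕ) (s u : ℝ) : scaledH k s u = (hermiteVar (s ^ 2) k).eval u := by
  by_cases hs : s = 0
  · subst hs
    have : hermiteVar (0 ^ 2) k = Polynomial.X ^ k := by
      induction k with
      | zero => rfl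
      | succ k ih => rw [hermiteVar_succ, ih, pow_succ' Polynomial.X]; simp
    rw [scaledH, if_pos rfl, this]; simp
  · rw [scaledH, if_neg hs]
    have key : ∀ k, hermiteVar (s ^ 2) k = Polynomial.C (s ^ k) *
        ((Polynomial.hermite k).map (Int.castRingHom ℝ)).comp
          (Polynomial.C s⁻¹ * Polynomial.X) := by
      intro k
      induction k with
      | zero => simp [hermiteVar_zero]
      | succ k ih =>
        rw [hermiteVar_succ, ih, Polynomial.hermite_succ, Polynomial.derivative_C_mul]
        simp only [Polynomial.derivative_mul, Polynomial.derivative_C, zero_mul, zero_add,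
          Polynomial.derivative_comp, Polynomial.map_sub, Polynomial.map_mul,
          Polynomial.map_X, Polynomial.sub_comp, Polynomial.mul_comp, Polynomial.X_comp,
          Polynomial.derivative_X, mul_one, Polynomial.derivative_map, pow_succ s k, mul_sub, map_mul,
          map_pow]
        have : (Polynomial.C s * Polynomial.C s⁻¹ : Polynomial ℝ) = 1 := by
          rw [← map_mul, mul_inv_cancel₀ hs, map_one]
        linear_combination (Polynomial.C s ^ k * Polynomial.C s * (Polynomial.map (Int.castRingHom ℝ) (Polynomial.derivative (Polynomial.hermite k))).comp
          (Polynomial.C s⁻¹ * Polynomial.X) * (-1)- Polynomial.C s ^ k * Polynomial.X * ((Polynomial.hermite k).map (Int.castRingHom ℝ)).comp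
          (Polynomial.C s⁻¹ * Polynomial.X)) * this
    rw [key k, H]
    simp [Polynomial.aeval_def, Polynomial.eval₂_eq_eval_map, div_eq_inv_mul]

lemma H_eq_eval (k : ℕ) (x : ℝ) : H k x = (hermiteVar 1 k).eval x := by
  have := scaledH_eq_eval k 1 x
  simpa [scaledH] using this

lemma H_add_two_zero (k : ℕ) : H (k + 2) 0 = -((k : ℝ) + 1) * H k 0 := by
  rw [H_eq_eval, H_eq_eval, hermiteVar_succ, derivative_hermiteVar_succ]
  simp
  ring

lemma H_odd_zero (j : ℕ) : H (2 * j + 1) 0 = 0 := by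
  induction j with
  | zero => simp [H_eq_eval, hermiteVar_succ, hermiteVar_zero]
  | succ j ih => rw [show 2 * (j + 1) + 1 = (2 * j + 1) + 2 by ring, H_add_two_zero, ih, mul_zero]

/-- These are the coefficients of exp(-w²/2) in powers of w², so sums of Hermite values at 0 become
partial sums of an exponential series. -/
lemma H_even_zero (j : ℕ) :
    H (2 * j) 0 / ((2 * j).factorial : ℝ) = (-1 / 2) ^ j / (j.factorial : ℝ) := by
  induction j with
  | zero => simp [H_eq_eval, hermiteVar_zero]
  | succ j ih =>
    rw [show 2 * (j + 1) = 2 * j + 2 by ring, H_add_two_zero, Nat.factorial_succ,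
      Nat.factorial_succ (2 * j), Nat.factorial_succ j, pow_succ]
    have h1 : ((2 * j).factorial : ℝ) ≠ 0 := by positivity
    have h2 : (j.factorial : ℝ) ≠ 0 := by positivity
    rw [div_eq_div_iff h1 h2] at ih
    rw [div_eq_div_iff (by positivity) (by positivity)]
    push_cast
    linear_combination (-(2 * (j : ℝ) + 1) * (j + 1)) * ih

/-! ### Polynomial moments of a normal variable -/

/-- The mean of a polynomial in a normal variable with mean `ω` and standard deviation `|t|`. -/
noncomputable def normalMean (ω t : ℝ) (q : Polynomial ℝ) : ℝ :=
  ∫ z, q.eval (ω + t * z) ∂(gaussianReal 0 1)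

lemma integrable_eval_affine (ω t : ℝ) (q : Polynomial ℝ) :
    Integrable (fun z => q.eval (ω + t * z)) (gaussianReal 0 1) := by
  have := integrable_polynomial_gaussian
    (q.comp (Polynomial.C ω + Polynomial.C t * Polynomial.X)) 0 1
  simpa using this

lemma normalMean_add (ω t : ℝ) (p q : Polynomial ℝ) :
    normalMean ω t (p + q) = normalMean ω t p + normalMean ω t q := by
  simp only [normalMean, Polynomial.eval_add]
  exact integral_add (integrable_eval_affine _ _ _) (integrable_eval_affine _ _ _)

lemma normalMean_C_mul (ω t c : ℝ) (q : Polynomial ℝ) :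
    normalMean ω t (Polynomial.C c * q) = c * normalMean ω t q := by
  simp only [normalMean, Polynomial.eval_mul, Polynomial.eval_C]
  exact integral_const_mul _ _

lemma normalMean_one (ω t : ℝ) : normalMean ω t 1 = 1 := by simp [normalMean]

/-- Stein's identity for N(ω, t²), obtained from the standard normal case by an affine substitution.
-/
lemma normalMean_X_mul (ω t : ℝ) (q : Polynomial ℝ) :
    normalMean ω t (Polynomial.X * q) =
      ω * normalMean ω t q + t ^ 2 * normalMean ω t (Polynomial.derivative q) := by
  have h := integral_mul_polynomial (q.comp (Polynomial.C ω + Polynomial.C t * Polynomial.X))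
  simp only [Polynomial.eval_comp, Polynomial.derivative_comp, Polynomial.eval_mul,
    Polynomial.eval_add, Polynomial.eval_C, Polynomial.eval_X, Polynomial.derivative_add,
    Polynomial.derivative_C, Polynomial.derivative_mul, Polynomial.derivative_X, zero_mul,
    zero_add, mul_one] at h
  rw [integral_const_mul] at h
  have hz : Integrable (fun z => z * q.eval (ω + t * z)) (gaussianReal 0 1) := by
    have := integrable_polynomial_gaussian
      (Polynomial.X * q.comp (Polynomial.C ω + Polynomial.C t * Polynomial.X)) 0 1
    simpa using this
  have h2 : normalMean ω t (Polynomial.X * q) =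
      ω * normalMean ω t q + t * ∫ z, z * q.eval (ω + t * z) ∂(gaussianReal 0 1) := by
    rw [normalMean, normalMean, ← integral_const_mul, ← integral_const_mul, ← integral_add
      ((integrable_eval_affine _ _ _).const_mul _) (hz.const_mul _)]
    congr 1; ext z
    simp only [Polynomial.eval_mul, Polynomial.eval_X]; ring
  rw [h2, h, normalMean, normalMean]; ring

/-- The derivative of the Hermite factor produced by Stein's identity cancels the one in the Hermite
recursion; only the derivative of q survives. -/
lemma normalMean_hermiteVar_succ_mul (ω t : ℝ) (k : ℕ) (q : Polynomial ℝ) :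
    normalMean ω t (hermiteVar (t ^ 2) (k + 1) * q) =
      ω * normalMean ω t (hermiteVar (t ^ 2) k * q) +
        t ^ 2 * normalMean ω t (hermiteVar (t ^ 2) k * Polynomial.derivative q) := by
  have h : hermiteVar (t ^ 2) (k + 1) * q = Polynomial.X * (hermiteVar (t ^ 2) k * q) +
      Polynomial.C (-t ^ 2) * (Polynomial.derivative (hermiteVar (t ^ 2) k) * q) := by
    rw [hermiteVar_succ, Polynomial.C_neg]; ring
  rw [h, normalMean_add, normalMean_X_mul, normalMean_C_mul, Polynomial.derivative_mul,
    normalMean_add]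
  ring

/-- With q = 1 in the recursion, each degree just contributes a factor ω: this is the unbiasedness
behind the Hermite estimate. -/
lemma normalMean_hermiteVar (ω t : ℝ) (k : ℕ) :
    normalMean ω t (hermiteVar (t ^ 2) k) = ω ^ k := by
  induction k with
  | zero => rw [hermiteVar_zero, normalMean_one, pow_zero]
  | succ k ih =>
    have := normalMean_hermiteVar_succ_mul ω t k 1
    simp only [mul_one, ih, Polynomial.derivative_one, mul_zero] at this
    rw [this]
    simp [normalMean, pow_succ, mul_comm]

/-- Each step of the recursion either multiplies by ω or, by the Appell property, multiplies by t²m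
and lowers m. Lowering m costs a factor 1/W in the bound, so a step is worth at most W + t²N/W. The
fixed cap N keeps this base constant along the induction on k. -/
lemma abs_normalMean_hermiteVar_mul_le {ω W : ℝ} (t : ℝ) (hW : 0 < W) (hω : |ω| ≤ W) (N k : ℕ) :
    ∀ m ≤ N, |normalMean ω t (hermiteVar (t ^ 2) k * hermiteVar (t ^ 2) m)| ≤
      (W + t ^ 2 * N / W) ^ k * W ^ m := by
  have hX : 0 ≤ W + t ^ 2 * N / W := by positivity
  induction k with
  | zero =>
    intro m _
    rw [hermiteVar_zero, one_mul, normalMean_hermiteVar, pow_zero, one_mul, abs_pow]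
    exact pow_le_pow_left₀ (abs_nonneg _) hω m
  | succ k ih =>
    intro m hm
    rw [normalMean_hermiteVar_succ_mul]
    have h1 : |ω * normalMean ω t (hermiteVar (t ^ 2) k * hermiteVar (t ^ 2) m)| ≤
        W * ((W + t ^ 2 * N / W) ^ k * W ^ m) := by
      rw [abs_mul]
      exact mul_le_mul hω (ih m hm) (abs_nonneg _) hW.le
    have h2 : |t ^ 2 * normalMean ω t (hermiteVar (t ^ 2) k *
        Polynomial.derivative (hermiteVar (t ^ 2) m))| ≤
        (t ^ 2 * N / W) * ((W + t ^ 2 * N / W) ^ k * W ^ m) := by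
      cases m with
      | zero =>
        simp only [hermiteVar_zero, Polynomial.derivative_one, mul_zero]
        simp only [normalMean, Polynomial.eval_zero, integral_zero, mul_zero, abs_zero]
        positivity
      | succ m =>
        rw [derivative_hermiteVar_succ, mul_left_comm, normalMean_C_mul, abs_mul, abs_mul,
          abs_of_nonneg (sq_nonneg t), abs_of_nonneg (by positivity : (0 : ℝ) ≤ m + 1)]
        have hm' : (m : ℝ) + 1 ≤ N := by exact_mod_cast hm
        have hb := ih m (by lia)
        calc t ^ 2 * (((m : ℝ) + 1) *
              |normalMean ω t (hermiteVar (t ^ 2) k * hermiteVar (t ^ 2) m)|)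
            ≤ t ^ 2 * (N * ((W + t ^ 2 * N / W) ^ k * W ^ m)) := by gcongr
          _ = _ := by field_simp; ring
    calc _ ≤ _ := abs_add_le _ _
      _ ≤ _ := add_le_add h1 h2
      _ = _ := by ring

lemma normalMean_hermiteVar_sq_le {ω W : ℝ} (t : ℝ) (hW : 0 < W) (hω : |ω| ≤ W) (k : ℕ) :
    normalMean ω t (hermiteVar (t ^ 2) k * hermiteVar (t ^ 2) k) ≤ (W ^ 2 + k * t ^ 2) ^ k := by
  refine (le_abs_self _).trans ((abs_normalMean_hermiteVar_mul_le t hW hω k k k le_rfl).trans ?_)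
  rw [← mul_pow]
  apply le_of_eq
  congr 1
  field_simp

/-! ### Taylor approximation of G -/

/-- The `(k + 2)`-nd Taylor coefficient of `G` at the origin, divided by `φ(0)`. -/
noncomputable def taylorCoef (k : ℕ) : ℝ := (-1) ^ k * H k 0 / ((k + 2).factorial : ℝ)

/-- The Taylor polynomial of `G(·, β)` of degree `N + 1` at the origin. -/
noncomputable def taylorG (β : ℝ) (N : ℕ) (w : ℝ) : ℝ :=
  G 0 β + (Phi 0 - β) * w + phi 0 * ∑ k ∈ Finset.range N, taylorCoef k * w ^ (k + 2)

lemma sum_hermite_zero_even (w : ℝ) (J : ℕ) :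
    ∑ k ∈ Finset.range (2 * J), (-1) ^ k * H k 0 / (k.factorial : ℝ) * w ^ k =
      ∑ j ∈ Finset.range J, (-(w ^ 2 / 2)) ^ j / (j.factorial : ℝ) := by
  induction J with
  | zero => simp
  | succ J ih =>
    rw [show 2 * (J + 1) = 2 * J + 1 + 1 by ring, Finset.sum_range_succ, Finset.sum_range_succ, ih,
      Finset.sum_range_succ, H_odd_zero, mul_div_assoc, H_even_zero]
    simp only [pow_mul, neg_one_sq, one_pow]
    rw [show (-(w ^ 2 / 2)) = (-1 / 2) * w ^ 2 by ring, mul_pow]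
    ring

/-- The odd terms vanish, so N may be rounded up to an even number. -/
lemma exists_sum_hermite_zero (w : ℝ) (N : ℕ) : ∃ J : ℕ, N ≤ 2 * J ∧
    ∑ k ∈ Finset.range N, (-1) ^ k * H k 0 / (k.factorial : ℝ) * w ^ k =
      ∑ j ∈ Finset.range J, (-(w ^ 2 / 2)) ^ j / (j.factorial : ℝ) := by
  obtain ⟨J, rfl | rfl⟩ := N.even_or_odd'
  · exact ⟨J, le_rfl, sum_hermite_zero_even w J⟩
  · refine ⟨J + 1, by lia, ?_⟩
    rw [← sum_hermite_zero_even, show 2 * (J + 1) = 2 * J + 1 + 1 by ring,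
      Finset.sum_range_succ _ (2 * J + 1), H_odd_zero]
    simp

lemma pow_div_factorial_le {x : ℝ} (hx : 0 ≤ x) {J : ℕ} (hJ : 0 < J) :
    x ^ J / (J.factorial : ℝ) ≤ (Real.exp 1 * x / J) ^ J := by
  have h1 := Real.pow_div_factorial_le_exp (x := (J : ℝ)) (Nat.cast_nonneg J) J
  have hJ' : (0 : ℝ) < (J : ℝ) ^ J := by positivity
  rw [div_pow, mul_pow, ← Real.exp_nat_mul, mul_one, le_div_iff₀ hJ']
  calc x ^ J / (J.factorial : ℝ) * (J : ℝ) ^ J = ((J : ℝ) ^ J / J.factorial) * x ^ J := by ring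
    _ ≤ _ := by gcongr

/-- The remainder is at most 2x^J/J!, hence 2(ex/J)^J, and J ≥ e²x makes the base at most 1/e. This
accounts for the factor e² in the truncation order. -/
lemma abs_exp_neg_sub_sum_le {x : ℝ} (hx : 0 ≤ x) {J : ℕ} (hJ : Real.exp 1 ^ 2 * x ≤ J)
    (hJ0 : 0 < J) :
    |Real.exp (-x) - ∑ j ∈ Finset.range J, (-x) ^ j / (j.factorial : ℝ)| ≤
      2 * Real.exp (-J) := by
  have he : (2 : ℝ) ≤ Real.exp 1 := by linarith [Real.add_one_le_exp (1 : ℝ)]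
  have hJr : (0 : ℝ) < J := by exact_mod_cast hJ0
  have h := Complex.exp_bound' (x := ((-x : ℝ) : ℂ)) (n := J) (by
    rw [Complex.norm_real, Real.norm_eq_abs, abs_neg, abs_of_nonneg hx, div_le_iff₀ (by positivity)]
    push_cast
    have h4 : 4 * x ≤ Real.exp 1 ^ 2 * x := by gcongr; nlinarith
    linarith)
  have h2 : Complex.exp ((-x : ℝ) : ℂ) - ∑ m ∈ Finset.range J, ((-x : ℝ) : ℂ) ^ m / (m.factorial : ℂ)
      = ((Real.exp (-x) - ∑ j ∈ Finset.range J, (-x) ^ j / (j.factorial : ℝ) : ℝ) : ℂ) := by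
    push_cast; rfl
  rw [h2, Complex.norm_real, Complex.norm_real, Real.norm_eq_abs, Real.norm_eq_abs, abs_neg,
    abs_of_nonneg hx] at h
  refine h.trans ?_
  have h3 := pow_div_factorial_le hx hJ0
  have h4 : (Real.exp 1 * x / J) ^ J ≤ Real.exp (-J) := by
    rw [show (-(J : ℝ)) = (J : ℝ) * (-1) by ring, Real.exp_nat_mul]
    refine pow_le_pow_left₀ (by positivity) ?_ _
    rw [div_le_iff₀ hJr, Real.exp_neg, inv_mul_eq_div, le_div_iff₀ (Real.exp_pos 1)]
    linarith
  linarith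

lemma hasDerivAt_sum_pow (c : ℕ → ℝ) (m N : ℕ) (w : ℝ) :
    HasDerivAt (fun w : ℝ => ∑ k ∈ Finset.range N, c k / ((k + m + 1).factorial : ℝ) * w ^ (k + m + 1))
      (∑ k ∈ Finset.range N, c k / ((k + m).factorial : ℝ) * w ^ (k + m)) w := by
  refine HasDerivAt.fun_sum fun k _ => ?_
  have := (hasDerivAt_pow (k + m + 1) w).const_mul (c k / ((k + m + 1).factorial : ℝ))
  refine this.congr_deriv ?_
  rw [Nat.factorial_succ]
  have : ((k + m).factorial : ℝ) ≠ 0 := by positivity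
  push_cast
  field_simp

lemma abs_sub_le_of_deriv_bound {f f' : ℝ → ℝ} {K W : ℝ} (hf : ∀ x, HasDerivAt f (f' x) x)
    (hK : ∀ x, |x| ≤ W → |f' x| ≤ K) (h0 : f 0 = 0) {w : ℝ} (hw : |w| ≤ W) :
    |f w| ≤ K * |w| := by
  have hW : 0 ≤ W := (abs_nonneg w).trans hw
  have := Convex.norm_image_sub_le_of_norm_hasDerivWithin_le (f := f) (f' := f') (C := K)
    (s := Set.Icc (-W) W) (x := 0) (y := w) (fun x _ => (hf x).hasDerivWithinAt)
    (fun x hx => hK x (abs_le.2 hx)) (convex_Icc _ _) ⟨by linarith, hW⟩ (abs_le.1 hw)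
  simpa [h0] using this

/-- The second derivative of the Taylor polynomial is φ(0) times a partial sum of exp(-x²/2), within
8/W⁴ of φ on [-W, W]. Value and slope agree with those of G at 0, so integrating twice costs a
factor W². -/
lemma abs_taylorG_sub_le {W w : ℝ} (β : ℝ) (hW : 0 < W) (hw : |w| ≤ W) {N : ℕ}
    (hN : Real.exp 1 ^ 2 * W ^ 2 ≤ N) : |taylorG β N w - G w β| ≤ 8 / W ^ 2 := by
  have he : (1 : ℝ) ≤ Real.exp 1 ^ 2 := by
    have : (2 : ℝ) ≤ Real.exp 1 := by linarith [Real.add_one_le_exp (1 : ℝ)]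
    nlinarith
  have hsecond : ∀ x : ℝ, |x| ≤ W →
      |phi 0 * ∑ k ∈ Finset.range N, (-1) ^ k * H k 0 / ((k + 0).factorial : ℝ) * x ^ (k + 0)
        - phi x| ≤ 8 / W ^ 4 := by
    intro x hx
    have hx2 : x ^ 2 ≤ W ^ 2 := sq_le_sq' (abs_le.1 hx).1 (abs_le.1 hx).2
    obtain ⟨J, hJ, hs⟩ := exists_sum_hermite_zero x N
    have hJr : (N : ℝ) ≤ 2 * J := by exact_mod_cast hJ
    have hWJ : W ^ 2 / 2 ≤ J := by nlinarith
    have hJ0 : 0 < J := by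
      have : (0 : ℝ) < J := lt_of_lt_of_le (by positivity) hWJ
      exact_mod_cast this
    have h1 := abs_exp_neg_sub_sum_le (x := x ^ 2 / 2) (by positivity) (J := J) (by nlinarith) hJ0
    simp only [add_zero]
    rw [hs, phi_eq_phi_zero_mul x, ← mul_sub, abs_mul, abs_of_pos (phi_pos 0), abs_sub_comm,
      neg_div]
    -- Polynomial decay in W is enough: e^J ≥ J²/2 and J ≥ W²/2.
    have h2 : Real.exp (-J) ≤ 8 / W ^ 4 := by
      have h3 := Real.quadratic_le_exp_of_nonneg (x := (J : ℝ)) (Nat.cast_nonneg J)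
      rw [Real.exp_neg, inv_eq_one_div, div_le_div_iff₀ (Real.exp_pos _) (by positivity)]
      have : W ^ 4 / 4 ≤ (J : ℝ) ^ 2 := by
        calc W ^ 4 / 4 = (W ^ 2 / 2) ^ 2 := by ring
          _ ≤ _ := pow_le_pow_left₀ (by positivity) hWJ 2
      nlinarith [(Nat.cast_nonneg J : (0 : ℝ) ≤ J)]
    calc phi 0 * _ ≤ 1 / 2 * (2 * Real.exp (-J)) :=
          mul_le_mul phi_zero_le h1 (abs_nonneg _) (by norm_num)
      _ ≤ _ := by linarith
  have hfirst : ∀ x : ℝ, |x| ≤ W →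
      |(Phi 0 - β) + phi 0 * ∑ k ∈ Finset.range N,
        (-1) ^ k * H k 0 / ((k + 0 + 1).factorial : ℝ) * x ^ (k + 0 + 1)
        - (Phi x - β)| ≤ 8 / W ^ 4 * W := by
    intro x hx
    have := abs_sub_le_of_deriv_bound (W := W)
      (f := fun x => (Phi 0 - β) + phi 0 * ∑ k ∈ Finset.range N,
        (-1) ^ k * H k 0 / ((k + 0 + 1).factorial : ℝ) * x ^ (k + 0 + 1) - (Phi x - β))
      (fun x => (((hasDerivAt_sum_pow (fun k => (-1) ^ k * H k 0) 0 N x).const_mul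
        (phi 0)).const_add (Phi 0 - β)).sub ((hasDerivAt_Phi x).sub_const β))
      hsecond (by simp) hx
    exact this.trans (mul_le_mul_of_nonneg_left hx (by positivity))
  have := abs_sub_le_of_deriv_bound (W := W)
    (f := fun x => G 0 β + (Phi 0 - β) * x + phi 0 * ∑ k ∈ Finset.range N,
        (-1) ^ k * H k 0 / ((k + 1 + 1).factorial : ℝ) * x ^ (k + 1 + 1) - G x β)
    (fun x => ((((hasDerivAt_id x).const_mul (Phi 0 - β)).const_add (G 0 β)).add
        ((hasDerivAt_sum_pow (fun k => (-1) ^ k * H k 0) 1 N x).const_mul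
        (phi 0))).sub (hasDerivAt_G x β))
    (K := 8 / W ^ 4 * W) (fun x hx => by simpa using hfirst x hx) (by simp) hw
  refine this.trans ((mul_le_mul_of_nonneg_left hw (by positivity)).trans (le_of_eq ?_))
  field_simp

/-! ### Second moment of the Hermite estimate -/

/-- The Hermite estimate of the Taylor polynomial, for noise of variance `v`. -/
noncomputable def hermitePoly (β v : ℝ) (N : ℕ) : Polynomial ℝ :=
  Polynomial.C (G 0 β) + Polynomial.C (Phi 0 - β) * Polynomial.X +
    Polynomial.C (phi 0) * ∑ k ∈ Finset.range N,
      Polynomial.C (taylorCoef k) * hermiteVar v (k + 2)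

lemma normalMean_sum {ι : Type*} (s : Finset ι) (ω t : ℝ) (q : ι → Polynomial ℝ) :
    normalMean ω t (∑ k ∈ s, q k) = ∑ k ∈ s, normalMean ω t (q k) := by
  simp only [normalMean, Polynomial.eval_finsetSum]
  exact integral_finsetSum _ fun k _ => integrable_eval_affine _ _ _

lemma normalMean_X (ω t : ℝ) : normalMean ω t Polynomial.X = ω := by
  have := normalMean_X_mul ω t 1
  simpa [normalMean] using this

lemma normalMean_C (ω t c : ℝ) : normalMean ω t (Polynomial.C c) = c := by
  simp [normalMean]

lemma normalMean_hermitePoly (ω t β : ℝ) (N : ℕ) :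
    normalMean ω t (hermitePoly β (t ^ 2) N) = taylorG β N ω := by
  simp only [hermitePoly, normalMean_add, normalMean_C_mul, normalMean_C, normalMean_X,
    normalMean_sum, normalMean_hermiteVar, taylorG]

lemma normalMean_mono {ω t : ℝ} {p q : Polynomial ℝ} (h : ∀ u, p.eval u ≤ q.eval u) :
    normalMean ω t p ≤ normalMean ω t q :=
  integral_mono (integrable_eval_affine _ _ _) (integrable_eval_affine _ _ _) fun _ => h _

/-- The tangent of exp(t/2) with slope one, at t = 2 log 2, has intercept 2 - 2 log 2 > 1/2. -/
lemma half_add_le_exp (t : ℝ) : 1 / 2 + t ≤ Real.exp (t / 2) := by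
  have h2 : Real.exp (t / 2) = 2 * Real.exp (t / 2 - Real.log 2) := by
    rw [Real.exp_sub, Real.exp_log two_pos]; ring
  have := Real.add_one_le_exp (t / 2 - Real.log 2)
  have := Real.log_two_lt_d9
  linarith

lemma taylorCoef_odd (j : ℕ) : taylorCoef (2 * j + 1) = 0 := by
  rw [taylorCoef, H_odd_zero]; simp

/-- The exact absolute value has a further factor 1/(2j+1), which is dropped. -/
lemma abs_taylorCoef_even_le (j : ℕ) :
    |taylorCoef (2 * j)| ≤ 1 / (2 ^ (j + 1) * ((j + 1).factorial : ℝ)) := by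
  have h1 : ((2 * j).factorial : ℝ) ≠ 0 := by positivity
  have h2 : H (2 * j) 0 = (-1 / 2) ^ j / (j.factorial : ℝ) * ((2 * j).factorial : ℝ) := by
    rw [← H_even_zero, div_mul_cancel₀ _ h1]
  rw [taylorCoef, h2, Nat.factorial_succ, Nat.factorial_succ, Nat.factorial_succ]
  have h3 : |(-1 : ℝ) / 2| = 1 / 2 := by rw [abs_div]; norm_num
  have h4 : (0 : ℝ) < j.factorial := by positivity
  have h5 : (0 : ℝ) < (2 * j).factorial := by positivity
  rw [abs_div, abs_mul, abs_mul, abs_div, abs_pow, abs_pow, h3, abs_neg, abs_one, one_pow, one_mul,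
    Nat.abs_cast, Nat.abs_cast, Nat.abs_cast, div_pow, one_pow]
  push_cast
  rw [div_le_div_iff₀ (by positivity) (by positivity)]
  field_simp
  rw [pow_succ]
  have : (0 : ℝ) ≤ 2 ^ j * (j * (j + 1)) := by positivity
  nlinarith

/-- With l = j + 1 and B = W² + 2lt² the product is at most ((B/2)^l / l!)². By the factorial bound
this involves the l-th power of eB/(2l) = et² + eW²/(2l), whose first term is at most 1/2.
`half_add_le_exp` then replaces the base by exp(eW²/(4l)), whose l-th power no longer depends on the
degree. The hypothesis et² ≤ 1/2 is what a variance ratio below 1/(4e) provides. -/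
lemma taylorCoef_sq_mul_normalMean_le {ω W t : ℝ} (hW : 0 < W) (hω : |ω| ≤ W)
    (ht : Real.exp 1 * t ^ 2 ≤ 1 / 2) (k : ℕ) :
    taylorCoef k ^ 2 * normalMean ω t (hermiteVar (t ^ 2) (k + 2) * hermiteVar (t ^ 2) (k + 2)) ≤
      Real.exp (Real.exp 1 * W ^ 2 / 2) := by
  obtain ⟨j, rfl | rfl⟩ := k.even_or_odd'
  swap
  · rw [taylorCoef_odd]; simp [Real.exp_nonneg]
  have hm := normalMean_hermiteVar_sq_le t hW hω (2 * j + 2)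
  set l := j + 1 with hl
  have hl0 : 0 < l := by lia
  have hlr : (0 : ℝ) < l := by exact_mod_cast hl0
  have h2l : 2 * j + 2 = l * 2 := by lia
  rw [h2l] at hm ⊢
  have hc := abs_taylorCoef_even_le j
  rw [← hl] at hc
  set B : ℝ := W ^ 2 + ((l * 2 : ℕ) : ℝ) * t ^ 2 with hB
  have hB0 : 0 ≤ B := by positivity
  have key : (B / 2) ^ l / (l.factorial : ℝ) ≤ Real.exp (Real.exp 1 * W ^ 2 / 4) := by
    refine (pow_div_factorial_le (by positivity) hl0).trans ?_
    have : Real.exp (Real.exp 1 * W ^ 2 / 4) =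
        Real.exp ((Real.exp 1 * W ^ 2 / (2 * l)) / 2) ^ l := by
      rw [← Real.exp_nat_mul]; congr 1; field_simp; norm_num
    rw [this]
    refine pow_le_pow_left₀ (by positivity) (le_trans ?_ (half_add_le_exp _)) _
    rw [hB]
    push_cast
    have : Real.exp 1 * ((W ^ 2 + (l : ℝ) * 2 * t ^ 2) / 2) / l =
        Real.exp 1 * t ^ 2 + Real.exp 1 * W ^ 2 / (2 * l) := by field_simp; ring
    linarith
  calc taylorCoef (2 * j) ^ 2 * _ ≤ (1 / (2 ^ l * (l.factorial : ℝ))) ^ 2 * B ^ (l * 2) := by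
        refine mul_le_mul ?_ hm ?_ (by positivity)
        · rw [← sq_abs]; exact pow_le_pow_left₀ (abs_nonneg _) hc 2
        · refine integral_nonneg fun z => ?_
          simp only [Polynomial.eval_mul]; exact mul_self_nonneg _
    _ = ((B / 2) ^ l / (l.factorial : ℝ)) ^ 2 := by
        rw [pow_mul, div_pow B 2 l]; field_simp
    _ ≤ Real.exp (Real.exp 1 * W ^ 2 / 4) ^ 2 :=
        pow_le_pow_left₀ (by positivity) key 2
    _ = _ := by rw [← Real.exp_nat_mul]; congr 1; push_cast; ring

/-- The constant, linear and Hermite blocks are separated at the cost of a factor 3, and the N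
Hermite terms by Cauchy–Schwarz at the cost of a factor N, so no cross moment is needed. -/
lemma normalMean_hermitePoly_sq_le {ω W t β : ℝ} (hW : 0 < W) (hω : |ω| ≤ W)
    (ht : Real.exp 1 * t ^ 2 ≤ 1 / 2) (hβ0 : 0 ≤ β) (hβ1 : β ≤ 1) (N : ℕ) :
    normalMean ω t (hermitePoly β (t ^ 2) N * hermitePoly β (t ^ 2) N) ≤
      3 * (W ^ 2 + 2 + (N : ℝ) ^ 2) * Real.exp (Real.exp 1 * W ^ 2 / 2) := by
  set D := Real.exp (Real.exp 1 * W ^ 2 / 2)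
  have hD1 : 1 ≤ D := Real.one_le_exp (by positivity)
  have hG : G 0 β ^ 2 ≤ 1 := by
    have : G 0 β = phi 0 := by simp [G]
    rw [this]; nlinarith [phi_pos 0, phi_zero_le]
  have hP : (Phi 0 - β) ^ 2 ≤ 1 := by
    nlinarith [Phi_nonneg 0, Phi_le_one 0]
  have hphi : phi 0 ^ 2 ≤ 1 := by nlinarith [phi_pos 0, phi_zero_le]
  have ht1 : t ^ 2 ≤ 1 := by nlinarith [Real.add_one_le_exp (1 : ℝ), sq_nonneg t]
  set S : Polynomial ℝ := Polynomial.C (3 * G 0 β ^ 2) +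
    (Polynomial.C (3 * (Phi 0 - β) ^ 2) * (Polynomial.X * Polynomial.X) +
      Polynomial.C (3 * phi 0 ^ 2 * N) * ∑ k ∈ Finset.range N, Polynomial.C (taylorCoef k ^ 2) *
        (hermiteVar (t ^ 2) (k + 2) * hermiteVar (t ^ 2) (k + 2))) with hS
  have h1 : normalMean ω t (hermitePoly β (t ^ 2) N * hermitePoly β (t ^ 2) N) ≤
      normalMean ω t S := by
    refine normalMean_mono fun u => ?_
    simp only [hS, hermitePoly, Polynomial.eval_mul, Polynomial.eval_add, Polynomial.eval_C,
      Polynomial.eval_X, Polynomial.eval_finsetSum]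
    have hcs := sq_sum_le_card_mul_sum_sq (s := Finset.range N)
      (f := fun k => taylorCoef k * (hermiteVar (t ^ 2) (k + 2)).eval u)
    rw [Finset.card_range] at hcs
    have e : ∑ k ∈ Finset.range N, taylorCoef k ^ 2 *
        ((hermiteVar (t ^ 2) (k + 2)).eval u * (hermiteVar (t ^ 2) (k + 2)).eval u) =
        ∑ k ∈ Finset.range N, (taylorCoef k * (hermiteVar (t ^ 2) (k + 2)).eval u) ^ 2 :=
      Finset.sum_congr rfl fun k _ => by ring
    rw [e]
    set A := ∑ k ∈ Finset.range N, taylorCoef k * (hermiteVar (t ^ 2) (k + 2)).eval u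
    set B := ∑ k ∈ Finset.range N, (taylorCoef k * (hermiteVar (t ^ 2) (k + 2)).eval u) ^ 2
    have := mul_le_mul_of_nonneg_left hcs (sq_nonneg (phi 0))
    nlinarith [sq_nonneg (G 0 β - (Phi 0 - β) * u), sq_nonneg (G 0 β - phi 0 * A),
      sq_nonneg ((Phi 0 - β) * u - phi 0 * A)]
  refine h1.trans ?_
  rw [hS, normalMean_add, normalMean_add, normalMean_C_mul, normalMean_C_mul, normalMean_C,
    normalMean_X_mul, normalMean_X, Polynomial.derivative_X, normalMean_one, normalMean_sum]
  have h2 : ∑ k ∈ Finset.range N, normalMean ω t (Polynomial.C (taylorCoef k ^ 2) *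
        (hermiteVar (t ^ 2) (k + 2) * hermiteVar (t ^ 2) (k + 2))) ≤ N * D := by
    calc _ ≤ ∑ k ∈ Finset.range N, D := Finset.sum_le_sum fun k _ => by
          rw [normalMean_C_mul]; exact taylorCoef_sq_mul_normalMean_le hW hω ht k
      _ = _ := by simp
  have h3 : ω * ω + t ^ 2 * 1 ≤ W ^ 2 + 1 := by
    have : ω ^ 2 ≤ W ^ 2 := sq_le_sq' (abs_le.1 hω).1 (abs_le.1 hω).2
    nlinarith
  have h4 : 3 * (Phi 0 - β) ^ 2 * (ω * ω + t ^ 2 * 1) ≤ 3 * (W ^ 2 + 1) := by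
    have : (Phi 0 - β) ^ 2 * (ω * ω + t ^ 2 * 1) ≤ 1 * (W ^ 2 + 1) :=
      mul_le_mul hP h3 (by nlinarith [sq_nonneg ω, sq_nonneg t]) (by norm_num)
    linarith
  have h5 : 3 * phi 0 ^ 2 * N * (N * D) ≤ 3 * (N : ℝ) ^ 2 * D := by
    have : 0 ≤ (N : ℝ) ^ 2 * D := by positivity
    nlinarith
  have h6 := mul_le_mul_of_nonneg_left h2 (by positivity : 0 ≤ 3 * phi 0 ^ 2 * (N : ℝ))
  nlinarith [sq_nonneg W]

/-! ### Gaussian tails against the growth of G -/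

lemma integral_sq_gaussian : ∫ z, z ^ 2 ∂(gaussianReal 0 1) = 1 := by
  have := integral_mul_polynomial Polynomial.X
  simpa [← sq] using this

lemma integral_id_std : ∫ z, z ∂(gaussianReal 0 1) = 0 := integral_id_gaussianReal

lemma integrable_sq_std : Integrable (fun z : ℝ => z ^ 2) (gaussianReal 0 1) :=
  integrable_pow_gaussian 2 0 1

lemma integrable_id_std : Integrable (fun z : ℝ => z) (gaussianReal 0 1) := by
  simpa using integrable_pow_gaussian 1 0 1

lemma gaussian_chebyshev (t : ℝ) {a : ℝ} (ha : 0 < a) :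
    (gaussianReal 0 1).real {r | a ≤ |t * r|} ≤ t ^ 2 / a ^ 2 := by
  have h := mul_meas_ge_le_integral_of_nonneg (μ := gaussianReal 0 1)
    (f := fun r => t ^ 2 * r ^ 2) (ae_of_all _ fun r => by simp only [Pi.zero_apply]; positivity)
    (integrable_sq_std.const_mul _) (a ^ 2)
  rw [integral_const_mul, integral_sq_gaussian, mul_one] at h
  rw [le_div_iff₀ (by positivity), mul_comm]
  refine le_trans (mul_le_mul_of_nonneg_left (measureReal_mono fun r hr => ?_) (by positivity)) h
  have : a ^ 2 ≤ |t * r| ^ 2 := pow_le_pow_left₀ ha.le hr 2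
  rw [sq_abs, mul_pow] at this
  exact this

lemma gaussian_tail {L : ℝ} (hL : 0 < L) :
    (gaussianReal 0 1).real {r | L < |r|} ≤ 1 / (Real.exp (L ^ 2 / 2) * L) := by
  have h1 := measure_Ici_le hL
  have h2 : (gaussianReal 0 1).real (Set.Iio (-L)) = (gaussianReal 0 1).real (Set.Ioi L) := by
    have hm : (gaussianReal 0 1).map (fun x => -x) = gaussianReal 0 1 := by
      rw [gaussianReal_map_neg, neg_zero]
    conv_lhs => rw [← hm]
    rw [measureReal_def, Measure.map_apply measurable_neg measurableSet_Iio, measureReal_def]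
    congr 2
    ext x; simp
  have h3 : {r : ℝ | L < |r|} ⊆ Set.Ioi L ∪ Set.Iio (-L) := fun r hr => by
    rcases lt_abs.1 (show L < |r| from hr) with h | h
    · exact Or.inl h
    · exact Or.inr (by simp only [Set.mem_Iio]; linarith)
  have h4 := (measureReal_mono (μ := gaussianReal 0 1) h3).trans (measureReal_union_le _ _)
  have h5 : phi L ≤ 1 / 2 * (Real.exp (L ^ 2 / 2))⁻¹ := by
    rw [phi_eq_phi_zero_mul, neg_div, Real.exp_neg]
    exact mul_le_mul_of_nonneg_right phi_zero_le (by positivity)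
  have h6 : phi L / L ≤ 1 / 2 * (Real.exp (L ^ 2 / 2))⁻¹ / L := by gcongr
  calc _ ≤ _ := h4
    _ ≤ 1 / 2 * (Real.exp (L ^ 2 / 2))⁻¹ / L + 1 / 2 * (Real.exp (L ^ 2 / 2))⁻¹ / L := by linarith
    _ = _ := by field_simp; norm_num

lemma normalExcess_le' (w : ℝ) : normalExcess w ≤ 1 / 2 + max w 0 :=
  (normalExcess_le w).trans (by linarith [phi_le_phi_zero w, phi_zero_le])

lemma abs_G_le {w β : ℝ} (hβ0 : 0 ≤ β) (hβ1 : β ≤ 1) : |G w β| ≤ 1 / 2 + |w| := by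
  have h1 := normalExcess_nonneg w
  have h2 := normalExcess_le' w
  rw [G_eq, abs_le]
  rcases le_total w 0 with h | h
  · rw [max_eq_right h] at h2; rw [abs_of_nonpos h]; constructor <;> nlinarith
  · rw [max_eq_left h] at h2; rw [abs_of_nonneg h]; constructor <;> nlinarith

/-- Each factor is small where the other is not. For ω ≤ -λ/2 the excess is at most φ(ω); otherwise
falling below -λ is a deviation of at least λ + ω, and Chebyshev's quadratic decay beats the linear
growth of the excess. -/
lemma left_prob_mul_normalExcess_le {ω t lam : ℝ} (hlam : 0 < lam) (ht : t ^ 2 ≤ 1) :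
    (gaussianReal 0 1).real {r | ω + t * r < -lam} * normalExcess ω ≤ 3 / lam := by
  set P := (gaussianReal 0 1).real {r | ω + t * r < -lam}
  have hP0 : 0 ≤ P := measureReal_nonneg
  have hP1 : P ≤ 1 := measureReal_le_one
  have hE := normalExcess_nonneg ω
  rcases le_total ω (-lam / 2) with h | h
  · have h1 := normalExcess_le ω
    rw [max_eq_right (by linarith), add_zero] at h1
    have h2 : phi ω ≤ 1 / lam := by
      rw [phi_eq_phi_zero_mul, neg_div, Real.exp_neg]
      have h3 := Real.add_one_le_exp (ω ^ 2 / 2)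
      have h4 : lam / 2 ≤ Real.exp (ω ^ 2 / 2) := by nlinarith [sq_nonneg (ω + 1)]
      rw [← div_eq_mul_inv, div_le_div_iff₀ (Real.exp_pos _) hlam]
      nlinarith [phi_zero_le, phi_pos 0]
    have h5 : 1 / lam ≤ 3 / lam := by gcongr; norm_num
    nlinarith
  · have ha : 0 < lam + ω := by linarith
    have hc := gaussian_chebyshev t ha
    have hsub : P ≤ t ^ 2 / (lam + ω) ^ 2 := by
      refine le_trans (measureReal_mono fun r hr => ?_) hc
      simp only [Set.mem_ofPred_eq] at hr ⊢
      exact le_abs.2 (Or.inr (by linarith))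
    have hP2 : P ≤ 1 / (lam + ω) ^ 2 := hsub.trans (by gcongr)
    have hE2 : normalExcess ω ≤ 1 / 2 + (lam + ω) :=
      (normalExcess_le' ω).trans (by
        have : max ω 0 ≤ lam + ω := max_le (by linarith) ha.le
        linarith)
    rcases le_total 1 (lam + ω) with h1 | h1
    · calc P * normalExcess ω ≤ 1 / (lam + ω) ^ 2 * (1 / 2 + (lam + ω)) :=
            mul_le_mul hP2 hE2 hE (by positivity)
        _ ≤ 3 / lam := by
          rw [div_mul_eq_mul_div, one_mul, div_le_div_iff₀ (by positivity) hlam]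
          nlinarith
    · calc P * normalExcess ω ≤ 1 * (1 / 2 + (lam + ω)) :=
            mul_le_mul hP1 hE2 hE (by positivity)
        _ ≤ 3 / lam := by
          rw [le_div_iff₀ hlam]
          nlinarith

lemma right_prob_mul_normalExcess_le {ω t lam : ℝ} (hlam : 0 < lam) (ht : t ^ 2 ≤ 1) :
    (gaussianReal 0 1).real {r | lam < ω + t * r} * normalExcess (-ω) ≤ 3 / lam := by
  have h := left_prob_mul_normalExcess_le (ω := -ω) (t := -t) hlam (by simpa using ht)
  have e : {r | -ω + -t * r < -lam} = {r | lam < ω + t * r} := by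
    ext r
    simp only [Set.mem_ofPred_eq]
    constructor <;> intro h <;> linarith
  rwa [e] at h

/-! ### Bias and mean square error of the threshold rule -/

/-- The threshold rule with truncation level `m`, as a function of two independent copies. -/
noncomputable def thresholdRule (β lam m : ℝ) (q : Polynomial ℝ) (u v : ℝ) : ℝ :=
  if v < -lam then -β * u
  else if v ≤ lam then max (-m) (min (q.eval u) m)
  else (1 - β) * u

lemma abs_trunc_le {m : ℝ} (hm : 0 ≤ m) (y : ℝ) : |max (-m) (min y m)| ≤ m :=
  abs_le.2 ⟨le_max_left _ _, max_le (by linarith) (min_le_right _ _)⟩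

lemma abs_trunc_le_abs {m : ℝ} (hm : 0 ≤ m) (y : ℝ) : |max (-m) (min y m)| ≤ |y| := by
  rw [abs_le]
  rcases abs_cases y with ⟨h1, h2⟩ | ⟨h1, h2⟩ <;> rw [h1] <;> constructor
  · exact le_max_of_le_right (le_min (by linarith) (by linarith))
  · exact max_le (by linarith) (min_le_left _ _)
  · exact le_max_of_le_right (le_min (by linarith) (by linarith))
  · exact max_le (by linarith) ((min_le_left _ _).trans (by linarith))

lemma abs_trunc_sub_le {m : ℝ} (hm : 0 < m) (y : ℝ) : |max (-m) (min y m) - y| ≤ y ^ 2 / m := by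
  rw [le_div_iff₀ hm]
  rcases le_total y m with h | h
  · rw [min_eq_left h]
    rcases le_total (-m) y with h' | h'
    · rw [max_eq_right h', sub_self, abs_zero, zero_mul]; positivity
    · rw [max_eq_left h', abs_of_nonneg (by linarith)]; nlinarith
  · rw [min_eq_right h, max_eq_right (by linarith), abs_of_nonpos (by linarith)]; nlinarith

lemma measurable_thresholdRule (β lam m : ℝ) (q : Polynomial ℝ) :
    Measurable fun p : ℝ × ℝ => thresholdRule β lam m q p.1 p.2 := by
  unfold thresholdRule
  refine Measurable.ite (measurableSet_lt measurable_snd measurable_const) (by fun_prop)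
    (Measurable.ite (measurableSet_le measurable_snd measurable_const) ?_ (by fun_prop))
  exact measurable_const.max ((q.continuous.measurable.comp measurable_fst).min measurable_const)

lemma abs_thresholdRule_le {β lam m : ℝ} (hβ0 : 0 ≤ β) (hβ1 : β ≤ 1) (hm : 0 ≤ m)
    (q : Polynomial ℝ) (u v : ℝ) : |thresholdRule β lam m q u v| ≤ |u| + m := by
  rw [thresholdRule]
  split_ifs
  · rw [abs_mul, abs_neg, abs_of_nonneg hβ0]; nlinarith [abs_nonneg u]
  · linarith [abs_trunc_le hm (q.eval u), abs_nonneg u]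
  · rw [abs_mul, abs_of_nonneg (by linarith : 0 ≤ 1 - β)]; nlinarith [abs_nonneg u]

lemma integrable_trunc (m : ℝ) (hm : 0 ≤ m) (q : Polynomial ℝ) (ω t : ℝ) :
    Integrable (fun p => max (-m) (min (q.eval (ω + t * p)) m)) (gaussianReal 0 1) := by
  refine Integrable.of_bound (C := m) ?_ (ae_of_all _ fun p => abs_trunc_le hm _)
  have : Continuous fun p => max (-m) (min (q.eval (ω + t * p)) m) := by fun_prop
  exact this.aestronglyMeasurable

/-- The middle set of the threshold rule. -/
def midSet (ω t lam : ℝ) : Set ℝ := {r | -lam ≤ ω + t * r ∧ ω + t * r ≤ lam}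

lemma measurableSet_midSet (ω t lam : ℝ) : MeasurableSet (midSet ω t lam) := by
  have h : Measurable fun r : ℝ => ω + t * r := by fun_prop
  exact (measurableSet_le measurable_const h).inter (measurableSet_le h measurable_const)

lemma integral_add_three {α : Type*} [MeasurableSpace α] {μ : Measure α} {f g h : α → ℝ}
    (hf : Integrable f μ) (hg : Integrable g μ) (hh : Integrable h μ) :
    ∫ x, f x + g x + h x ∂μ = ∫ x, f x ∂μ + ∫ x, g x ∂μ + ∫ x, h x ∂μ := by
  have h1 := integral_add (hf.add hg) hh
  have h2 := integral_add hf hg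
  simp only [Pi.add_apply] at h1
  rw [h1, h2]

/-- Independence of the two copies factors each regime into a probability times a mean. Distributing
G(ω, β) over the three probabilities leaves in the outer regimes the exact distance between G and
its asymptotes. -/
lemma integral_thresholdRule {β lam m : ℝ} (hlam : 0 < lam) (hm : 0 ≤ m)
    (q : Polynomial ℝ) (ω t : ℝ) :
    ∫ p : ℝ × ℝ, thresholdRule β lam m q (ω + t * p.1) (ω + t * p.2)
        ∂((gaussianReal 0 1).prod (gaussianReal 0 1)) - G ω β =
      -((gaussianReal 0 1).real {r | ω + t * r < -lam} * normalExcess ω)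
      - (gaussianReal 0 1).real {r | lam < ω + t * r} * normalExcess (-ω)
      + (gaussianReal 0 1).real (midSet ω t lam) *
        (∫ p, max (-m) (min (q.eval (ω + t * p)) m) ∂(gaussianReal 0 1) - G ω β) := by
  set g := gaussianReal 0 1 with hg
  set A := {r | ω + t * r < -lam} with hA
  set B := {r | lam < ω + t * r} with hB
  have hAm : MeasurableSet A := measurableSet_lt (by fun_prop) measurable_const
  have hBm : MeasurableSet B := measurableSet_lt measurable_const (by fun_prop)
  have hMm : MeasurableSet (midSet ω t lam) :=
    measurableSet_midSet ω t lam
  have hint : ∀ s : Set ℝ, MeasurableSet s → ∫ r, s.indicator (fun _ => (1 : ℝ)) r ∂g = g.real s :=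
    fun s hs => by rw [integral_indicator hs]; simp
  have hind : ∀ s : Set ℝ, MeasurableSet s → Integrable (s.indicator fun _ => (1 : ℝ)) g :=
    fun s hs => (integrable_const 1).indicator hs
  have hsplit : ∀ p : ℝ × ℝ, thresholdRule β lam m q (ω + t * p.1) (ω + t * p.2) =
      (-β * (ω + t * p.1)) * A.indicator (fun _ => (1 : ℝ)) p.2 +
      (max (-m) (min (q.eval (ω + t * p.1)) m)) *
        (midSet ω t lam).indicator (fun _ => (1 : ℝ)) p.2 +
      ((1 - β) * (ω + t * p.1)) * B.indicator (fun _ => (1 : ℝ)) p.2 := by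
    intro p
    rw [thresholdRule]
    split_ifs with h1 h2
    · rw [Set.indicator_of_mem (by exact h1),
        Set.indicator_of_notMem (fun h => by have := h.1; linarith),
        Set.indicator_of_notMem (fun h => by have : lam < ω + t * p.2 := h; linarith)]; ring
    · rw [Set.indicator_of_notMem (by exact h1), Set.indicator_of_mem (by exact ⟨not_lt.1 h1, h2⟩),
        Set.indicator_of_notMem (fun h => by have : lam < ω + t * p.2 := h; linarith)]; ring
    · rw [Set.indicator_of_notMem (by exact h1),
        Set.indicator_of_notMem (fun h => by have := h.2; linarith),
        Set.indicator_of_mem (by exact not_le.1 h2)]; ring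
  have hlin : Integrable (fun p : ℝ => ω + t * p) g :=
    (integrable_const ω).add (integrable_id_std.const_mul t)
  have hlinv : ∫ p, (ω + t * p) ∂g = ω := by
    rw [integral_add (integrable_const ω) (integrable_id_std.const_mul t), integral_const_mul,
      integral_id_std]
    simp
  have hi1 := (hlin.const_mul (-β)).mul_prod (hind A hAm)
  have hi2 := (integrable_trunc m hm q ω t).mul_prod (hind _ hMm)
  have hi3 := (hlin.const_mul (1 - β)).mul_prod (hind B hBm)
  have htot : g.real A + g.real (midSet ω t lam) + g.real B = 1 := by
    rw [← hint A hAm, ← hint _ hMm, ← hint B hBm, ← integral_add_three (hind A hAm) (hind _ hMm) (hind B hBm)]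
    have : ∀ r, A.indicator (fun _ => (1 : ℝ)) r + (midSet ω t lam).indicator (fun _ => (1 : ℝ)) r
        + B.indicator (fun _ => (1 : ℝ)) r = 1 := by
      intro r
      by_cases h1 : ω + t * r < -lam
      · rw [Set.indicator_of_mem (by exact h1),
          Set.indicator_of_notMem (fun h => by have := h.1; linarith),
          Set.indicator_of_notMem (fun h => by have : lam < ω + t * r := h; linarith)]; ring
      · by_cases h2 : ω + t * r ≤ lam
        · rw [Set.indicator_of_notMem (by exact h1),
            Set.indicator_of_mem (by exact ⟨not_lt.1 h1, h2⟩),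
            Set.indicator_of_notMem (fun h => by have : lam < ω + t * r := h; linarith)]; ring
        · rw [Set.indicator_of_notMem (by exact h1),
            Set.indicator_of_notMem (fun h => by have := h.2; linarith),
            Set.indicator_of_mem (by exact not_le.1 h2)]; ring
    simp only [this]
    simp
  simp_rw [hsplit]
  have e1 := integral_prod_mul (μ := g) (ν := g) (fun p => -β * (ω + t * p))
    (A.indicator fun _ => (1 : ℝ))
  have e2 := integral_prod_mul (μ := g) (ν := g) (fun p => max (-m) (min (q.eval (ω + t * p)) m))
    ((midSet ω t lam).indicator fun _ => (1 : ℝ))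
  have e3 := integral_prod_mul (μ := g) (ν := g) (fun p => (1 - β) * (ω + t * p))
    (B.indicator fun _ => (1 : ℝ))
  rw [integral_add_three hi1 hi2 hi3, e1, e2, e3, integral_const_mul, integral_const_mul, hlinv, hint A hAm, hint _ hMm,
    hint B hBm]
  have hE := normalExcess_sub_neg ω
  rw [G_eq]
  linear_combination (normalExcess ω - β * ω) * htot - g.real B * hE

lemma midSet_subset {ω t lam : ℝ} : midSet ω t lam ⊆ {r | |ω| - lam ≤ |t * r|} := fun r hr => by
  have h1 : |ω + t * r| ≤ lam := abs_le.2 hr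
  have h2 := abs_add_le (ω + t * r) (-(t * r))
  rw [abs_neg, add_neg_cancel_right] at h2
  exact (by linarith : |ω| - lam ≤ |t * r|)

/-- If |ω| > W, the middle regime forces |tr| > W - λ ≥ |t|L, hence |r| > L. -/
lemma midSet_prob_le {ω t lam W L : ℝ} (hL : 0 < L) (htL : |t| * L ≤ W - lam) (hω : W < |ω|) :
    (gaussianReal 0 1).real (midSet ω t lam) ≤ 1 / (Real.exp (L ^ 2 / 2) * L) := by
  refine le_trans (measureReal_mono (midSet_subset.trans fun r hr => ?_)) (gaussian_tail hL)
  have h1 : |ω| - lam ≤ |t * r| := hr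
  rw [abs_mul] at h1
  have h2 : |t| * L < |t| * |r| := by linarith
  exact (lt_of_mul_lt_mul_left h2 (abs_nonneg t) : L < |r|)

/-- The bound for the second moment of the Hermite estimate. -/
noncomputable def hermiteBound (W : ℝ) (N : ℕ) : ℝ :=
  3 * (W ^ 2 + 2 + (N : ℝ) ^ 2) * Real.exp (Real.exp 1 * W ^ 2 / 2)

lemma sq_le_one_of_exp_mul_sq_le {t : ℝ} (ht : Real.exp 1 * t ^ 2 ≤ 1 / 2) : t ^ 2 ≤ 1 := by
  nlinarith [Real.add_one_le_exp (1 : ℝ), sq_nonneg t]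

lemma integral_hermitePoly_sq_le {ω W t β : ℝ} (hW : 0 < W) (hω : |ω| ≤ W)
    (ht : Real.exp 1 * t ^ 2 ≤ 1 / 2) (hβ0 : 0 ≤ β) (hβ1 : β ≤ 1) (N : ℕ) :
    ∫ p, (hermitePoly β (t ^ 2) N).eval (ω + t * p) ^ 2 ∂(gaussianReal 0 1) ≤
      hermiteBound W N := by
  have := normalMean_hermitePoly_sq_le hW hω ht hβ0 hβ1 N
  simpa [normalMean, ← sq, hermiteBound] using this

lemma integrable_eval_sq (ω t : ℝ) (q : Polynomial ℝ) :
    Integrable (fun z => q.eval (ω + t * z) ^ 2) (gaussianReal 0 1) := by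
  have := integrable_eval_affine ω t (q ^ 2)
  simpa using this

/-- Truncation at m moves y by at most y²/m, so its bias is at most the second moment divided by m.
The untruncated mean is the Taylor polynomial, which leaves only the Taylor error. -/
lemma abs_trunc_mean_sub_le {ω W t β m : ℝ} {N : ℕ} (hW : 0 < W) (hω : |ω| ≤ W)
    (ht : Real.exp 1 * t ^ 2 ≤ 1 / 2) (hβ0 : 0 ≤ β) (hβ1 : β ≤ 1) (hm : 0 < m)
    (hN : Real.exp 1 ^ 2 * W ^ 2 ≤ N) :
    |∫ p, max (-m) (min ((hermitePoly β (t ^ 2) N).eval (ω + t * p)) m) ∂(gaussianReal 0 1)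
      - G ω β| ≤ hermiteBound W N / m + 8 / W ^ 2 := by
  have h1 := abs_taylorG_sub_le β hW hω hN
  have h2 := normalMean_hermitePoly ω t β N
  have h3 := integral_hermitePoly_sq_le hW hω ht hβ0 hβ1 N
  set q := hermitePoly β (t ^ 2) N
  have h4 : |∫ p, max (-m) (min (q.eval (ω + t * p)) m) ∂(gaussianReal 0 1) - taylorG β N ω| ≤
      hermiteBound W N / m := by
    rw [← h2, normalMean, ← integral_sub (integrable_trunc m hm.le q ω t)
      (integrable_eval_affine _ _ _)]
    refine (abs_integral_le_integral_abs).trans (le_trans ?_ (div_le_div_of_nonneg_right h3 hm.le))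
    rw [← integral_div]
    exact integral_mono ((integrable_trunc m hm.le q ω t).sub (integrable_eval_affine _ _ _)).abs
      ((integrable_eval_sq ω t q).div_const m) fun p => abs_trunc_sub_le hm _
  calc _ ≤ _ := abs_sub_le _ (taylorG β N ω) _
    _ ≤ _ := add_le_add h4 h1

/-- The bound for the bias of the threshold rule. -/
noncomputable def biasBound (lam W L m : ℝ) (N : ℕ) : ℝ :=
  6 / lam + (hermiteBound W N / m + 8 / W ^ 2) +
    (1 / L + ((1 + lam) / (W - lam) ^ 2 + 1 / (W - lam)))

lemma hermiteBound_nonneg (W : ℝ) (N : ℕ) : 0 ≤ hermiteBound W N := by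
  unfold hermiteBound; positivity

/-- For |ω| ≤ W the Hermite estimate is accurate. For |ω| > W the middle regime is rare: the level m
= exp(L²/2) is cancelled by the Gaussian tail beyond L, leaving 1/L, and Chebyshev takes care of the
linear growth of G. -/
lemma abs_thresholdRule_bias_le {β lam W L m ω t : ℝ} {N : ℕ} (hβ0 : 0 ≤ β) (hβ1 : β ≤ 1)
    (hlam : 0 < lam) (hW : lam < W) (hL : 0 < L) (htL : |t| * L ≤ W - lam)
    (ht : Real.exp 1 * t ^ 2 ≤ 1 / 2) (hm : m = Real.exp (L ^ 2 / 2))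
    (hN : Real.exp 1 ^ 2 * W ^ 2 ≤ N) :
    |∫ p : ℝ × ℝ, thresholdRule β lam m (hermitePoly β (t ^ 2) N) (ω + t * p.1) (ω + t * p.2)
        ∂((gaussianReal 0 1).prod (gaussianReal 0 1)) - G ω β| ≤ biasBound lam W L m N := by
  have hm0 : 0 < m := hm ▸ Real.exp_pos _
  have hW0 : 0 < W := hlam.trans hW
  have hWl : 0 < W - lam := by linarith
  have ht1 := sq_le_one_of_exp_mul_sq_le ht
  rw [integral_thresholdRule hlam hm0.le]
  set q := hermitePoly β (t ^ 2) N
  set I := ∫ p, max (-m) (min (q.eval (ω + t * p)) m) ∂(gaussianReal 0 1) with hI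
  set P := (gaussianReal 0 1).real (midSet ω t lam)
  have hP0 : 0 ≤ P := measureReal_nonneg
  have hP1 : P ≤ 1 := measureReal_le_one
  have hl := left_prob_mul_normalExcess_le (ω := ω) (t := t) hlam ht1
  have hr := right_prob_mul_normalExcess_le (ω := ω) (t := t) hlam ht1
  have hl0 : 0 ≤ (gaussianReal 0 1).real {r | ω + t * r < -lam} * normalExcess ω :=
    mul_nonneg measureReal_nonneg (normalExcess_nonneg _)
  have hr0 : 0 ≤ (gaussianReal 0 1).real {r | lam < ω + t * r} * normalExcess (-ω) :=
    mul_nonneg measureReal_nonneg (normalExcess_nonneg _)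
  have hHB := hermiteBound_nonneg W N
  have hA0 : 0 ≤ hermiteBound W N / m + 8 / W ^ 2 := by positivity
  have hB0 : 0 ≤ 1 / L + ((1 + lam) / (W - lam) ^ 2 + 1 / (W - lam)) := by positivity
  have hmid : |P * (I - G ω β)| ≤ (hermiteBound W N / m + 8 / W ^ 2) +
      (1 / L + ((1 + lam) / (W - lam) ^ 2 + 1 / (W - lam))) := by
    rw [abs_mul, abs_of_nonneg hP0]
    rcases le_or_gt |ω| W with hω | hω
    · have := abs_trunc_mean_sub_le hW0 hω ht hβ0 hβ1 hm0 hN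
      have : P * |I - G ω β| ≤ 1 * (hermiteBound W N / m + 8 / W ^ 2) :=
        mul_le_mul hP1 this (abs_nonneg _) zero_le_one
      linarith
    · have h1 : |I| ≤ m := by
        rw [hI]
        refine abs_integral_le_integral_abs.trans ?_
        calc _ ≤ ∫ p : ℝ, m ∂(gaussianReal 0 1) :=
              integral_mono (integrable_trunc m hm0.le q ω t).abs (integrable_const m)
                fun p => abs_trunc_le hm0.le _
          _ = m := by simp
      have h2 := abs_G_le (w := ω) hβ0 hβ1
      have h3 : P ≤ 1 / (m * L) := hm ▸ midSet_prob_le hL htL hω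
      have ha : 0 < |ω| - lam := by linarith
      have h4 : P ≤ 1 / (|ω| - lam) ^ 2 :=
        ((measureReal_mono midSet_subset).trans (gaussian_chebyshev t ha)).trans (by gcongr)
      have h5 : P * |I - G ω β| ≤ P * m + (P * (1 + lam) + P * (|ω| - lam)) := by
        have : |I - G ω β| ≤ m + ((1 + lam) + (|ω| - lam)) :=
          (abs_sub _ _).trans (by linarith)
        calc _ ≤ P * (m + ((1 + lam) + (|ω| - lam))) := mul_le_mul_of_nonneg_left this hP0
          _ = _ := by ring
      have h6 : P * m ≤ 1 / L := by
        calc P * m ≤ 1 / (m * L) * m := mul_le_mul_of_nonneg_right h3 hm0.le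
          _ = 1 / L := by field_simp
      have h7 : P * (1 + lam) ≤ (1 + lam) / (W - lam) ^ 2 := by
        calc P * (1 + lam) ≤ 1 / (|ω| - lam) ^ 2 * (1 + lam) := by gcongr
          _ ≤ 1 / (W - lam) ^ 2 * (1 + lam) := by gcongr
          _ = _ := by ring
      have h8 : P * (|ω| - lam) ≤ 1 / (W - lam) := by
        calc P * (|ω| - lam) ≤ 1 / (|ω| - lam) ^ 2 * (|ω| - lam) := by gcongr
          _ = 1 / (|ω| - lam) := by field_simp
          _ ≤ _ := by gcongr
      linarith
  have h9 : 6 / lam = 3 / lam + 3 / lam := by ring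
  rw [biasBound, h9]
  rw [abs_le] at hmid ⊢
  constructor <;> linarith [hmid.1, hmid.2]

/-- When v lies on the wrong side, the excess is paid for by |v - ω|; in the middle |ω| ≤ λ + |v -
ω| controls G. Hence no bound on ω is needed, and only the truncated estimate remains as a separate
term. -/
lemma thresholdRule_sub_sq_le {β lam m ω u v : ℝ} (hβ0 : 0 ≤ β) (hβ1 : β ≤ 1) (hlam : 0 < lam)
    (q : Polynomial ℝ) :
    (thresholdRule β lam m q u v - G ω β) ^ 2 ≤
      6 * ((u - ω) ^ 2 + (v - ω) ^ 2 + (1 + lam ^ 2)) +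
        2 * ((if -lam ≤ v ∧ v ≤ lam then 1 else 0) * max (-m) (min (q.eval u) m) ^ 2) := by
  have key : ∀ x a b : ℝ, |x| ≤ a + b + 1 → 0 ≤ a → 0 ≤ b → x ^ 2 ≤ 6 * (a ^ 2 + b ^ 2 + 1) := by
    intro x a b h ha hb
    rw [← sq_abs]
    calc |x| ^ 2 ≤ (a + b + 1) ^ 2 := pow_le_pow_left₀ (abs_nonneg x) h 2
      _ ≤ _ := by nlinarith [sq_nonneg (a - b), sq_nonneg (a - 1), sq_nonneg (b - 1)]
  rcases lt_or_ge v (-lam) with h1 | h1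
  · rw [thresholdRule, if_pos h1, if_neg (fun h => by linarith [h.1]), zero_mul, mul_zero, add_zero]
    have hE0 := normalExcess_nonneg ω
    have hE := normalExcess_le' ω
    have hmax : max ω 0 ≤ |v - ω| := max_le (by rw [abs_sub_comm]; exact le_trans (by linarith) (le_abs_self _)) (abs_nonneg _)
    have := key (-β * u - G ω β) |u - ω| |v - ω| (by
      have e : -β * u - G ω β = -β * (u - ω) - normalExcess ω := by rw [G_eq]; ring
      rw [e]
      refine (abs_sub _ _).trans ?_
      rw [abs_mul, abs_neg, abs_of_nonneg hβ0, abs_of_nonneg hE0]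
      nlinarith [abs_nonneg (u - ω)]) (abs_nonneg _) (abs_nonneg _)
    rw [sq_abs, sq_abs] at this
    nlinarith [sq_nonneg lam]
  rcases le_or_gt v lam with h2 | h2
  · rw [thresholdRule, if_neg (not_lt.2 h1), if_pos h2, if_pos ⟨h1, h2⟩, one_mul]
    set S := max (-m) (min (q.eval u) m)
    have hG := abs_G_le (w := ω) hβ0 hβ1
    have hω : |ω| ≤ lam + |v - ω| := by
      have h5 := abs_sub_abs_le_abs_sub ω v
      have h6 : |v| ≤ lam := abs_le.2 ⟨h1, h2⟩
      rw [abs_sub_comm] at h5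
      linarith
    have hG2 : G ω β ^ 2 ≤ 3 * (1 + lam ^ 2 + (v - ω) ^ 2) := by
      rw [← sq_abs, ← sq_abs (v - ω)]
      calc |G ω β| ^ 2 ≤ (1 + lam + |v - ω|) ^ 2 :=
            pow_le_pow_left₀ (abs_nonneg _) (by linarith) 2
        _ ≤ _ := by nlinarith [sq_nonneg (1 - lam), sq_nonneg (1 - |v - ω|),
            sq_nonneg (lam - |v - ω|)]
    nlinarith [sq_nonneg (S + G ω β), sq_nonneg (u - ω)]
  · rw [thresholdRule, if_neg (not_lt.2 h1), if_neg (not_le.2 h2),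
      if_neg (fun h => by linarith [h.2]), zero_mul, mul_zero, add_zero]
    have hE0 := normalExcess_nonneg (-ω)
    have hE := normalExcess_le' (-ω)
    have hmax : max (-ω) 0 ≤ |v - ω| := max_le (le_trans (by linarith) (le_abs_self _)) (abs_nonneg _)
    have := key ((1 - β) * u - G ω β) |u - ω| |v - ω| (by
      have e : (1 - β) * u - G ω β = (1 - β) * (u - ω) - normalExcess (-ω) := by
        rw [G_eq]; linear_combination -normalExcess_sub_neg ω
      rw [e]
      refine (abs_sub _ _).trans ?_
      rw [abs_mul, abs_of_nonneg (by linarith : 0 ≤ 1 - β), abs_of_nonneg hE0]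
      nlinarith [abs_nonneg (u - ω)]) (abs_nonneg _) (abs_nonneg _)
    rw [sq_abs, sq_abs] at this
    nlinarith [sq_nonneg lam]

lemma integrable_thresholdRule_sub_sq {β lam m : ℝ} (hβ0 : 0 ≤ β) (hβ1 : β ≤ 1) (hm : 0 ≤ m)
    (q : Polynomial ℝ) (ω t κ : ℝ) :
    Integrable (fun p : ℝ × ℝ => (thresholdRule β lam m q (ω + t * p.1) (ω + t * p.2) - κ) ^ 2)
      ((gaussianReal 0 1).prod (gaussianReal 0 1)) := by
  have hdom : Integrable (fun p : ℝ × ℝ => 4 * (t ^ 2 * p.1 ^ 2) + 4 * (|ω| + m + |κ|) ^ 2)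
      ((gaussianReal 0 1).prod (gaussianReal 0 1)) := by
    have h1 : Integrable (fun p : ℝ × ℝ => p.1 ^ 2)
        ((gaussianReal 0 1).prod (gaussianReal 0 1)) := integrable_sq_std.comp_fst _
    exact ((h1.const_mul _).const_mul 4).add (integrable_const _)
  refine hdom.mono' ?_ (ae_of_all _ fun p => ?_)
  · have h := (measurable_thresholdRule β lam m q).comp
      (f := fun p : ℝ × ℝ => (ω + t * p.1, ω + t * p.2)) (by fun_prop)
    exact ((h.sub measurable_const).pow_const 2).aestronglyMeasurable
  · have h := abs_thresholdRule_le (lam := lam) hβ0 hβ1 hm q (ω + t * p.1) (ω + t * p.2)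
    have h2 : |thresholdRule β lam m q (ω + t * p.1) (ω + t * p.2) - κ| ≤
        |t * p.1| + (|ω| + m + |κ|) := by
      have := abs_add_le ω (t * p.1)
      exact (abs_sub _ _).trans (by linarith)
    rw [Real.norm_eq_abs, abs_of_nonneg (sq_nonneg _), ← sq_abs]
    calc _ ≤ (|t * p.1| + (|ω| + m + |κ|)) ^ 2 := pow_le_pow_left₀ (abs_nonneg _) h2 2
      _ ≤ 4 * |t * p.1| ^ 2 + 4 * (|ω| + m + |κ|) ^ 2 := by
        nlinarith [sq_nonneg (|t * p.1| - (|ω| + m + |κ|))]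
      _ = _ := by rw [sq_abs, mul_pow]

/-- By independence the remaining middle term is a second moment times a probability. For |ω| ≤ W
the Hermite bound applies; for |ω| > W the product is at most m² · 1/(mL) = m/L. The gain of 1/L
over m is what later pays for the union bound. -/
lemma integral_thresholdRule_sub_sq_le {β lam W L m ω t : ℝ} {N : ℕ} (hβ0 : 0 ≤ β) (hβ1 : β ≤ 1)
    (hlam : 0 < lam) (hW : lam < W) (hL : 0 < L) (htL : |t| * L ≤ W - lam)
    (ht : Real.exp 1 * t ^ 2 ≤ 1 / 2) (hm : m = Real.exp (L ^ 2 / 2)) :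
    ∫ p : ℝ × ℝ, (thresholdRule β lam m (hermitePoly β (t ^ 2) N) (ω + t * p.1) (ω + t * p.2)
        - G ω β) ^ 2 ∂((gaussianReal 0 1).prod (gaussianReal 0 1)) ≤
      6 * (3 + lam ^ 2) + 2 * (hermiteBound W N + m / L) := by
  have hm0 : 0 < m := hm ▸ Real.exp_pos _
  have hW0 : 0 < W := hlam.trans hW
  have ht1 := sq_le_one_of_exp_mul_sq_le ht
  set q := hermitePoly β (t ^ 2) N with hq
  set g := gaussianReal 0 1
  set S : ℝ → ℝ := fun p => max (-m) (min (q.eval (ω + t * p)) m) ^ 2 with hS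
  set I : ℝ → ℝ := (midSet ω t lam).indicator fun _ => (1 : ℝ) with hI
  have hSint : Integrable S g := by
    refine Integrable.of_bound (C := m ^ 2) ?_ (ae_of_all _ fun p => ?_)
    · have : Continuous S := by fun_prop
      exact this.aestronglyMeasurable
    · rw [Real.norm_eq_abs, abs_of_nonneg (sq_nonneg _)]
      simp only [hS]
      rw [← sq_abs]
      exact pow_le_pow_left₀ (abs_nonneg _) (abs_trunc_le hm0.le _) 2
  have hIint : Integrable I g := (integrable_const 1).indicator (measurableSet_midSet _ _ _)
  have hprod : Integrable (fun p : ℝ × ℝ => S p.1 * I p.2) (g.prod g) := hSint.mul_prod hIint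
  have h1 : Integrable (fun p : ℝ × ℝ => p.1 ^ 2) (g.prod g) := integrable_sq_std.comp_fst _
  have h2 : Integrable (fun p : ℝ × ℝ => p.2 ^ 2) (g.prod g) := integrable_sq_std.comp_snd _
  have hP : ∫ r, I r ∂g = g.real (midSet ω t lam) := by
    rw [hI, integral_indicator (measurableSet_midSet _ _ _)]; simp
  have e1 : ∫ p : ℝ × ℝ, p.1 ^ 2 ∂(g.prod g) = 1 := by
    rw [integral_fun_fst (fun x : ℝ => x ^ 2), integral_sq_gaussian]; simp
  have e2 : ∫ p : ℝ × ℝ, p.2 ^ 2 ∂(g.prod g) = 1 := by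
    rw [integral_fun_snd (fun x : ℝ => x ^ 2), integral_sq_gaussian]; simp
  have hle : ∀ p : ℝ × ℝ, (thresholdRule β lam m q (ω + t * p.1) (ω + t * p.2) - G ω β) ^ 2 ≤
      (6 * t ^ 2) * p.1 ^ 2 + (6 * t ^ 2) * p.2 ^ 2 + (6 * (1 + lam ^ 2) + 2 * (S p.1 * I p.2)) := by
    intro p
    refine (thresholdRule_sub_sq_le (ω := ω) hβ0 hβ1 hlam q).trans (le_of_eq ?_)
    have : (if -lam ≤ ω + t * p.2 ∧ ω + t * p.2 ≤ lam then (1 : ℝ) else 0) = I p.2 := by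
      by_cases h : p.2 ∈ midSet ω t lam
      · rw [hI, Set.indicator_of_mem h, if_pos (by exact h)]
      · rw [hI, Set.indicator_of_notMem h, if_neg (by exact h)]
    rw [this]
    simp only [hS]
    ring
  have hmid : (∫ p, S p ∂g) * g.real (midSet ω t lam) ≤ hermiteBound W N + m / L := by
    have hP0 : 0 ≤ g.real (midSet ω t lam) := measureReal_nonneg
    have hP1 : g.real (midSet ω t lam) ≤ 1 := measureReal_le_one
    have hHB := hermiteBound_nonneg W N
    have hmL : 0 ≤ m / L := by positivity
    rcases le_or_gt |ω| W with hω | hω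
    · have h3 : ∫ p, S p ∂g ≤ hermiteBound W N := by
        refine le_trans (integral_mono hSint (integrable_eval_sq ω t q) fun p => ?_)
          (integral_hermitePoly_sq_le hW0 hω ht hβ0 hβ1 N)
        simp only [hS]
        rw [← sq_abs, ← sq_abs (q.eval _)]
        exact pow_le_pow_left₀ (abs_nonneg _) (abs_trunc_le_abs hm0.le _) 2
      calc _ ≤ hermiteBound W N * 1 := mul_le_mul h3 hP1 hP0 hHB
        _ ≤ _ := by linarith
    · have h3 : ∫ p, S p ∂g ≤ m ^ 2 := by
        calc _ ≤ ∫ p : ℝ, m ^ 2 ∂g := by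
              refine integral_mono hSint (integrable_const _) fun p => ?_
              simp only [hS]
              rw [← sq_abs]
              exact pow_le_pow_left₀ (abs_nonneg _) (abs_trunc_le hm0.le _) 2
          _ = _ := by simp
      have h4 : g.real (midSet ω t lam) ≤ 1 / (m * L) := hm ▸ midSet_prob_le hL htL hω
      calc _ ≤ m ^ 2 * (1 / (m * L)) := mul_le_mul h3 h4 hP0 (by positivity)
        _ = m / L := by field_simp
        _ ≤ _ := by linarith
  have e3 := integral_prod_mul (μ := g) (ν := g) S I
  have h3 : Integrable (fun p : ℝ × ℝ => 6 * (1 + lam ^ 2) + 2 * (S p.1 * I p.2)) (g.prod g) :=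
    (integrable_const _).add (hprod.const_mul 2)
  have e4 : ∫ p : ℝ × ℝ, (6 * (1 + lam ^ 2) + 2 * (S p.1 * I p.2)) ∂(g.prod g) =
      6 * (1 + lam ^ 2) + 2 * ((∫ p, S p ∂g) * g.real (midSet ω t lam)) := by
    rw [integral_add (integrable_const _) (hprod.const_mul 2),
      integral_const_mul 2 (fun p : ℝ × ℝ => S p.1 * I p.2), e3, hP]
    simp
  calc _ ≤ ∫ p : ℝ × ℝ, ((6 * t ^ 2) * p.1 ^ 2 + (6 * t ^ 2) * p.2 ^ 2 +
        (6 * (1 + lam ^ 2) + 2 * (S p.1 * I p.2))) ∂(g.prod g) :=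
        integral_mono (integrable_thresholdRule_sub_sq hβ0 hβ1 hm0.le q ω t _)
          (((h1.const_mul _).add (h2.const_mul _)).add
            h3) hle
    _ = 6 * t ^ 2 + 6 * t ^ 2 + (6 * (1 + lam ^ 2) +
          2 * ((∫ p, S p ∂g) * g.real (midSet ω t lam))) := by
        rw [integral_add_three (h1.const_mul _) (h2.const_mul _) h3, integral_const_mul,
          integral_const_mul, e1, e2, e4, mul_one]
    _ ≤ _ := by nlinarith

/-! ### Rotation of a Gaussian pair and affine changes of variable -/

/-- A rotation by π/4. Sum and difference of the standardized observation and the added noise are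
therefore independent, which is the purpose of the noise. -/
lemma map_rotation_std : ((gaussianReal 0 1).prod (gaussianReal 0 1)).map
    (fun p : ℝ × ℝ => ((p.1 - p.2) / √2, (p.1 + p.2) / √2)) =
      (gaussianReal 0 1).prod (gaussianReal 0 1) := by
  have h := IsGaussian.map_rotation_eq_self (μ := gaussianReal 0 1)
    (by simp) (-(Real.pi / 4))
  have e : (fun p : ℝ × ℝ => ((p.1 - p.2) / √2, (p.1 + p.2) / √2)) =
      ContinuousLinearMap.rotation (-(Real.pi / 4)) := by
    ext p <;>
    · simp only [ContinuousLinearMap.rotation_apply, Real.cos_neg, Real.sin_neg,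
        Real.cos_pi_div_four, Real.sin_pi_div_four, smul_eq_mul]
      have h2 : √2 * √2 = 2 := Real.mul_self_sqrt (by norm_num)
      have h3 : √2 ≠ 0 := by positivity
      field_simp
      try rw [sq, h2]
      try ring
  rw [e, h]

lemma integral_rotation (F : ℝ → ℝ → ℝ) (hF : Measurable fun p : ℝ × ℝ => F p.1 p.2) :
    ∫ p : ℝ × ℝ, F ((p.1 + p.2) / √2) ((p.1 - p.2) / √2)
        ∂((gaussianReal 0 1).prod (gaussianReal 0 1)) =
      ∫ p : ℝ × ℝ, F p.1 p.2 ∂((gaussianReal 0 1).prod (gaussianReal 0 1)) := by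
  have hF' : Measurable fun p : ℝ × ℝ => F p.2 p.1 := hF.comp measurable_swap
  have h1 := integral_map (μ := (gaussianReal 0 1).prod (gaussianReal 0 1))
    (φ := fun p : ℝ × ℝ => ((p.1 - p.2) / √2, (p.1 + p.2) / √2)) (f := fun p => F p.2 p.1)
    (by fun_prop) hF'.aestronglyMeasurable
  rw [map_rotation_std] at h1
  rw [← h1]
  exact integral_prod_swap (fun p : ℝ × ℝ => F p.1 p.2)

lemma integrable_rotation (F : ℝ → ℝ → ℝ)
    (hF : Integrable (fun p : ℝ × ℝ => F p.1 p.2) ((gaussianReal 0 1).prod (gaussianReal 0 1))) :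
    Integrable (fun p : ℝ × ℝ => F ((p.1 + p.2) / √2) ((p.1 - p.2) / √2))
      ((gaussianReal 0 1).prod (gaussianReal 0 1)) := by
  have h1 : Integrable (fun p : ℝ × ℝ => F p.2 p.1)
      ((gaussianReal 0 1).prod (gaussianReal 0 1)) := hF.swap
  rw [← map_rotation_std] at h1
  exact h1.comp_measurable (f := fun p : ℝ × ℝ => ((p.1 - p.2) / √2, (p.1 + p.2) / √2))
    (by fun_prop)

lemma map_affine_std (m : ℝ) {v : ℝ} (hv : 0 ≤ v) :
    (gaussianReal 0 1).map (fun z => m + √v * z) = gaussianReal m v.toNNReal := by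
  have h1 := gaussianReal_map_const_mul (μ := 0) (v := 1) (√v)
  have h2 := gaussianReal_map_const_add (μ := √v * 0) (v := NNReal.mk (√v ^ 2) (sq_nonneg _) * 1) m
  rw [← h1, Measure.map_map (by fun_prop) (by fun_prop)] at h2
  have e : ((fun x => m + x) ∘ fun x => √v * x) = fun z => m + √v * z := rfl
  rw [e] at h2
  rw [h2, mul_zero, zero_add, mul_one]
  congr 1
  ext
  simp [Real.sq_sqrt hv, Real.coe_toNNReal v hv]

lemma integral_gaussianReal_eq_std (m : ℝ) {v : ℝ} (hv : 0 ≤ v) {f : ℝ → ℝ} (hf : Measurable f) :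
    ∫ x, f x ∂(gaussianReal m v.toNNReal) = ∫ z, f (m + √v * z) ∂(gaussianReal 0 1) := by
  rw [← map_affine_std m hv, integral_map (by fun_prop) hf.aestronglyMeasurable]

lemma integrable_gaussianReal_iff_std (m : ℝ) {v : ℝ} (hv : 0 ≤ v) {f : ℝ → ℝ}
    (hf : Measurable f) : Integrable f (gaussianReal m v.toNNReal) ↔
      Integrable (fun z => f (m + √v * z)) (gaussianReal 0 1) := by
  rw [← map_affine_std m hv, integrable_map_measure hf.aestronglyMeasurable (by fun_prop)]
  rfl

/-! ### Moments of the noise-averaged estimate of one coordinate -/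

namespace Model

variable (M : Model)

lemma bt_pos (i : ℕ) : 0 < M.bt i :=
  div_pos (M.b_pos i) (add_pos (M.b_pos i) (M.h_pos i))

lemma bt_lt_one (i : ℕ) : M.bt i < 1 := by
  rw [bt, div_lt_one (add_pos (M.b_pos i) (M.h_pos i))]
  linarith [M.h_pos i]

lemma shrink_nonneg (i : ℕ) (τ : ℝ≥0∞) : 0 ≤ M.shrink i τ := by
  rw [shrink]
  split_ifs
  · exact zero_le_one
  · exact div_nonneg ENNReal.toReal_nonneg (add_nonneg ENNReal.toReal_nonneg (M.varP_pos i).le)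

lemma shrink_le_one (i : ℕ) (τ : ℝ≥0∞) : M.shrink i τ ≤ 1 := by
  rw [shrink]
  split_ifs
  · exact le_rfl
  · refine div_le_one_of_le₀ ?_ (add_nonneg ENNReal.toReal_nonneg (M.varP_pos i).le)
    linarith [M.varP_pos i]

/-- The mean of the statistic `U_i(τ)` when the predictors shrink towards `η`. -/
noncomputable def uMean (θ : ℕ → ℝ) (i : ℕ) (η : ℝ) (τ : ℝ≥0∞) : ℝ :=
  M.cCoef i τ + M.dCoef i τ * (θ i - η)

/-- The signed standard deviation of `U_i(τ)`. -/
noncomputable def uDev (i : ℕ) (τ : ℝ≥0∞) : ℝ := M.dCoef i τ * √(M.varP i) * √2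

lemma uDev_sq (i : ℕ) (τ : ℝ≥0∞) : M.uDev i τ ^ 2 = 2 * M.varP i * M.dCoef i τ ^ 2 := by
  rw [uDev, mul_pow, mul_pow, Real.sq_sqrt (M.varP_pos i).le, Real.sq_sqrt (by norm_num)]
  ring

lemma uStat_eq (θ : ℕ → ℝ) (i : ℕ) (η : ℝ) (τ : ℝ≥0∞) (ξ z : ℝ) :
    M.uStat i τ (θ i + √(M.varP i) * ξ - η) z =
      M.uMean θ i η τ + M.uDev i τ * ((ξ + z) / √2) := by
  have h3 : √2 ≠ 0 := by positivity
  rw [uStat, uMean, uDev]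
  field_simp
  ring

lemma vStat_eq (θ : ℕ → ℝ) (i : ℕ) (η : ℝ) (τ : ℝ≥0∞) (ξ z : ℝ) :
    M.vStat i τ (θ i + √(M.varP i) * ξ - η) z =
      M.uMean θ i η τ + M.uDev i τ * ((ξ - z) / √2) := by
  have h3 : √2 ≠ 0 := by positivity
  rw [vStat, uMean, uDev]
  field_simp
  ring

lemma hermiteEst_eq (γ : ℕ → ℝ) (n i : ℕ) (τ : ℝ≥0∞) (u : ℝ) :
    M.hermiteEst γ n i τ u =
      (hermitePoly (M.bt i) (M.uDev i τ ^ 2) (M.order γ n i - 1)).eval u := by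
  have h : √(2 * M.varP i * M.dCoef i τ ^ 2) ^ 2 = M.uDev i τ ^ 2 := by
    rw [uDev_sq, Real.sq_sqrt]
    have := (M.varP_pos i).le
    positivity
  simp only [hermiteEst, hermitePoly, scaledH_eq_eval, h, deriv_G, taylorCoef,
    Polynomial.eval_add, Polynomial.eval_mul, Polynomial.eval_C, Polynomial.eval_X,
    Polynomial.eval_finsetSum]

lemma thrEst_eq (γ : ℕ → ℝ) (n i : ℕ) (τ : ℝ≥0∞) (x z : ℝ) :
    M.thrEst γ n i τ x z = thresholdRule (M.bt i) (thr γ n i) n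
      (hermitePoly (M.bt i) (M.uDev i τ ^ 2) (M.order γ n i - 1))
      (M.uStat i τ x z) (M.vStat i τ x z) := by
  rw [thrEst, thresholdRule, truncEst, hermiteEst_eq]

lemma measurable_thrEst (γ : ℕ → ℝ) (n i : ℕ) (τ : ℝ≥0∞) :
    Measurable fun p : ℝ × ℝ => M.thrEst γ n i τ p.1 p.2 := by
  simp only [thrEst_eq]
  exact (measurable_thresholdRule _ _ _ _).comp
    (f := fun p : ℝ × ℝ => (M.uStat i τ p.1 p.2, M.vStat i τ p.1 p.2))
    (by unfold uStat vStat; fun_prop)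

lemma abs_thrEst_le (γ : ℕ → ℝ) (n i : ℕ) (τ : ℝ≥0∞) (x z : ℝ) :
    |M.thrEst γ n i τ x z| ≤ |M.uStat i τ x z| + n := by
  rw [thrEst_eq]
  exact abs_thresholdRule_le (M.bt_pos i).le (M.bt_lt_one i).le (Nat.cast_nonneg n) _ _ _

lemma integrable_thrEst_sq (γ : ℕ → ℝ) (n i : ℕ) (τ : ℝ≥0∞) (x κ : ℝ) :
    Integrable (fun z => (M.thrEst γ n i τ x z - κ) ^ 2) (gaussianReal 0 1) ∧
    Integrable (fun z => M.thrEst γ n i τ x z - κ) (gaussianReal 0 1) := by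
  have hm : Measurable fun z => M.thrEst γ n i τ x z - κ :=
    ((M.measurable_thrEst γ n i τ).comp (measurable_const.prodMk measurable_id)).sub_const κ
  have hL2 : MemLp (fun z => M.thrEst γ n i τ x z - κ) 2 (gaussianReal 0 1) := by
    rw [memLp_two_iff_integrable_sq hm.aestronglyMeasurable]
    -- The dominating function is 2u² + 2(n + |κ|)², a polynomial in the noise through u.
    have hdom := integrable_eval_affine
      (M.cCoef i τ + M.dCoef i τ * x) (M.dCoef i τ * √(M.varP i))
      (Polynomial.C 2 * Polynomial.X ^ 2 + Polynomial.C (2 * ((n : ℝ) + |κ|) ^ 2))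
    refine hdom.mono' (hm.pow_const 2).aestronglyMeasurable (ae_of_all _ fun z => ?_)
    have h1 := M.abs_thrEst_le γ n i τ x z
    have h2 : |M.thrEst γ n i τ x z - κ| ≤ |M.uStat i τ x z| + (n + |κ|) :=
      (abs_sub _ _).trans (by linarith)
    have h3 : M.uStat i τ x z = M.cCoef i τ + M.dCoef i τ * x + M.dCoef i τ * √(M.varP i) * z := by
      rw [uStat]; ring
    rw [Real.norm_eq_abs, abs_of_nonneg (sq_nonneg _), ← sq_abs]
    calc _ ≤ (|M.uStat i τ x z| + (n + |κ|)) ^ 2 := pow_le_pow_left₀ (abs_nonneg _) h2 2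
      _ ≤ 2 * |M.uStat i τ x z| ^ 2 + 2 * (n + |κ|) ^ 2 := by
        nlinarith [sq_nonneg (|M.uStat i τ x z| - (n + |κ|))]
      _ = _ := by
        rw [sq_abs, h3]
        simp
  exact ⟨(memLp_two_iff_integrable_sq hm.aestronglyMeasurable).1 hL2,
    hL2.integrable (by norm_num)⟩

lemma measurable_rbEst (γ : ℕ → ℝ) (n i : ℕ) (τ : ℝ≥0∞) : Measurable (M.rbEst γ n i τ) := by
  have := StronglyMeasurable.integral_prod_right
    (f := fun x z => M.thrEst γ n i τ x z) (ν := gaussianReal 0 1)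
    (M.measurable_thrEst γ n i τ).stronglyMeasurable
  exact this.measurable

end Model

lemma sq_integral_le_integral_sq {Ω : Type*} [MeasurableSpace Ω] {μ : Measure Ω}
    [IsProbabilityMeasure μ] {f : Ω → ℝ} (hf : Integrable f μ)
    (hf2 : Integrable (fun x => f x ^ 2) μ) : (∫ x, f x ∂μ) ^ 2 ≤ ∫ x, f x ^ 2 ∂μ := by
  have h : 0 ≤ ∫ x, (f x - ∫ y, f y ∂μ) ^ 2 ∂μ := integral_nonneg fun x => sq_nonneg _
  set a := ∫ y, f y ∂μ with ha
  have e : ∫ x, (f x - a) ^ 2 ∂μ = ∫ x, f x ^ 2 ∂μ + ∫ x, (-2 * a) * f x ∂μ + ∫ x, a ^ 2 ∂μ := by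
    rw [← integral_add_three hf2 (hf.const_mul _) (integrable_const _)]
    congr 1; ext x; ring
  rw [e, integral_const_mul, ← ha] at h
  simp at h
  nlinarith

namespace Model

variable (M : Model)

/-- The threshold rule of coordinate `i` as a function of two independent standard normal
variables. -/
noncomputable def ruleOf (θ γ : ℕ → ℝ) (n i : ℕ) (η : ℝ) (τ : ℝ≥0∞) (p : ℝ × ℝ) : ℝ :=
  thresholdRule (M.bt i) (thr γ n i) n
    (hermitePoly (M.bt i) (M.uDev i τ ^ 2) (M.order γ n i - 1))
    (M.uMean θ i η τ + M.uDev i τ * p.1) (M.uMean θ i η τ + M.uDev i τ * p.2)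

lemma thrEst_eq_ruleOf (θ γ : ℕ → ℝ) (n i : ℕ) (η : ℝ) (τ : ℝ≥0∞) (p : ℝ × ℝ) :
    M.thrEst γ n i τ (θ i + √(M.varP i) * p.1 - η) p.2 =
      M.ruleOf θ γ n i η τ ((p.1 + p.2) / √2, (p.1 - p.2) / √2) := by
  rw [thrEst_eq, uStat_eq, vStat_eq, ruleOf]

lemma measurable_ruleOf (θ γ : ℕ → ℝ) (n i : ℕ) (η : ℝ) (τ : ℝ≥0∞) :
    Measurable (M.ruleOf θ γ n i η τ) :=
  (measurable_thresholdRule _ _ _ _).comp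
    (f := fun p : ℝ × ℝ => (M.uMean θ i η τ + M.uDev i τ * p.1, M.uMean θ i η τ + M.uDev i τ * p.2))
    (by fun_prop)

lemma memLp_ruleOf_sub (θ γ : ℕ → ℝ) (n i : ℕ) (η : ℝ) (τ : ℝ≥0∞) (κ : ℝ) :
    MemLp (fun p => M.ruleOf θ γ n i η τ p - κ) 2
      ((gaussianReal 0 1).prod (gaussianReal 0 1)) := by
  rw [memLp_two_iff_integrable_sq ((M.measurable_ruleOf θ γ n i η τ).sub_const κ).aestronglyMeasurable]
  exact integrable_thresholdRule_sub_sq (M.bt_pos i).le (M.bt_lt_one i).le (Nat.cast_nonneg n)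
    _ _ _ _

/-- Averaging over the noise preserves the mean, by Fubini, and does not increase the mean square
error, by Jensen. The rotation identifies the pair (data, noise) with the independent arguments of
`ruleOf`. -/
lemma rbEst_moments (θ γ : ℕ → ℝ) (n i : ℕ) (η : ℝ) (τ : ℝ≥0∞) (κ : ℝ) :
    MemLp (fun x => M.rbEst γ n i τ (x - η)) 2 (gaussianReal (θ i) (M.varP i).toNNReal) ∧
    ∫ x, M.rbEst γ n i τ (x - η) ∂(gaussianReal (θ i) (M.varP i).toNNReal) =
      ∫ p, M.ruleOf θ γ n i η τ p ∂((gaussianReal 0 1).prod (gaussianReal 0 1)) ∧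
    ∫ x, (M.rbEst γ n i τ (x - η) - κ) ^ 2 ∂(gaussianReal (θ i) (M.varP i).toNNReal) ≤
      ∫ p, (M.ruleOf θ γ n i η τ p - κ) ^ 2 ∂((gaussianReal 0 1).prod (gaussianReal 0 1)) := by
  have hv := (M.varP_pos i).le
  set g := gaussianReal 0 1 with hg
  have hmr : Measurable fun x => M.rbEst γ n i τ (x - η) :=
    (M.measurable_rbEst γ n i τ).comp (measurable_id.sub_const η)
  have hrule := M.measurable_ruleOf θ γ n i η τ
  -- square integrability on the product space
  have hsq : ∀ κ : ℝ, Integrable (fun p : ℝ × ℝ =>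
      (M.thrEst γ n i τ (θ i + √(M.varP i) * p.1 - η) p.2 - κ) ^ 2) (g.prod g) := by
    intro κ
    simp only [thrEst_eq_ruleOf]
    exact integrable_rotation (fun a b => (M.ruleOf θ γ n i η τ (a, b) - κ) ^ 2)
      ((M.memLp_ruleOf_sub θ γ n i η τ κ).integrable_sq)
  have hint : Integrable (fun p : ℝ × ℝ =>
      M.thrEst γ n i τ (θ i + √(M.varP i) * p.1 - η) p.2) (g.prod g) := by
    simp only [thrEst_eq_ruleOf]
    refine integrable_rotation (fun a b => M.ruleOf θ γ n i η τ (a, b)) ?_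
    have := (M.memLp_ruleOf_sub θ γ n i η τ 0).integrable (by norm_num)
    simpa using this
  have hjensen : ∀ κ ξ : ℝ, (M.rbEst γ n i τ (θ i + √(M.varP i) * ξ - η) - κ) ^ 2 ≤
      ∫ z, (M.thrEst γ n i τ (θ i + √(M.varP i) * ξ - η) z - κ) ^ 2 ∂g := by
    intro κ ξ
    obtain ⟨h1, h2⟩ := M.integrable_thrEst_sq γ n i τ (θ i + √(M.varP i) * ξ - η) κ
    have h3 := sq_integral_le_integral_sq h2 h1
    obtain ⟨-, h4⟩ := M.integrable_thrEst_sq γ n i τ (θ i + √(M.varP i) * ξ - η) 0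
    simp only [sub_zero] at h4
    rw [integral_sub h4 (integrable_const κ)] at h3
    simpa [rbEst] using h3
  have hsqr : ∀ κ : ℝ, Integrable
      (fun ξ => (M.rbEst γ n i τ (θ i + √(M.varP i) * ξ - η) - κ) ^ 2) g := by
    intro κ
    refine (hsq κ).integral_prod_left.mono' ?_ (ae_of_all _ fun ξ => ?_)
    · have : Measurable fun ξ => (M.rbEst γ n i τ (θ i + √(M.varP i) * ξ - η) - κ) ^ 2 :=
        (((M.measurable_rbEst γ n i τ).comp
          (by fun_prop : Measurable fun ξ : ℝ => θ i + √(M.varP i) * ξ - η)).sub_const κ).pow_const 2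
      exact this.aestronglyMeasurable
    · rw [Real.norm_eq_abs, abs_of_nonneg (sq_nonneg _)]
      exact hjensen κ ξ
  refine ⟨?_, ?_, ?_⟩
  · rw [memLp_two_iff_integrable_sq hmr.aestronglyMeasurable,
      integrable_gaussianReal_iff_std _ hv (hmr.pow_const 2)]
    simpa using hsqr 0
  · rw [integral_gaussianReal_eq_std _ hv hmr]
    have h1 := integral_prod _ hint
    have h2 := integral_rotation (fun a b => M.ruleOf θ γ n i η τ (a, b)) hrule
    simp only [thrEst_eq_ruleOf] at h1
    rw [h2] at h1
    rw [h1]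
    rfl
  · rw [integral_gaussianReal_eq_std _ hv ((hmr.sub_const κ).pow_const 2)]
    have h1 := integral_prod _ (hsq κ)
    have h2 := integral_rotation (fun a b => (M.ruleOf θ γ n i η τ (a, b) - κ) ^ 2)
      ((hrule.sub_const κ).pow_const 2)
    rw [← h2]
    simp only [← thrEst_eq_ruleOf]
    simp only [thrEst_eq_ruleOf] at h1 ⊢
    rw [h1]
    refine integral_mono (hsqr κ) ?_ fun ξ => ?_
    · have := (hsq κ).integral_prod_left
      simpa only [thrEst_eq_ruleOf] using this
    · refine (hjensen κ ξ).trans (le_of_eq ?_)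
      exact integral_congr_ae (ae_of_all _ fun z => by
        simp only [M.thrEst_eq_ruleOf θ γ n i η τ (ξ, z)])

end Model

/-! ### Bounds uniform in the coordinate and the hyperparameters -/

/-- A bound for `hermiteBound`, in terms of `L = √(2 log n)`. -/
noncomputable def hermiteSeq (L : ℝ) : ℝ :=
  3 * (L ^ 2 + 2 + (2 * L ^ 2 + 1) ^ 2) * Real.exp (L ^ 2 / 4)

/-- A uniform bound for the bias of the risk estimate, in terms of `L = √(2 log n)`. -/
noncomputable def biasSeq (γ₀ s₀ L : ℝ) : ℝ :=
  6 / (γ₀ * L) + (hermiteSeq L / Real.exp (L ^ 2 / 2) + 8 / (γ₀ * L) ^ 2) +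
    (1 / L + ((1 + L) / (s₀ * L) ^ 2 + 1 / (s₀ * L)))

/-- A uniform bound for the second moment of the risk estimate, in terms of `L = √(2 log n)`. -/
noncomputable def secondSeq (L : ℝ) : ℝ :=
  6 * (3 + L ^ 2) + 2 * (hermiteSeq L + Real.exp (L ^ 2 / 2) / L)

lemma two_lt_exp_one : (2 : ℝ) < Real.exp 1 := by
  have := Real.exp_one_gt_d9; linarith

lemma exp_one_lt_three : Real.exp 1 < (3 : ℝ) := by
  have := Real.exp_one_lt_d9; linarith

/-- The condition on W makes the exponent eW²/2 at most L²/4, so with n = exp(L²/2) the second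
moment is √n up to a polynomial in L. -/
lemma hermiteBound_le {W L : ℝ} {N : ℕ} (hWL : W ^ 2 ≤ L ^ 2 / (2 * Real.exp 1))
    (hN : (N : ℝ) ≤ Real.exp 1 ^ 2 * W ^ 2 + 1) : hermiteBound W N ≤ hermiteSeq L := by
  have he := two_lt_exp_one
  have he3 := exp_one_lt_three
  rw [le_div_iff₀ (by positivity)] at hWL
  have h1 : Real.exp 1 * W ^ 2 / 2 ≤ L ^ 2 / 4 := by linarith
  have h2 : W ^ 2 ≤ L ^ 2 := by nlinarith [sq_nonneg W]
  have h3 : (N : ℝ) ≤ 2 * L ^ 2 + 1 := by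
    have : Real.exp 1 ^ 2 * W ^ 2 = Real.exp 1 * (W ^ 2 * (2 * Real.exp 1)) / 2 := by ring
    nlinarith [sq_nonneg L]
  rw [hermiteBound, hermiteSeq]
  gcongr

lemma biasBound_le {lam W L γ₀ s₀ : ℝ} {N : ℕ} (hL : 0 < L) (hγ₀ : 0 < γ₀) (hs₀ : 0 < s₀)
    (h1 : γ₀ * L ≤ lam) (h2 : lam ≤ L) (h3 : s₀ * L ≤ W - lam)
    (hH : hermiteBound W N ≤ hermiteSeq L) :
    biasBound lam W L (Real.exp (L ^ 2 / 2)) N ≤ biasSeq γ₀ s₀ L := by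
  have hg : 0 < γ₀ * L := by positivity
  have hs : 0 < s₀ * L := by positivity
  have hlam : 0 < lam := hg.trans_le h1
  have hW : γ₀ * L ≤ W := by linarith
  rw [biasBound, biasSeq]
  gcongr

namespace Model

variable (M : Model)

lemma shrinkVar_pos (i : ℕ) (τ : ℝ≥0∞) : 0 < M.varF i + M.varP i * M.shrink i τ ^ 2 :=
  add_pos_of_pos_of_nonneg (M.varF_pos i) (mul_nonneg (M.varP_pos i).le (sq_nonneg _))

lemma uDev_sq_le (i : ℕ) (τ : ℝ≥0∞) : M.uDev i τ ^ 2 ≤ 2 * M.varP i / M.varF i := by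
  have h0 := M.shrink_nonneg i τ
  have h1 := M.shrink_le_one i τ
  have hf := M.varF_pos i
  have hp := M.varP_pos i
  rw [uDev_sq, dCoef, div_pow, Real.sq_sqrt (M.shrinkVar_pos i τ).le, neg_sq, mul_div_assoc']
  refine div_le_div₀ (by positivity) ?_ hf ?_
  · have : (1 - M.shrink i τ) ^ 2 ≤ 1 := by nlinarith
    nlinarith
  · have := mul_nonneg hp.le (sq_nonneg (M.shrink i τ))
    linarith

lemma sqrt_two_mul_ratio (i : ℕ) : √(2 * M.varP i / M.varF i) = √2 * √(M.varP i / M.varF i) := by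
  rw [mul_div_assoc, Real.sqrt_mul (by norm_num)]

/-- With L = √(2 log n) the truncation level n equals exp(L²/2). The choice W = (γ + R)L gives W - λ
= RL ≥ |t|L, because R bounds the deviation of U, and admissibility of γ gives W² ≤ L²/(2e). -/
lemma ruleOf_bounds (θ γ : ℕ → ℝ) {γ₀ s₀ : ℝ} (hγ₀ : 0 < γ₀) (hs₀ : 0 < s₀) {i n : ℕ}
    (h1 : γ₀ ≤ γ i) (h2 : γ i < 1 / √(4 * Real.exp 1) - √(M.varP i / M.varF i))
    (h3 : s₀ ≤ √(2 * M.varP i / M.varF i)) (hn : 2 ≤ n) (η : ℝ) (τ : ℝ≥0∞) :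
    |∫ p, M.ruleOf θ γ n i η τ p ∂((gaussianReal 0 1).prod (gaussianReal 0 1)) -
        G (M.uMean θ i η τ) (M.bt i)| ≤ biasSeq γ₀ s₀ √(2 * Real.log n) ∧
    ∫ p, (M.ruleOf θ γ n i η τ p - G (M.uMean θ i η τ) (M.bt i)) ^ 2
        ∂((gaussianReal 0 1).prod (gaussianReal 0 1)) ≤ secondSeq √(2 * Real.log n) := by
  have hnr : (1 : ℝ) < n := by exact_mod_cast hn
  have hlog : 0 < Real.log n := Real.log_pos hnr
  set L := √(2 * Real.log n) with hLdef
  have hL : 0 < L := Real.sqrt_pos.2 (by positivity)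
  have hL2 : L ^ 2 = 2 * Real.log n := Real.sq_sqrt (by positivity)
  have hm : (n : ℝ) = Real.exp (L ^ 2 / 2) := by
    rw [hL2, mul_div_cancel_left₀ _ (two_ne_zero), Real.exp_log (by linarith)]
  set r := √(M.varP i / M.varF i) with hr
  set R := √(2 * M.varP i / M.varF i) with hR
  have hr0 : 0 ≤ r := Real.sqrt_nonneg _
  have hRr : R = √2 * r := M.sqrt_two_mul_ratio i
  have hR0 : 0 < R := hs₀.trans_le h3
  have hρ : 0 ≤ 2 * M.varP i / M.varF i :=
    div_nonneg (mul_nonneg two_pos.le (M.varP_pos i).le) (M.varF_pos i).le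
  have hR2 : R ^ 2 = 2 * M.varP i / M.varF i := Real.sq_sqrt hρ
  have hγ : 0 < γ i := hγ₀.trans_le h1
  set a := 1 / √(4 * Real.exp 1) with ha
  have ha0 : 0 < a := by positivity
  have ha2 : a ^ 2 * (4 * Real.exp 1) = 1 := by
    rw [ha, div_pow, Real.sq_sqrt (by positivity), one_pow]
    field_simp
  have hs2 : √2 ^ 2 = 2 := Real.sq_sqrt (by norm_num)
  have hs1 : 1 ≤ √2 := Real.one_le_sqrt.2 (by norm_num)
  have he := two_lt_exp_one
  have ha1 : a ≤ 1 := by nlinarith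
  set W := (γ i + R) * L with hW
  -- As √2 ≥ 1, γ + √2 r ≤ √2 (γ + r), and γ + r < a by admissibility.
  have hsum : γ i + R ≤ √2 * a := by
    rw [hRr]; nlinarith
  have hthr : thr γ n i = γ i * L := rfl
  have hWL : W ^ 2 ≤ L ^ 2 / (2 * Real.exp 1) := by
    have : (γ i + R) ^ 2 ≤ (√2 * a) ^ 2 := pow_le_pow_left₀ (by positivity) hsum 2
    rw [le_div_iff₀ (by positivity), hW, mul_pow]
    have h5 : (γ i + R) ^ 2 * (2 * Real.exp 1) ≤ 1 := by
      calc _ ≤ (√2 * a) ^ 2 * (2 * Real.exp 1) := by gcongr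
        _ = 1 := by rw [mul_pow, hs2]; linarith
    nlinarith [sq_nonneg L]
  have ht2 := M.uDev_sq_le i τ
  have hte : Real.exp 1 * M.uDev i τ ^ 2 ≤ 1 / 2 := by
    have hra : r ≤ a := by linarith
    have : r ^ 2 ≤ a ^ 2 := pow_le_pow_left₀ hr0 hra 2
    have h6 : M.uDev i τ ^ 2 ≤ 2 * a ^ 2 := by
      rw [← hR2, hRr, mul_pow, hs2] at ht2
      linarith
    nlinarith
  have htL : |M.uDev i τ| * L ≤ W - thr γ n i := by
    rw [hthr, hW]
    have := mul_le_mul_of_nonneg_right (Real.abs_le_sqrt ht2 : |M.uDev i τ| ≤ R) hL.le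
    linarith
  have hX : Real.exp 1 ^ 2 * W ^ 2 = Real.exp 1 ^ 2 * (γ i + R) ^ 2 * (2 * Real.log n) := by
    rw [hW, mul_pow, hL2]; ring
  -- The number of Hermite terms is one less than the order, hence exactly ⌈e²W²⌉.
  have hNX : M.order γ n i - 1 = ⌈Real.exp 1 ^ 2 * (γ i + R) ^ 2 * (2 * Real.log n)⌉₊ :=
    Nat.add_sub_cancel_left _ _
  have hN1 : Real.exp 1 ^ 2 * W ^ 2 ≤ ((M.order γ n i - 1 : ℕ) : ℝ) := by
    rw [hX, hNX]
    exact Nat.le_ceil _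
  have hN2 : ((M.order γ n i - 1 : ℕ) : ℝ) ≤ Real.exp 1 ^ 2 * W ^ 2 + 1 := by
    rw [hX, hNX]
    exact (Nat.ceil_lt_add_one (hX ▸ by positivity)).le
  have hRL : 0 < R * L := by positivity
  have hlam0 : 0 < thr γ n i := by rw [hthr]; positivity
  have hlamW : thr γ n i < W := by rw [hthr, hW]; linarith
  have hγ1 : γ i ≤ 1 := by linarith
  have hlamL : thr γ n i ≤ L := by rw [hthr]; exact mul_le_of_le_one_left hL.le hγ1
  have hH := hermiteBound_le hWL hN2
  have hsL : s₀ * L ≤ W - thr γ n i := by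
    have := mul_le_mul_of_nonneg_right h3 hL.le
    rw [hthr, hW]; linarith
  have hgL : γ₀ * L ≤ thr γ n i := by rw [hthr]; gcongr
  constructor
  · refine (abs_thresholdRule_bias_le (M.bt_pos i).le (M.bt_lt_one i).le hlam0 hlamW hL htL hte hm
      hN1).trans ?_
    rw [hm]
    exact biasBound_le hL hγ₀ hs₀ hgL hlamL hsL hH
  · refine (integral_thresholdRule_sub_sq_le (N := M.order γ n i - 1) (M.bt_pos i).le
      (M.bt_lt_one i).le hlam0 hlamW hL htL hte hm).trans ?_
    rw [secondSeq, ← hm]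
    gcongr

end Model

/-! ### The predictive loss and its expectation -/

lemma map_linear_std (a b : ℝ) : ((gaussianReal 0 1).prod (gaussianReal 0 1)).map
    (fun p : ℝ × ℝ => a * p.1 + b * p.2) = gaussianReal 0 (a ^ 2 + b ^ 2).toNNReal := by
  have ha := gaussianReal_map_const_mul (μ := 0) (v := 1) a
  have hb := gaussianReal_map_const_mul (μ := 0) (v := 1) b
  have hc := gaussianReal_conv_gaussianReal (m₁ := a * 0) (m₂ := b * 0)
    (v₁ := NNReal.mk (a ^ 2) (sq_nonneg _) * 1) (v₂ := NNReal.mk (b ^ 2) (sq_nonneg _) * 1)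
  rw [← ha, ← hb, Measure.conv, Measure.map_prod_map _ _ (by fun_prop) (by fun_prop),
    Measure.map_map (by fun_prop) (by fun_prop)] at hc
  refine Eq.trans hc ?_
  congr 1
  · simp
  · ext
    simp [Real.coe_toNNReal _ (by positivity : 0 ≤ a ^ 2 + b ^ 2)]

lemma abs_G_sub_le {β : ℝ} (hβ0 : 0 ≤ β) (hβ1 : β ≤ 1) (w w' : ℝ) :
    |G w β - G w' β| ≤ |w - w'| := by
  have := Convex.norm_image_sub_le_of_norm_hasDerivWithin_le (f := fun w => G w β)
    (f' := fun w => Phi w - β) (C := 1) (s := Set.univ) (x := w') (y := w)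
    (fun x _ => (hasDerivAt_G x β).hasDerivWithinAt)
    (fun x _ => by
      rw [Real.norm_eq_abs, abs_le]
      have := Phi_nonneg x
      have := Phi_le_one x
      constructor <;> linarith) convex_univ trivial trivial
  simpa using this

lemma integrable_max_affine (m s : ℝ) :
    Integrable (fun z => max (m + s * z) 0) (gaussianReal 0 1) :=
  ((integrable_const m).add (integrable_id_std.const_mul s)).sup (integrable_const 0)

lemma integral_max_affine (m : ℝ) {s : ℝ} (hs : 0 < s) :
    ∫ z, max (m + s * z) 0 ∂(gaussianReal 0 1) = s * normalExcess (m / s) := by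
  rw [← integral_max_add, ← integral_const_mul]
  congr 1; ext z
  have h : m + s * z = s * (m / s + z) := by field_simp
  rw [h, mul_max_of_nonneg _ _ hs.le, mul_zero]

namespace Model

variable (M : Model)

/-- The loss of overestimating by `w`. -/
noncomputable def errLoss (i : ℕ) (w : ℝ) : ℝ := (M.b i + M.h i) * max w 0 - M.b i * w

lemma check_eq (i : ℕ) (y q : ℝ) :
    M.b i * max (y - q) 0 + M.h i * max (q - y) 0 = M.errLoss i (q - y) := by
  rw [errLoss]
  rcases le_total y q with h | h
  · rw [max_eq_right (by linarith), max_eq_left (by linarith)]; ring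
  · rw [max_eq_left (by linarith), max_eq_right (by linarith)]; ring

lemma measurable_errLoss (i : ℕ) : Measurable (M.errLoss i) := by
  unfold errLoss; fun_prop

lemma measurable_errLoss_sub (i : ℕ) (q : ℝ) : Measurable fun y => M.errLoss i (q - y) :=
  (M.measurable_errLoss i).comp (by fun_prop)

lemma sum_pos (i : ℕ) : 0 < M.b i + M.h i := add_pos (M.b_pos i) (M.h_pos i)

lemma integral_errLoss_affine (i : ℕ) (m : ℝ) {s : ℝ} (hs : 0 < s) :
    ∫ z, M.errLoss i (m + s * z) ∂(gaussianReal 0 1) =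
      (M.b i + M.h i) * s * G (m / s) (M.bt i) := by
  have hlin : Integrable (fun z : ℝ => m + s * z) (gaussianReal 0 1) :=
    (integrable_const m).add (integrable_id_std.const_mul s)
  have hlinv : ∫ z, (m + s * z) ∂(gaussianReal 0 1) = m := by
    rw [integral_add (integrable_const m) (integrable_id_std.const_mul s), integral_const_mul,
      integral_id_std]
    simp
  simp only [errLoss]
  rw [integral_sub ((integrable_max_affine m s).const_mul _) (hlin.const_mul _),
    integral_const_mul, integral_const_mul, hlinv, integral_max_affine m hs, G_eq, bt]
  have := (M.sum_pos i).ne'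
  field_simp

lemma abs_errLoss_le (i : ℕ) (w : ℝ) : |M.errLoss i w| ≤ (M.b i + M.h i) * |w| := by
  have hb := M.b_pos i
  have hh := M.h_pos i
  rw [errLoss, abs_le]
  rcases le_total w 0 with h | h
  · rw [max_eq_right h, abs_of_nonpos h]; constructor <;> nlinarith
  · rw [max_eq_left h, abs_of_nonneg h]; constructor <;> nlinarith

lemma coordLoss_eq (i : ℕ) (t q : ℝ) :
    M.coordLoss i t q = (M.b i + M.h i) * √(M.varF i) * G ((q - t) / √(M.varF i)) (M.bt i) := by
  have hf := M.varF_pos i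
  rw [coordLoss]
  simp only [check_eq]
  rw [integral_gaussianReal_eq_std t hf.le (M.measurable_errLoss_sub i q),
    ← M.integral_errLoss_affine i (q - t) (Real.sqrt_pos.2 hf)]
  -- The future enters the error q - y with a minus sign; symmetry of the noise removes it.
  have hm : (gaussianReal 0 1).map (fun x => -x) = gaussianReal 0 1 := by
    rw [gaussianReal_map_neg, neg_zero]
  conv_rhs => rw [← hm]
  have hF : Measurable fun z => M.errLoss i (q - t + √(M.varF i) * z) :=
    (M.measurable_errLoss i).comp (by fun_prop)
  rw [integral_map (by fun_prop) hF.aestronglyMeasurable]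
  congr 1; ext z; congr 1; ring

lemma abs_coordLoss_sub_le (i : ℕ) (t q q' : ℝ) :
    |M.coordLoss i t q - M.coordLoss i t q'| ≤ (M.b i + M.h i) * |q - q'| := by
  have hs := Real.sqrt_pos.2 (M.varF_pos i)
  have hb := M.sum_pos i
  rw [coordLoss_eq, coordLoss_eq, ← mul_sub, abs_mul, abs_of_pos (mul_pos hb hs)]
  have h := abs_G_sub_le (M.bt_pos i).le (M.bt_lt_one i).le ((q - t) / √(M.varF i))
    ((q' - t) / √(M.varF i))
  rw [← sub_div, sub_sub_sub_cancel_right, abs_div, abs_of_pos hs] at h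
  calc _ ≤ (M.b i + M.h i) * √(M.varF i) * (|q - q'| / √(M.varF i)) := by gcongr
    _ = _ := by field_simp

lemma abs_coordLoss_le (i : ℕ) (t q : ℝ) :
    |M.coordLoss i t q| ≤ (M.b i + M.h i) * (√(M.varF i) + |q - t|) := by
  have hs := Real.sqrt_pos.2 (M.varF_pos i)
  have hb := M.sum_pos i
  rw [coordLoss_eq, abs_mul, abs_of_pos (mul_pos hb hs)]
  have h := abs_G_le (w := (q - t) / √(M.varF i)) (M.bt_pos i).le (M.bt_lt_one i).le
  rw [abs_div, abs_of_pos hs] at h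
  calc _ ≤ (M.b i + M.h i) * √(M.varF i) * (1 / 2 + |q - t| / √(M.varF i)) := by gcongr
    _ = (M.b i + M.h i) * (√(M.varF i) / 2 + |q - t|) := by field_simp
    _ ≤ _ := by gcongr; linarith

lemma continuous_coordLoss (i : ℕ) (t : ℝ) : Continuous (M.coordLoss i t) := by
  have hG : Continuous fun w => G w (M.bt i) :=
    continuous_iff_continuousAt.2 fun w => (hasDerivAt_G w _).continuousAt
  have h : M.coordLoss i t = fun q =>
      (M.b i + M.h i) * √(M.varF i) * G ((q - t) / √(M.varF i)) (M.bt i) :=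
    funext fun q => M.coordLoss_eq i t q
  rw [h]
  fun_prop

/-- The prediction of one coordinate as a function of its observation. -/
noncomputable def qcoord (i : ℕ) (η : ℝ) (τ : ℝ≥0∞) (x : ℝ) : ℝ :=
  M.shrink i τ * x + (1 - M.shrink i τ) * η +
    √(M.varF i + M.shrink i τ * M.varP i) * PhiInv (M.bt i)

lemma qhat_eq {n : ℕ} (η : ℝ) (τ : ℝ≥0∞) (x : Fin n → ℝ) (i : Fin n) :
    M.qhat η τ x i = M.qcoord i η τ (x i) := rfl

/-- Past and future noise enter the prediction error through one normal variable of variance varF +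
α² varP, so the expected loss is again a value of G. Its argument is precisely the mean of U, which
makes U the right statistic for estimating it. -/
lemma integral_coordLoss_qcoord (θ : ℕ → ℝ) (i : ℕ) (η : ℝ) (τ : ℝ≥0∞) :
    ∫ x, M.coordLoss i (θ i) (M.qcoord i η τ x) ∂(gaussianReal (θ i) (M.varP i).toNNReal) =
      (M.b i + M.h i) * √(M.varF i + M.varP i * M.shrink i τ ^ 2) *
        G (M.uMean θ i η τ) (M.bt i) := by
  have hf := M.varF_pos i
  have hp := M.varP_pos i
  set α := M.shrink i τ with hα
  set ν := M.varF i + M.varP i * α ^ 2 with hν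
  have hν0 : 0 < ν := M.shrinkVar_pos i τ
  set m := (1 - α) * (η - θ i) + √(M.varF i + α * M.varP i) * PhiInv (M.bt i) with hm
  have hq : Measurable fun x => M.coordLoss i (θ i) (M.qcoord i η τ x) :=
    (M.continuous_coordLoss i _).measurable.comp (by unfold qcoord; fun_prop)
  rw [integral_gaussianReal_eq_std _ hp.le hq]
  have h1 : ∀ ξ : ℝ, M.coordLoss i (θ i) (M.qcoord i η τ (θ i + √(M.varP i) * ξ)) =
      ∫ z, M.errLoss i (m + (α * √(M.varP i) * ξ + (-√(M.varF i)) * z)) ∂(gaussianReal 0 1) := by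
    intro ξ
    rw [coordLoss]
    simp only [check_eq]
    rw [integral_gaussianReal_eq_std (θ i) hf.le (M.measurable_errLoss_sub i _)]
    congr 1; ext z; congr 1; rw [qcoord, hm]; ring
  simp only [h1]
  have hF : Measurable fun y => M.errLoss i (m + y) :=
    (M.measurable_errLoss i).comp (by fun_prop)
  have hint : Integrable (fun p : ℝ × ℝ =>
      M.errLoss i (m + (α * √(M.varP i) * p.1 + (-√(M.varF i)) * p.2)))
      ((gaussianReal 0 1).prod (gaussianReal 0 1)) := by
    have e1 : Integrable (fun p : ℝ × ℝ => p.1) ((gaussianReal 0 1).prod (gaussianReal 0 1)) :=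
      integrable_id_std.comp_fst _
    have e2 : Integrable (fun p : ℝ × ℝ => p.2) ((gaussianReal 0 1).prod (gaussianReal 0 1)) :=
      integrable_id_std.comp_snd _
    have e3 := (((integrable_const m).add ((e1.const_mul (α * √(M.varP i))).add
      (e2.const_mul (-√(M.varF i))))).abs.const_mul (M.b i + M.h i))
    exact e3.mono' (hF.comp (by fun_prop)).aestronglyMeasurable
      (ae_of_all _ fun p => M.abs_errLoss_le i _)
  rw [← integral_prod _ hint]
  have h2 := integral_map (μ := (gaussianReal 0 1).prod (gaussianReal 0 1))
    (φ := fun p : ℝ × ℝ => α * √(M.varP i) * p.1 + (-√(M.varF i)) * p.2)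
    (f := fun y => M.errLoss i (m + y)) (by fun_prop) hF.aestronglyMeasurable
  have hvar : (α * √(M.varP i)) ^ 2 + (-√(M.varF i)) ^ 2 = ν := by
    rw [mul_pow, neg_sq, Real.sq_sqrt hp.le, Real.sq_sqrt hf.le, hν]; ring
  rw [map_linear_std, hvar, integral_gaussianReal_eq_std 0 hν0.le hF] at h2
  rw [← h2]
  simp only [zero_add]
  rw [M.integral_errLoss_affine i m (Real.sqrt_pos.2 hν0)]
  congr 2
  have hd : M.dCoef i τ = -(1 - α) / √ν := rfl
  have hc : M.cCoef i τ = √(M.varF i + α * M.varP i) / √ν * PhiInv (M.bt i) := by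
    rw [cCoef, ← hα, Real.sqrt_div' _ (by positivity), hν, mul_comm (α ^ 2)]
  rw [uMean, hd, hc, hm]
  ring

lemma abs_qcoord_sub_le (i : ℕ) (η : ℝ) (τ : ℝ≥0∞) (x y : ℝ) :
    |M.qcoord i η τ x - M.qcoord i η τ y| ≤ |x - y| := by
  have h0 := M.shrink_nonneg i τ
  have h1 := M.shrink_le_one i τ
  have e : M.qcoord i η τ x - M.qcoord i η τ y = M.shrink i τ * (x - y) := by
    rw [qcoord, qcoord]; ring
  rw [e, abs_mul, abs_of_nonneg h0]
  exact mul_le_of_le_one_left (abs_nonneg _) h1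

lemma integral_sub_mean_sq (θ : ℕ → ℝ) (i : ℕ) :
    Integrable (fun x => (x - θ i) ^ 2) (gaussianReal (θ i) (M.varP i).toNNReal) ∧
    ∫ x, (x - θ i) ^ 2 ∂(gaussianReal (θ i) (M.varP i).toNNReal) = M.varP i := by
  have hp := M.varP_pos i
  have hmeas : Measurable fun x : ℝ => (x - θ i) ^ 2 := by fun_prop
  have e : ∀ z, (θ i + √(M.varP i) * z - θ i) ^ 2 = M.varP i * z ^ 2 := fun z => by
    rw [add_sub_cancel_left, mul_pow, Real.sq_sqrt hp.le]
  constructor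
  · rw [integrable_gaussianReal_iff_std _ hp.le hmeas]
    simp only [e]
    exact integrable_sq_std.const_mul _
  · rw [integral_gaussianReal_eq_std _ hp.le hmeas]
    simp only [e]
    rw [integral_const_mul, integral_sq_gaussian, mul_one]

/-- The loss is Lipschitz in the prediction and the prediction in the observation. Centring at the
prediction made from x = θ gives a bound that does not involve θ, η or τ. -/
lemma coordLoss_qcoord_moments (θ : ℕ → ℝ) (i : ℕ) (η : ℝ) (τ : ℝ≥0∞) :
    MemLp (fun x => M.coordLoss i (θ i) (M.qcoord i η τ x)) 2
      (gaussianReal (θ i) (M.varP i).toNNReal) ∧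
    ∫ x, (M.coordLoss i (θ i) (M.qcoord i η τ x) -
        M.coordLoss i (θ i) (M.qcoord i η τ (θ i))) ^ 2
        ∂(gaussianReal (θ i) (M.varP i).toNNReal) ≤ (M.b i + M.h i) ^ 2 * M.varP i := by
  obtain ⟨hi, hv⟩ := M.integral_sub_mean_sq θ i
  set κ := M.coordLoss i (θ i) (M.qcoord i η τ (θ i))
  have hq : Measurable fun x => M.coordLoss i (θ i) (M.qcoord i η τ x) :=
    (M.continuous_coordLoss i _).measurable.comp (by unfold qcoord; fun_prop)
  have hb := M.sum_pos i
  have hle : ∀ x, (M.coordLoss i (θ i) (M.qcoord i η τ x) - κ) ^ 2 ≤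
      (M.b i + M.h i) ^ 2 * (x - θ i) ^ 2 := fun x => by
    rw [← sq_abs, ← sq_abs (x - θ i), ← mul_pow]
    refine pow_le_pow_left₀ (abs_nonneg _) ((M.abs_coordLoss_sub_le i _ _ _).trans ?_) 2
    exact mul_le_mul_of_nonneg_left (M.abs_qcoord_sub_le i η τ x (θ i)) hb.le
  have hsq : Integrable (fun x => (M.coordLoss i (θ i) (M.qcoord i η τ x) - κ) ^ 2)
      (gaussianReal (θ i) (M.varP i).toNNReal) :=
    (hi.const_mul _).mono' ((hq.sub_const κ).pow_const 2).aestronglyMeasurable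
      (ae_of_all _ fun x => by
        rw [Real.norm_eq_abs, abs_of_nonneg (sq_nonneg _)]; exact hle x)
  constructor
  · have h := ((memLp_two_iff_integrable_sq (hq.sub_const κ).aestronglyMeasurable).2 hsq).add
      (memLp_const κ)
    refine h.congr_norm hq.aestronglyMeasurable (ae_of_all _ fun x => ?_)
    simp
  · calc _ ≤ ∫ x, (M.b i + M.h i) ^ 2 * (x - θ i) ^ 2
          ∂(gaussianReal (θ i) (M.varP i).toNNReal) := integral_mono hsq (hi.const_mul _) hle
      _ = _ := by rw [integral_const_mul, hv]

end Model

/-! ### Concentration at fixed hyperparameters -/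

lemma variance_le_integral_sub_sq {Ω : Type*} [MeasurableSpace Ω] {μ : Measure Ω}
    [IsProbabilityMeasure μ] {X : Ω → ℝ} (hX : MemLp X 2 μ) (κ : ℝ) :
    variance X μ ≤ ∫ x, (X x - κ) ^ 2 ∂μ := by
  rw [← variance_sub_const hX.aestronglyMeasurable κ]
  exact variance_le_expectation_sq (hX.sub (memLp_const κ)).aestronglyMeasurable

/-- Chebyshev's inequality for the average of independent coordinates. -/
lemma measure_abs_average_ge_le {n : ℕ} (hn : 0 < n) (μ : Fin n → Measure ℝ)
    [∀ i, IsProbabilityMeasure (μ i)] {D : Fin n → ℝ → ℝ} (hD : ∀ i, MemLp (D i) 2 (μ i))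
    {e V ε : ℝ} (hmean : ∀ i, |∫ x, D i x ∂(μ i)| ≤ e) (hvar : ∀ i, variance (D i) (μ i) ≤ V)
    (hε : 0 < ε) (he : e ≤ ε / 2) :
    Measure.pi μ {x | ε ≤ |(1 / (n : ℝ)) * ∑ i, D i (x i)|} ≤
      ENNReal.ofReal (4 * V / (n * ε ^ 2)) := by
  have hnr : (0 : ℝ) < n := by exact_mod_cast hn
  set X : (Fin n → ℝ) → ℝ := fun x => (1 / (n : ℝ)) * (∑ i, fun x : Fin n → ℝ => D i (x i)) x
    with hX
  have hcoord : ∀ i, MemLp (fun x : Fin n → ℝ => D i (x i)) 2 (Measure.pi μ) := fun i =>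
    (hD i).comp_measurePreserving (measurePreserving_eval μ i)
  have hsum : MemLp (∑ i, fun x : Fin n → ℝ => D i (x i)) 2 (Measure.pi μ) :=
    memLp_finsetSum' _ fun i _ => hcoord i
  have hXL : MemLp X 2 (Measure.pi μ) := hsum.const_mul _
  have hXvar : variance X (Measure.pi μ) ≤ V / n := by
    rw [hX, variance_const_mul, variance_sum_pi hD]
    calc (1 / (n : ℝ)) ^ 2 * ∑ i, variance (D i) (μ i) ≤ (1 / (n : ℝ)) ^ 2 * ∑ _i : Fin n, V := by
          gcongr with i; exact hvar i
      _ = V / n := by simp; field_simp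
  have hXmean : |∫ x, X x ∂(Measure.pi μ)| ≤ e := by
    have h1 : ∫ x, X x ∂(Measure.pi μ) = (1 / (n : ℝ)) * ∑ i, ∫ x, D i x ∂(μ i) := by
      simp only [hX, Finset.sum_apply]
      rw [integral_const_mul, integral_finsetSum _ fun i _ => (hcoord i).integrable (by norm_num)]
      congr 1
      exact Finset.sum_congr rfl fun i _ =>
        integral_comp_eval (hD i).aestronglyMeasurable
    rw [h1, abs_mul, abs_of_pos (by positivity : 0 < 1 / (n : ℝ))]
    calc 1 / (n : ℝ) * |∑ i, ∫ x, D i x ∂(μ i)| ≤ 1 / (n : ℝ) * ∑ _i : Fin n, e := by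
          gcongr
          exact (Finset.abs_sum_le_sum_abs _ _).trans (Finset.sum_le_sum fun i _ => hmean i)
      _ = e := by simp; field_simp
  -- The mean uses up at most ε/2, so a fluctuation of ε/2 remains.
  have hcheb := meas_ge_le_variance_div_sq hXL (c := ε / 2) (by positivity)
  refine (measure_mono fun x hx => ?_).trans (hcheb.trans (ENNReal.ofReal_le_ofReal ?_))
  · have h1 : ε ≤ |X x| := by
      simpa only [hX, Finset.sum_apply, Set.mem_ofPred_eq] using hx
    have h2 := abs_sub_abs_le_abs_sub (X x) (∫ x, X x ∂(Measure.pi μ))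
    exact (by linarith : ε / 2 ≤ |X x - ∫ x, X x ∂(Measure.pi μ)|)
  · calc variance X (Measure.pi μ) / (ε / 2) ^ 2 ≤ V / n / (ε / 2) ^ 2 := by gcongr
      _ = _ := by field_simp; norm_num

namespace Model

variable (M : Model)

/-- The contribution of one coordinate to the difference between the risk estimate and the loss. -/
noncomputable def errCoord (θ γ : ℕ → ℝ) (n i : ℕ) (η : ℝ) (τ : ℝ≥0∞) (x : ℝ) : ℝ :=
  (M.b i + M.h i) * √(M.varF i + M.varP i * M.shrink i τ ^ 2) * M.rbEst γ n i τ (x - η) -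
    M.coordLoss i (θ i) (M.qcoord i η τ x)

lemma ARED_sub_loss (θ γ : ℕ → ℝ) (n : ℕ) (η : ℝ) (τ : ℝ≥0∞) (x : Fin n → ℝ) :
    M.ARED γ n η τ x - M.loss θ n (M.qhat η τ x) =
      (1 / (n : ℝ)) * ∑ i : Fin n, M.errCoord θ γ n i η τ (x i) := by
  simp only [ARED, ARE, loss, errCoord, qhat_eq]
  rw [← mul_sub, ← Finset.sum_sub_distrib]

lemma errCoord_bounds (θ γ : ℕ → ℝ) {γ₀ s₀ B V P : ℝ} (hγ₀ : 0 < γ₀) (hs₀ : 0 < s₀) {i n : ℕ}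
    (h1 : γ₀ ≤ γ i) (h2 : γ i < 1 / √(4 * Real.exp 1) - √(M.varP i / M.varF i))
    (h3 : s₀ ≤ √(2 * M.varP i / M.varF i)) (hn : 2 ≤ n) (hB : M.b i + M.h i ≤ B)
    (hV : M.varF i + M.varP i ≤ V) (hP : M.varP i ≤ P) (η : ℝ) (τ : ℝ≥0∞) :
    MemLp (M.errCoord θ γ n i η τ) 2 (gaussianReal (θ i) (M.varP i).toNNReal) ∧
    |∫ x, M.errCoord θ γ n i η τ x ∂(gaussianReal (θ i) (M.varP i).toNNReal)| ≤
      B * √V * biasSeq γ₀ s₀ √(2 * Real.log n) ∧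
    variance (M.errCoord θ γ n i η τ) (gaussianReal (θ i) (M.varP i).toNNReal) ≤
      2 * B ^ 2 * (V * secondSeq √(2 * Real.log n) + P) := by
  set μ := gaussianReal (θ i) (M.varP i).toNNReal with hμ
  set ω := M.uMean θ i η τ with hω
  obtain ⟨r1, r2⟩ := M.ruleOf_bounds θ γ hγ₀ hs₀ h1 h2 h3 hn η τ
  obtain ⟨m1, m2, m3⟩ := M.rbEst_moments θ γ n i η τ (G ω (M.bt i))
  obtain ⟨l1, l2⟩ := M.coordLoss_qcoord_moments θ i η τ
  have l3 := M.integral_coordLoss_qcoord θ i η τ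
  set s := √(M.varF i + M.varP i * M.shrink i τ ^ 2) with hs
  set κ := M.coordLoss i (θ i) (M.qcoord i η τ (θ i)) with hκ
  have hb := M.sum_pos i
  have hB0 : 0 ≤ B := hb.le.trans hB
  have hs0 : 0 ≤ s := Real.sqrt_nonneg _
  have hνV : M.varF i + M.varP i * M.shrink i τ ^ 2 ≤ V := by
    have a0 := M.shrink_nonneg i τ
    have a1 := M.shrink_le_one i τ
    have : M.shrink i τ ^ 2 ≤ 1 := pow_le_one₀ a0 a1
    nlinarith [M.varP_pos i]
  have hsV : s ≤ √V := Real.sqrt_le_sqrt hνV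
  have hs2 : s ^ 2 ≤ V := by rw [hs, Real.sq_sqrt (M.shrinkVar_pos i τ).le]; exact hνV
  have hmem : MemLp (M.errCoord θ γ n i η τ) 2 μ := (m1.const_mul _).sub l1
  refine ⟨hmem, ?_, ?_⟩
  · have e : ∫ x, M.errCoord θ γ n i η τ x ∂μ = (M.b i + M.h i) * s *
        (∫ p, M.ruleOf θ γ n i η τ p ∂((gaussianReal 0 1).prod (gaussianReal 0 1)) -
          G ω (M.bt i)) := by
      simp only [errCoord]
      rw [integral_sub ((m1.integrable (by norm_num)).const_mul _) (l1.integrable (by norm_num)),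
        integral_const_mul, m2, l3, mul_sub]
    rw [e, abs_mul, abs_of_nonneg (by positivity)]
    gcongr
  -- The variance may be computed about any constant; this centre keeps both second moments bounded
  -- although ω is unbounded.
  · refine (variance_le_integral_sub_sq hmem
      ((M.b i + M.h i) * s * G ω (M.bt i) - κ)).trans ?_
    have i1 : Integrable (fun x => (M.rbEst γ n i τ (x - η) - G ω (M.bt i)) ^ 2) μ :=
      (m1.sub (memLp_const _)).integrable_sq
    have i2 : Integrable (fun x => (M.coordLoss i (θ i) (M.qcoord i η τ x) - κ) ^ 2) μ :=
      (l1.sub (memLp_const _)).integrable_sq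
    have i3 : Integrable (fun x => (M.errCoord θ γ n i η τ x -
        ((M.b i + M.h i) * s * G ω (M.bt i) - κ)) ^ 2) μ :=
      (hmem.sub (memLp_const _)).integrable_sq
    have hle : ∀ x, (M.errCoord θ γ n i η τ x - ((M.b i + M.h i) * s * G ω (M.bt i) - κ)) ^ 2 ≤
        2 * ((M.b i + M.h i) * s) ^ 2 * (M.rbEst γ n i τ (x - η) - G ω (M.bt i)) ^ 2 +
          2 * (M.coordLoss i (θ i) (M.qcoord i η τ x) - κ) ^ 2 := fun x => by
      rw [errCoord]
      nlinarith [sq_nonneg ((M.b i + M.h i) * s * (M.rbEst γ n i τ (x - η) - G ω (M.bt i)) +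
        (M.coordLoss i (θ i) (M.qcoord i η τ x) - κ))]
    have hsec0 : 0 ≤ secondSeq √(2 * Real.log n) :=
      le_trans (integral_nonneg fun p => sq_nonneg _) r2
    calc _ ≤ ∫ x, (2 * ((M.b i + M.h i) * s) ^ 2 *
          (M.rbEst γ n i τ (x - η) - G ω (M.bt i)) ^ 2 +
          2 * (M.coordLoss i (θ i) (M.qcoord i η τ x) - κ) ^ 2) ∂μ :=
          integral_mono i3 ((i1.const_mul _).add (i2.const_mul _)) hle
      _ = 2 * ((M.b i + M.h i) * s) ^ 2 *
            ∫ x, (M.rbEst γ n i τ (x - η) - G ω (M.bt i)) ^ 2 ∂μ +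
          2 * ∫ x, (M.coordLoss i (θ i) (M.qcoord i η τ x) - κ) ^ 2 ∂μ := by
          rw [integral_add (i1.const_mul _) (i2.const_mul _), integral_const_mul,
            integral_const_mul]
      _ ≤ 2 * (B ^ 2 * V) * secondSeq √(2 * Real.log n) + 2 * (B ^ 2 * P) := by
          have hV0 : 0 ≤ V := (sq_nonneg s).trans hs2
          rw [mul_pow]
          refine add_le_add (mul_le_mul ?_ (m3.trans r2) (integral_nonneg fun x => sq_nonneg _)
            (by positivity)) ?_
          · gcongr
          · refine mul_le_mul_of_nonneg_left (l2.trans ?_) two_pos.le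
            have := M.varP_pos i
            gcongr
      _ = _ := by ring

lemma measure_ARED_sub_loss_ge_le (θ γ : ℕ → ℝ) {γ₀ s₀ B V P : ℝ} (hγ₀ : 0 < γ₀) (hs₀ : 0 < s₀)
    (h1 : ∀ i, γ₀ ≤ γ i) (h2 : ∀ i, γ i < 1 / √(4 * Real.exp 1) - √(M.varP i / M.varF i))
    (h3 : ∀ i, s₀ ≤ √(2 * M.varP i / M.varF i)) {n : ℕ} (hn : 2 ≤ n)
    (hB : ∀ i, M.b i + M.h i ≤ B) (hV : ∀ i, M.varF i + M.varP i ≤ V) (hP : ∀ i, M.varP i ≤ P)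
    (η : ℝ) (τ : ℝ≥0∞) {ε : ℝ} (hε : 0 < ε)
    (he : B * √V * biasSeq γ₀ s₀ √(2 * Real.log n) ≤ ε / 2) :
    M.dataLaw θ n {x | ε ≤ |M.ARED γ n η τ x - M.loss θ n (M.qhat η τ x)|} ≤
      ENNReal.ofReal (4 * (2 * B ^ 2 * (V * secondSeq √(2 * Real.log n) + P)) / (n * ε ^ 2)) := by
  simp only [ARED_sub_loss]
  have h := fun i : Fin n => M.errCoord_bounds θ γ hγ₀ hs₀ (h1 i) (h2 i) (h3 i) hn (hB i) (hV i)
    (hP i) η τ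
  exact measure_abs_average_ge_le (by lia) _ (fun i => (h i).1) (fun i => (h i).2.1)
    (fun i => (h i).2.2) hε he

end Model

/-! ### Sample quantiles and the width of the data-quantile interval -/

/-- The number of observations that are at most `t`. -/
noncomputable def countLE {n : ℕ} (x : Fin n → ℝ) (t : ℝ) : ℕ := Nat.card {i : Fin n // x i ≤ t}

lemma countLE_eq {n : ℕ} (x : Fin n → ℝ) (t : ℝ) :
    countLE x t = (Finset.univ.filter fun i => x i ≤ t).card := by
  rw [countLE, Nat.card_eq_fintype_card, Fintype.card_subtype]

lemma countLE_mono {n : ℕ} (x : Fin n → ℝ) {s t : ℝ} (h : s ≤ t) : countLE x s ≤ countLE x t := by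
  rw [countLE_eq, countLE_eq]
  exact Finset.card_le_card fun i hi => by
    simp only [Finset.mem_filter, Finset.mem_univ, true_and] at hi ⊢
    exact hi.trans h

/-- The average absolute observation. -/
noncomputable def meanAbs {n : ℕ} (x : Fin n → ℝ) : ℝ := (1 / (n : ℝ)) * ∑ i, |x i|

lemma meanAbs_nonneg {n : ℕ} (x : Fin n → ℝ) : 0 ≤ meanAbs x :=
  mul_nonneg (by positivity) (Finset.sum_nonneg fun _ _ => abs_nonneg _)

lemma card_mul_le_sum_abs {n : ℕ} (x : Fin n → ℝ) (s : Finset (Fin n)) {t : ℝ}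
    (h : ∀ i ∈ s, t ≤ |x i|) : s.card * t ≤ ∑ i, |x i| :=
  calc (s.card : ℝ) * t = ∑ _i ∈ s, t := by simp
    _ ≤ ∑ i ∈ s, |x i| := Finset.sum_le_sum h
    _ ≤ _ := Finset.sum_le_sum_of_subset_of_nonneg (Finset.subset_univ s)
      fun _ _ _ => abs_nonneg _

namespace Model

lemma le_countLE_of_sampleQuantile_lt {n : ℕ} (hn : 0 < n) (x : Fin n → ℝ) {α : ℝ}
    (hα : α ≤ 1) {t : ℝ} (ht : sampleQuantile x α < t) :
    α * n ≤ countLE x t := by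
  have hnr : (0 : ℝ) < n := by exact_mod_cast hn
  -- For α > 1 the set would be empty and `sInf` would be 0.
  have hne : {t : ℝ | α ≤ (Nat.card {i : Fin n // x i ≤ t} : ℝ) / n}.Nonempty := by
    refine ⟨∑ i, |x i|, ?_⟩
    have : countLE x (∑ i, |x i|) = n := by
      rw [countLE_eq, Finset.filter_true_of_mem, Finset.card_univ, Fintype.card_fin]
      exact fun i _ => (le_abs_self _).trans
        (Finset.single_le_sum (f := fun i => |x i|) (fun _ _ => abs_nonneg _) (Finset.mem_univ i))
    have h2 : α ≤ (countLE x (∑ i, |x i|) : ℝ) / n := by rw [this, div_self hnr.ne']; exact hα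
    exact h2
  obtain ⟨s, hs, hst⟩ := exists_lt_of_csInf_lt hne ht
  have hs' : α ≤ (countLE x s : ℝ) / n := hs
  rw [le_div_iff₀ hnr] at hs'
  exact hs'.trans (by exact_mod_cast countLE_mono x hst.le)

lemma countLE_lt_of_lt_sampleQuantile {n : ℕ} (hn : 0 < n) (x : Fin n → ℝ) {α : ℝ}
    (hα : 0 < α) {t : ℝ} (ht : t < sampleQuantile x α) :
    (countLE x t : ℝ) < α * n := by
  have hnr : (0 : ℝ) < n := by exact_mod_cast hn
  -- For α ≤ 0 the set would be unbounded below and `sInf` would again be 0.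
  have hbdd : BddBelow {t : ℝ | α ≤ (Nat.card {i : Fin n // x i ≤ t} : ℝ) / n} := by
    refine ⟨-∑ i, |x i|, fun s hs => ?_⟩
    by_contra hlt
    have hlt := not_le.1 hlt
    have : countLE x s = 0 := by
      rw [countLE_eq, Finset.card_eq_zero, Finset.filter_eq_empty_iff]
      intro i _ hi
      have h1 := Finset.single_le_sum (f := fun i => |x i|) (fun _ _ => abs_nonneg _)
        (Finset.mem_univ i)
      have h2 := neg_abs_le (x i)
      linarith
    have hs' : α ≤ (countLE x s : ℝ) / n := hs
    rw [this] at hs'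
    simp at hs'
    linarith
  have h := notMem_of_lt_csInf ht hbdd
  have h' : ¬ α ≤ (countLE x t : ℝ) / n := h
  rw [le_div_iff₀ hnr] at h'
  exact not_le.1 h'

/-- Markov's inequality for the empirical law: a quantile far to the left forces a fraction β₀ of
the data, and one far to the right a fraction 1 - β₁, to have large absolute value. -/
lemma abs_sampleQuantile_le {n : ℕ} (hn : 0 < n) (x : Fin n → ℝ) {α : ℝ}
    {β₀ β₁ : ℝ} (hβ₀ : 0 < β₀) (hβ₁ : β₁ < 1) (h0 : β₀ ≤ α)
    (h1 : α ≤ β₁) : |sampleQuantile x α| ≤ (1 / β₀ + 1 / (1 - β₁)) * meanAbs x := by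
  have hnr : (0 : ℝ) < n := by exact_mod_cast hn
  have hm := meanAbs_nonneg x
  have hβ : 0 < 1 - β₁ := by linarith
  have hsum : ∑ i, |x i| = n * meanAbs x := by rw [meanAbs]; field_simp
  set m := sampleQuantile x α with hmdef
  have hA : 0 ≤ 1 / β₀ * meanAbs x := by positivity
  have hB : 0 ≤ 1 / (1 - β₁) * meanAbs x := by positivity
  rw [abs_le, add_mul]
  constructor
  · have : ∀ t, m < t → -(1 / β₀ * meanAbs x) ≤ t := by
      intro t ht
      rcases le_or_gt 0 t with h | h
      · linarith
      · have hc := le_countLE_of_sampleQuantile_lt hn x (by linarith) ht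
        rw [countLE_eq] at hc
        have hs := card_mul_le_sum_abs x (Finset.univ.filter fun i => x i ≤ t) (t := -t)
          (fun i hi => by
            simp only [Finset.mem_filter, Finset.mem_univ, true_and] at hi
            rw [abs_of_neg (by linarith)]; linarith)
        rw [hsum] at hs
        have h3 : n * (β₀ * -t) ≤ n * meanAbs x := by
          have : β₀ * n ≤ α * n := by gcongr
          nlinarith
        have h4 := le_of_mul_le_mul_left h3 hnr
        rw [neg_le, one_div_mul_eq_div, le_div_iff₀ hβ₀]
        linarith
    have := le_of_forall_gt_imp_ge_of_dense this
    linarith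
  · have : ∀ t, t < m → t ≤ 1 / (1 - β₁) * meanAbs x := by
      intro t ht
      rcases le_or_gt t 0 with h | h
      · linarith
      · have hc := countLE_lt_of_lt_sampleQuantile hn x (by linarith) ht
        rw [countLE_eq] at hc
        have hcard := Finset.card_filter_add_card_filter_not (s := (Finset.univ : Finset (Fin n)))
          (fun i => x i ≤ t)
        rw [Finset.card_univ, Fintype.card_fin] at hcard
        have hcr : ((Finset.univ.filter fun i => x i ≤ t).card : ℝ) +
          ((Finset.univ.filter fun i => ¬ x i ≤ t).card : ℝ) = n := by exact_mod_cast hcard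
        have hs := card_mul_le_sum_abs x (Finset.univ.filter fun i => ¬ x i ≤ t) (t := t)
          (fun i hi => by
            simp only [Finset.mem_filter, Finset.mem_univ, true_and, not_le] at hi
            exact hi.le.trans (le_abs_self _))
        rw [hsum] at hs
        have h3 : n * ((1 - β₁) * t) ≤ n * meanAbs x := by
          have : α * n ≤ β₁ * n := by gcongr
          nlinarith
        have h4 := le_of_mul_le_mul_left h3 hnr
        rw [one_div_mul_eq_div, le_div_iff₀ hβ]
        linarith
    have := le_of_forall_lt_imp_le_of_dense this
    linarith

/-- If two sample quantiles are close, many pairs of observations are close. -/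
lemma sq_le_card_close_pairs {n : ℕ} (hn : 0 < n) (x : Fin n → ℝ)
    {α₁ α₂ δ ℓ : ℝ} (h1 : 0 < α₁) (h2 : α₂ ≤ 1) (hδ : 0 ≤ δ)
    (h12 : α₁ + δ ≤ α₂) (hℓ : 0 < ℓ) (hw : sampleQuantile x α₂ - sampleQuantile x α₁ ≤ ℓ) :
    (δ * n) ^ 2 ≤ ∑ i, ∑ j, (if |x i - x j| ≤ 2 * ℓ then (1 : ℝ) else 0) := by
  -- Widening by ℓ/2 on each side makes both counting bounds applicable, and the length stays at
  -- most 2ℓ.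
  set a := sampleQuantile x α₁ - ℓ / 2 with hadef
  set b := sampleQuantile x α₂ + ℓ / 2 with hbdef
  have ha := countLE_lt_of_lt_sampleQuantile hn x h1 (t := a) (by linarith [hadef])
  have hb := le_countLE_of_sampleQuantile_lt hn x h2 (t := b) (by linarith [hbdef])
  have hnr : (0 : ℝ) < n := by exact_mod_cast hn
  set A := Finset.univ.filter fun i => x i ≤ b ∧ ¬ x i ≤ a with hA
  have hcard : (countLE x b : ℝ) ≤ countLE x a + A.card := by
    rw [countLE_eq, countLE_eq]
    have : (Finset.univ.filter fun i => x i ≤ b) ⊆ (Finset.univ.filter fun i => x i ≤ a) ∪ A := by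
      intro i hi
      simp only [hA, Finset.mem_union, Finset.mem_filter, Finset.mem_univ, true_and] at hi ⊢
      by_cases h : x i ≤ a
      · exact Or.inl h
      · exact Or.inr ⟨hi, h⟩
    exact_mod_cast (Finset.card_le_card this).trans (Finset.card_union_le _ _)
  have hAn : δ * n ≤ A.card := by nlinarith
  calc (δ * n) ^ 2 ≤ (A.card : ℝ) ^ 2 := pow_le_pow_left₀ (by positivity) hAn 2
    _ = ∑ i ∈ A, ∑ j ∈ A, (1 : ℝ) := by simp [sq]
    _ = ∑ i ∈ A, ∑ j ∈ A, (if |x i - x j| ≤ 2 * ℓ then (1 : ℝ) else 0) := by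
        refine Finset.sum_congr rfl fun i hi => Finset.sum_congr rfl fun j hj => ?_
        simp only [hA, Finset.mem_filter, Finset.mem_univ, true_and, not_le] at hi hj
        rw [if_pos]
        rw [abs_le]
        constructor <;> linarith [hi.1, hi.2, hj.1, hj.2, hadef, hbdef]
    _ ≤ ∑ i ∈ A, ∑ j, (if |x i - x j| ≤ 2 * ℓ then (1 : ℝ) else 0) :=
        Finset.sum_le_sum fun i _ => Finset.sum_le_sum_of_subset_of_nonneg (Finset.subset_univ A)
          fun j _ _ => by positivity
    _ ≤ _ := Finset.sum_le_sum_of_subset_of_nonneg (Finset.subset_univ A)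
          fun i _ _ => Finset.sum_nonneg fun j _ => by positivity

end Model

lemma gaussianReal_Icc_le (m : ℝ) {v s : ℝ} (hs : 0 < s) (hv : s ≤ v) (a b : ℝ) :
    gaussianReal m v.toNNReal (Set.Icc a b) ≤ ENNReal.ofReal ((b - a) / √s) := by
  have hv0 : 0 < v := hs.trans_le hv
  have hne : v.toNNReal ≠ 0 := (Real.toNNReal_pos.2 hv0).ne'
  rw [gaussianReal_apply _ hne]
  have hpdf : ∀ x, gaussianPDF m v.toNNReal x ≤ ENNReal.ofReal (1 / √s) := by
    intro x
    refine ENNReal.ofReal_le_ofReal ?_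
    rw [gaussianPDFReal_def, Real.coe_toNNReal v hv0.le]
    have h1 : Real.exp (-(x - m) ^ 2 / (2 * v)) ≤ 1 := by
      rw [Real.exp_le_one_iff, neg_div]
      have := div_nonneg (sq_nonneg (x - m)) (by positivity : 0 ≤ 2 * v)
      linarith
    have h2 : (√(2 * Real.pi * v))⁻¹ ≤ 1 / √s := by
      rw [one_div]
      refine inv_anti₀ (Real.sqrt_pos.2 hs) (Real.sqrt_le_sqrt ?_)
      nlinarith [Real.pi_gt_three]
    calc _ ≤ (√(2 * Real.pi * v))⁻¹ * 1 := mul_le_mul_of_nonneg_left h1 (by positivity)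
      _ ≤ _ := by linarith
  calc ∫⁻ x in Set.Icc a b, gaussianPDF m v.toNNReal x
      ≤ ∫⁻ _x in Set.Icc a b, ENNReal.ofReal (1 / √s) := lintegral_mono fun x => hpdf x
    _ = ENNReal.ofReal ((b - a) / √s) := by
      rw [setLIntegral_const, Real.volume_Icc, ← ENNReal.ofReal_mul (by positivity)]
      congr 1; ring

namespace Model

variable (M : Model)

instance (θ : ℕ → ℝ) (n : ℕ) : IsProbabilityMeasure (M.dataLaw θ n) := by
  unfold dataLaw; infer_instance

/-- Given x_i, the independent x_j must fall in an interval of length 2r, and its density is at most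
1/√s. -/
lemma measure_close_pair_le (θ : ℕ → ℝ) {n : ℕ} {s : ℝ} (hs : 0 < s) (hv : ∀ i, s ≤ M.varP i)
    {i j : Fin n} (hij : i ≠ j) (r : ℝ) :
    M.dataLaw θ n {x | |x i - x j| ≤ r} ≤ ENNReal.ofReal (2 * r / √s) := by
  set μ : Fin n → Measure ℝ := fun i => gaussianReal (θ i) (M.varP i).toNNReal with hμ
  have hind : iIndepFun (fun (i : Fin n) (x : Fin n → ℝ) => x i) (Measure.pi μ) := by
    have := iIndepFun_pi (μ := μ) (X := fun _ => id) (fun _ => aemeasurable_id)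
    simpa using this
  have hpair := (indepFun_iff_map_prod_eq_prod_map_map
    (measurable_pi_apply i).aemeasurable (measurable_pi_apply j).aemeasurable).1
    (hind.indepFun hij)
  rw [(measurePreserving_eval μ i).map_eq, (measurePreserving_eval μ j).map_eq] at hpair
  have hS : MeasurableSet {p : ℝ × ℝ | |p.1 - p.2| ≤ r} :=
    measurableSet_le (by fun_prop) measurable_const
  have h1 : M.dataLaw θ n {x | |x i - x j| ≤ r} =
      ((μ i).prod (μ j)) {p : ℝ × ℝ | |p.1 - p.2| ≤ r} := by
    rw [← hpair, Measure.map_apply (by fun_prop) hS]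
    rfl
  rw [h1, Measure.prod_apply hS]
  calc ∫⁻ a, μ j (Prod.mk a ⁻¹' {p : ℝ × ℝ | |p.1 - p.2| ≤ r}) ∂(μ i)
      ≤ ∫⁻ _a, ENNReal.ofReal (2 * r / √s) ∂(μ i) := lintegral_mono fun a => by
        refine (measure_mono fun b hb => ?_).trans
          ((gaussianReal_Icc_le (θ j) hs (hv j) (a - r) (a + r)).trans (le_of_eq (by congr 2; ring)))
        have hb' : |a - b| ≤ r := hb
        rw [abs_le] at hb'
        exact ⟨by linarith [hb'.2], by linarith [hb'.1]⟩
    _ = _ := by simp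

/-- The data-quantile interval is not short, with high probability. -/
lemma measure_short_interval_le (θ : ℕ → ℝ) {n : ℕ} (hn : 0 < n) {s : ℝ} (hs : 0 < s)
    (hv : ∀ i, s ≤ M.varP i) {α₁ α₂ δ ℓ : ℝ} (h1 : 0 < α₁) (h2 : α₂ ≤ 1) (hδ : 0 < δ)
    (h12 : α₁ + δ ≤ α₂) (hℓ : 0 < ℓ) :
    M.dataLaw θ n {x | sampleQuantile x α₂ - sampleQuantile x α₁ ≤ ℓ} ≤
      ENNReal.ofReal ((1 / n + 4 * ℓ / √s) / δ ^ 2) := by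
  have hnr : (0 : ℝ) < n := by exact_mod_cast hn
  set F : (Fin n → ℝ) → ℝ := fun x => ∑ i, ∑ j, (if |x i - x j| ≤ 2 * ℓ then (1 : ℝ) else 0) with hF
  have hset : ∀ i j : Fin n, MeasurableSet {x : Fin n → ℝ | |x i - x j| ≤ 2 * ℓ} := fun i j =>
    measurableSet_le (by fun_prop) measurable_const
  have hpair_int : ∀ i j : Fin n, Integrable
      (fun x : Fin n → ℝ => if |x i - x j| ≤ 2 * ℓ then (1 : ℝ) else 0) (M.dataLaw θ n) :=
    fun i j => by
      refine Integrable.of_bound (C := 1)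
        (Measurable.ite (hset i j) measurable_const measurable_const).aestronglyMeasurable
        (ae_of_all _ fun x => ?_)
      split_ifs <;> simp
  -- Diagonal pairs are always close; they produce the term 1/n of the final bound.
  have hpair : ∀ i j : Fin n, ∫ x, (if |x i - x j| ≤ 2 * ℓ then (1 : ℝ) else 0) ∂(M.dataLaw θ n) ≤
      (if i = j then 1 else 0) + 4 * ℓ / √s := by
    intro i j
    have e : ∫ x, (if |x i - x j| ≤ 2 * ℓ then (1 : ℝ) else 0) ∂(M.dataLaw θ n) =
        (M.dataLaw θ n).real {x | |x i - x j| ≤ 2 * ℓ} := by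
      rw [← integral_indicator_one (hset i j)]
      congr 1
    rw [e]
    have h4 : 0 ≤ 4 * ℓ / √s := by positivity
    split_ifs with hij
    · linarith [measureReal_le_one (μ := M.dataLaw θ n) (s := {x | |x i - x j| ≤ 2 * ℓ})]
    · rw [zero_add]
      refine ENNReal.toReal_le_of_le_ofReal h4 ?_
      refine (M.measure_close_pair_le θ hs hv hij _).trans (le_of_eq (by congr 2; ring))
  have hFint : Integrable F (M.dataLaw θ n) :=
    integrable_finsetSum _ fun i _ => integrable_finsetSum _ fun j _ => hpair_int i j
  have hFle : ∫ x, F x ∂(M.dataLaw θ n) ≤ n + n ^ 2 * (4 * ℓ / √s) := by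
    rw [hF, integral_finsetSum _ fun i _ => integrable_finsetSum _ fun j _ => hpair_int i j]
    calc _ ≤ ∑ i : Fin n, ∑ j : Fin n, ((if i = j then (1 : ℝ) else 0) + 4 * ℓ / √s) := by
          refine Finset.sum_le_sum fun i _ => ?_
          rw [integral_finsetSum _ fun j _ => hpair_int i j]
          exact Finset.sum_le_sum fun j _ => hpair i j
      _ = _ := by
          simp only [Finset.sum_add_distrib]
          simp
          ring
  have hmarkov := mul_meas_ge_le_integral_of_nonneg (μ := M.dataLaw θ n) (f := F)
    (ae_of_all _ fun x => Finset.sum_nonneg fun i _ => Finset.sum_nonneg fun j _ => by positivity)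
    hFint ((δ * n) ^ 2)
  have hr : (M.dataLaw θ n).real {x | (δ * n) ^ 2 ≤ F x} ≤ (1 / n + 4 * ℓ / √s) / δ ^ 2 := by
    rw [le_div_iff₀ (by positivity)]
    have h5 : (δ * n) ^ 2 * (M.dataLaw θ n).real {x | (δ * n) ^ 2 ≤ F x} ≤
        n + n ^ 2 * (4 * ℓ / √s) := hmarkov.trans hFle
    have h6 : (n : ℝ) ^ 2 * ((M.dataLaw θ n).real {x | (δ * n) ^ 2 ≤ F x} * δ ^ 2) ≤
        n ^ 2 * (1 / n + 4 * ℓ / √s) := by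
      calc _ = (δ * n) ^ 2 * (M.dataLaw θ n).real {x | (δ * n) ^ 2 ≤ F x} := by ring
        _ ≤ _ := h5
        _ = _ := by field_simp
    exact le_of_mul_le_mul_left h6 (by positivity)
  refine (measure_mono fun x hx => ?_).trans (ENNReal.le_ofReal_iff_toReal_le
    (measure_ne_top _ {x | (δ * n) ^ 2 ≤ F x}) (by positivity) |>.2 hr)
  exact sq_le_card_close_pairs hn x h1 h2 hδ.le h12 hℓ hx

end Model

/-! ### Lipschitz dependence of the loss on the hyperparameters -/

/-- The scale hyperparameter in the bounded variable `τ / (τ + 1)`. -/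
noncomputable def scaleVar (τ : ℝ≥0∞) : ℝ := if τ = ∞ then 1 else τ.toReal / (τ.toReal + 1)

lemma scaleVar_nonneg (τ : ℝ≥0∞) : 0 ≤ scaleVar τ := by
  have := ENNReal.toReal_nonneg (a := τ)
  rw [scaleVar]; split_ifs <;> positivity

lemma scaleVar_le_one (τ : ℝ≥0∞) : scaleVar τ ≤ 1 := by
  rw [scaleVar]
  split_ifs
  · exact le_rfl
  · exact div_le_one_of_le₀ (by linarith) (by linarith [ENNReal.toReal_nonneg (a := τ)])

lemma scaleVar_ofReal {k : ℝ} (h0 : 0 ≤ k) (h1 : k < 1) :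
    scaleVar (ENNReal.ofReal (k / (1 - k))) = k := by
  have h2 : 0 < 1 - k := by linarith
  rw [scaleVar, if_neg ENNReal.ofReal_ne_top, ENNReal.toReal_ofReal (by positivity)]
  field_simp
  ring

namespace Model

variable (M : Model)

lemma shrink_eq_scaleVar (i : ℕ) (τ : ℝ≥0∞) :
    M.shrink i τ = scaleVar τ / (scaleVar τ + M.varP i * (1 - scaleVar τ)) := by
  rw [shrink, scaleVar]
  split_ifs
  · simp
  · have h0 := ENNReal.toReal_nonneg (a := τ)
    have hp := M.varP_pos i
    set t := τ.toReal
    have h1 : t + M.varP i ≠ 0 := by positivity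
    have h2 : t + 1 ≠ 0 := by positivity
    have h3 : t / (t + 1) + M.varP i * (1 - t / (t + 1)) = (t + M.varP i) / (t + 1) := by
      field_simp; ring
    rw [h3]
    field_simp

/-- In the variable u = τ/(τ+1), which also covers τ = ∞, the shrinkage factor is a quotient whose
denominator is a convex combination of 1 and the past variance, hence at least min(1, s). -/
lemma abs_shrink_sub_le {s P : ℝ} (hs : 0 < s) (i : ℕ) (h1 : s ≤ M.varP i) (h2 : M.varP i ≤ P)
    (τ τ' : ℝ≥0∞) : |M.shrink i τ - M.shrink i τ'| ≤
      P / min 1 s ^ 2 * |scaleVar τ - scaleVar τ'| := by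
  rw [shrink_eq_scaleVar, shrink_eq_scaleVar]
  have hm : 0 < min 1 s := lt_min one_pos hs
  have hden : ∀ u : ℝ, 0 ≤ u → u ≤ 1 → min 1 s ≤ u + M.varP i * (1 - u) := fun u h0 h3 => by
    have h4 := min_le_left 1 s
    have h5 := (min_le_right 1 s).trans h1
    nlinarith
  set u := scaleVar τ
  set u' := scaleVar τ'
  have hu := hden u (scaleVar_nonneg _) (scaleVar_le_one _)
  have hu' := hden u' (scaleVar_nonneg _) (scaleVar_le_one _)
  have hp := M.varP_pos i
  set d := u + M.varP i * (1 - u) with hd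
  set d' := u' + M.varP i * (1 - u') with hd'
  have hd0 : 0 < d := hm.trans_le hu
  have hd0' : 0 < d' := hm.trans_le hu'
  have e : u / d - u' / d' = M.varP i / (d * d') * (u - u') := by
    field_simp
    rw [hd, hd']; ring
  rw [e, abs_mul, abs_of_pos (by positivity)]
  refine mul_le_mul_of_nonneg_right (div_le_div₀ (hp.le.trans h2) h2 (by positivity) ?_)
    (abs_nonneg _)
  rw [sq]
  exact mul_le_mul hu hu' hm.le hd0.le

lemma abs_qcoord_sub_mean_le (i : ℕ) {V Q : ℝ} (hV : M.varF i + M.varP i ≤ V)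
    (hQ : |PhiInv (M.bt i)| ≤ Q) (θ η : ℝ) (τ : ℝ≥0∞) (x : ℝ) :
    |M.qcoord i η τ x - θ| ≤ |x| + |η| + |θ| + √V * Q := by
  have h0 := M.shrink_nonneg i τ
  have h1 := M.shrink_le_one i τ
  have a1 : |M.shrink i τ * x| ≤ |x| := by
    rw [abs_mul, abs_of_nonneg h0]; exact mul_le_of_le_one_left (abs_nonneg _) h1
  have a2 : |(1 - M.shrink i τ) * η| ≤ |η| := by
    rw [abs_mul, abs_of_nonneg (by linarith)]
    exact mul_le_of_le_one_left (abs_nonneg _) (by linarith)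
  have a3 : |√(M.varF i + M.shrink i τ * M.varP i) * PhiInv (M.bt i)| ≤ √V * Q := by
    rw [abs_mul, abs_of_nonneg (Real.sqrt_nonneg _)]
    refine mul_le_mul (Real.sqrt_le_sqrt ?_) hQ (abs_nonneg _) (Real.sqrt_nonneg _)
    nlinarith [M.varP_pos i]
  rw [qcoord]
  have b1 := abs_add_le (M.shrink i τ * x + (1 - M.shrink i τ) * η)
    (√(M.varF i + M.shrink i τ * M.varP i) * PhiInv (M.bt i))
  have b2 := abs_add_le (M.shrink i τ * x) ((1 - M.shrink i τ) * η)
  exact (abs_sub _ _).trans (by linarith)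

lemma abs_qcoord_sub_qcoord_le (i : ℕ) {V Q : ℝ} (hV : M.varF i + M.varP i ≤ V)
    (hQ : |PhiInv (M.bt i)| ≤ Q) (hr : M.varP i ≤ M.varF i) (η η' : ℝ) (τ τ' : ℝ≥0∞) (x : ℝ) :
    |M.qcoord i η τ x - M.qcoord i η' τ' x| ≤
      |M.shrink i τ - M.shrink i τ'| * (|x| + |η| + √V * Q) + |η - η'| := by
  have hp := M.varP_pos i
  have hf := M.varF_pos i
  have h0 := M.shrink_nonneg i τ
  have h0' := M.shrink_nonneg i τ'
  have h1' := M.shrink_le_one i τ'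
  set α := M.shrink i τ
  set α' := M.shrink i τ'
  -- Multiplication by the sum of the roots, which is at least √varF; as varP ≤ varF, dividing by it
  -- leaves a factor √varF ≤ √V.
  have hsq : |√(M.varF i + α * M.varP i) - √(M.varF i + α' * M.varP i)| ≤ |α - α'| * √V := by
    have hA : 0 ≤ M.varF i + α * M.varP i := by positivity
    have hB : 0 ≤ M.varF i + α' * M.varP i := by positivity
    have e : (√(M.varF i + α * M.varP i) - √(M.varF i + α' * M.varP i)) *
        (√(M.varF i + α * M.varP i) + √(M.varF i + α' * M.varP i)) = (α - α') * M.varP i := by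
      ring_nf
      rw [Real.sq_sqrt (by linarith), Real.sq_sqrt (by linarith)]
      ring
    have hsum : √(M.varF i) ≤
        √(M.varF i + α * M.varP i) + √(M.varF i + α' * M.varP i) := by
      have h5 : √(M.varF i) ≤ √(M.varF i + α * M.varP i) :=
        Real.sqrt_le_sqrt (by nlinarith)
      linarith [Real.sqrt_nonneg (M.varF i + α' * M.varP i)]
    have hs0 : 0 < √(M.varF i) := Real.sqrt_pos.2 hf
    have e2 := congrArg abs e
    rw [abs_mul, abs_mul, abs_of_pos hp, abs_of_pos (hs0.trans_le hsum)] at e2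
    have h6 : |√(M.varF i + α * M.varP i) - √(M.varF i + α' * M.varP i)| * √(M.varF i) ≤
        |α - α'| * M.varP i := by
      rw [← e2]; gcongr
    have h7 : |α - α'| * M.varP i ≤ |α - α'| * √(M.varF i) * √(M.varF i) := by
      rw [mul_assoc, Real.mul_self_sqrt hf.le]; gcongr
    have h8 := le_of_mul_le_mul_right (h6.trans h7) hs0
    exact h8.trans (by gcongr; linarith)
  have e : M.qcoord i η τ x - M.qcoord i η' τ' x = (α - α') * (x - η) + (1 - α') * (η - η') +
      (√(M.varF i + α * M.varP i) - √(M.varF i + α' * M.varP i)) * PhiInv (M.bt i) := by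
    rw [qcoord, qcoord]; ring
  rw [e]
  refine (abs_add_le _ _).trans ((add_le_add_left (abs_add_le _ _) _).trans ?_)
  rw [abs_mul, abs_mul, abs_mul]
  have c1 : |α - α'| * |x - η| ≤ |α - α'| * (|x| + |η|) := by gcongr; exact abs_sub _ _
  have c2 : |1 - α'| * |η - η'| ≤ |η - η'| := by
    rw [abs_of_nonneg (by linarith)]
    exact mul_le_of_le_one_left (abs_nonneg _) (by linarith)
  have c3 : |√(M.varF i + α * M.varP i) - √(M.varF i + α' * M.varP i)| * |PhiInv (M.bt i)| ≤
      |α - α'| * √V * Q := by gcongr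
  linarith

lemma abs_average_le {n : ℕ} (c : Fin n → ℝ) (f : Fin n → ℝ) (h : ∀ i, |c i| ≤ f i) :
    |(1 / (n : ℝ)) * ∑ i, c i| ≤ (1 / (n : ℝ)) * ∑ i, f i := by
  rw [abs_mul, abs_of_nonneg (by positivity : 0 ≤ 1 / (n : ℝ))]
  gcongr
  exact (Finset.abs_sum_le_sum_abs _ _).trans (Finset.sum_le_sum fun i _ => h i)

lemma average_const_mul_abs_add {n : ℕ} (hn : 0 < n) (B c : ℝ) (x : Fin n → ℝ) :
    (1 / (n : ℝ)) * ∑ i, B * (|x i| + c) = B * (meanAbs x + c) := by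
  have hnr : (n : ℝ) ≠ 0 := by positivity
  rw [← Finset.mul_sum, Finset.sum_add_distrib, meanAbs]
  simp
  field_simp

lemma abs_loss_le {θ : ℕ → ℝ} {n : ℕ} (hn : 0 < n) {B V Q : ℝ} (hB : ∀ i, M.b i + M.h i ≤ B)
    (hV : ∀ i, M.varF i + M.varP i ≤ V) (hQ : ∀ i, |PhiInv (M.bt i)| ≤ Q) (η : ℝ) (τ : ℝ≥0∞)
    (x : Fin n → ℝ) : |M.loss θ n (M.qhat η τ x)| ≤
      B * (meanAbs x + (meanAbs (fun i : Fin n => θ i) + |η| + √V * (1 + Q))) := by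
  have hB0 : 0 ≤ B := (M.sum_pos 0).le.trans (hB 0)
  have h1 : ∀ i : Fin n, |M.coordLoss i (θ i) (M.qhat η τ x i)| ≤
      B * (|x i| + (|η| + √V * (1 + Q))) + B * (|θ i| + 0) := by
    intro i
    have h2 := M.abs_coordLoss_le i (θ i) (M.qhat η τ x i)
    have h3 := M.abs_qcoord_sub_mean_le i (hV i) (hQ i) (θ i) η τ (x i)
    have h4 : √(M.varF i) ≤ √V := Real.sqrt_le_sqrt (by linarith [M.varP_pos i, hV i])
    rw [qhat_eq] at h2 ⊢
    have hb := M.sum_pos i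
    refine h2.trans ?_
    calc _ ≤ B * (√V + (|x i| + |η| + |θ i| + √V * Q)) := by gcongr; exact hB i
      _ = _ := by ring
  refine (abs_average_le _ _ h1).trans (le_of_eq ?_)
  rw [Finset.sum_add_distrib, mul_add, average_const_mul_abs_add hn,
    average_const_mul_abs_add hn B 0 (fun i : Fin n => θ i)]
  ring

lemma abs_loss_sub_loss_le {θ : ℕ → ℝ} {n : ℕ} (hn : 0 < n) {B V Q s P : ℝ}
    (hB : ∀ i, M.b i + M.h i ≤ B)
    (hV : ∀ i, M.varF i + M.varP i ≤ V) (hQ : ∀ i, |PhiInv (M.bt i)| ≤ Q)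
    (hr : ∀ i, M.varP i ≤ M.varF i) (hs : 0 < s) (hsP : ∀ i, s ≤ M.varP i)
    (hP : ∀ i, M.varP i ≤ P) (η η' : ℝ) (τ τ' : ℝ≥0∞) (x : Fin n → ℝ) :
    |M.loss θ n (M.qhat η τ x) - M.loss θ n (M.qhat η' τ' x)| ≤
      B * (P / min 1 s ^ 2 * |scaleVar τ - scaleVar τ'| * (meanAbs x + (|η| + √V * Q)) +
        |η - η'|) := by
  have hB0 : 0 ≤ B := (M.sum_pos 0).le.trans (hB 0)
  have hQ0 : 0 ≤ Q := (abs_nonneg _).trans (hQ 0)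
  have hP0 : 0 ≤ P := (M.varP_pos 0).le.trans (hP 0)
  set A := P / min 1 s ^ 2 * |scaleVar τ - scaleVar τ'| with hA
  have hA0 : 0 ≤ A := by positivity
  have h1 : ∀ i : Fin n,
      |M.coordLoss i (θ i) (M.qhat η τ x i) - M.coordLoss i (θ i) (M.qhat η' τ' x i)| ≤
      (B * A) * (|x i| + (|η| + √V * Q)) + B * |η - η'| := by
    intro i
    have h2 := M.abs_coordLoss_sub_le i (θ i) (M.qhat η τ x i) (M.qhat η' τ' x i)
    have h3 := M.abs_qcoord_sub_qcoord_le i (hV i) (hQ i) (hr i) η η' τ τ' (x i)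
    have h4 := M.abs_shrink_sub_le hs i (hsP i) (hP i) τ τ'
    have hb := M.sum_pos i
    rw [qhat_eq, qhat_eq] at h2 ⊢
    refine h2.trans ?_
    calc _ ≤ B * (|M.shrink i τ - M.shrink i τ'| * (|x i| + |η| + √V * Q) + |η - η'|) := by
          gcongr; exact hB i
      _ ≤ B * (A * (|x i| + |η| + √V * Q) + |η - η'|) := by gcongr
      _ = _ := by ring
  have e : M.loss θ n (M.qhat η τ x) - M.loss θ n (M.qhat η' τ' x) = (1 / (n : ℝ)) *
      ∑ i : Fin n, (M.coordLoss i (θ i) (M.qhat η τ x i) -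
        M.coordLoss i (θ i) (M.qhat η' τ' x i)) := by
    rw [loss, loss, Finset.sum_sub_distrib, mul_sub]
  rw [e]
  refine (abs_average_le _ _ h1).trans (le_of_eq ?_)
  rw [Finset.sum_add_distrib, mul_add, average_const_mul_abs_add hn]
  have hnr : (n : ℝ) ≠ 0 := by positivity
  simp
  field_simp

/-! ### Approximation by the grids and their cardinality -/

namespace GridConstants

variable {M : Model} (C : M.GridConstants)

lemma C₁_pos : 0 < C.C₁ := (M.sum_pos 0).trans_le (C.weight_le 0)

lemma C₂_pos : 0 < C.C₂ := (M.varP_pos 0).trans_le (C.varP_le 0)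

lemma C₃_nonneg : 0 ≤ C.C₃ :=
  (mul_nonneg (div_pos (M.varP_pos 0) (M.varF_pos 0)).le (abs_nonneg _)).trans (C.ratio_le 0 0)

lemma mesh1_pos {n : ℕ} (ha : 0 < aSeq n) : 0 < C.mesh1 n := by
  have := C.C₁_pos
  rw [mesh1]; positivity

lemma mesh2_pos {n : ℕ} (ha : 0 < aSeq n) : 0 < C.mesh2 n := by
  have := C.C₁_pos
  have := C.C₂_pos
  have := C.C₃_nonneg
  have := C.C₄_pos
  have := phi_pos 0
  rw [mesh2]; positivity

/-- Round η down to the grid. If this leaves the interval on the left, the next grid point lies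
within one mesh of the left end, and a width of two meshes keeps it inside. -/
lemma exists_grid1_near {n : ℕ} (ha : 0 < aSeq n) {m₁ m₂ η : ℝ} (h1 : -aSeq n ≤ m₁)
    (h2 : m₂ ≤ aSeq n) (hw : 2 * C.mesh1 n ≤ m₂ - m₁) (hη : η ∈ Set.Icc m₁ m₂) :
    ∃ η' ∈ C.grid1 n ∩ Set.Icc m₁ m₂, |η - η'| ≤ C.mesh1 n := by
  have hδ := C.mesh1_pos ha
  set δ := C.mesh1 n with hδdef
  set k := ⌊(η + aSeq n) / δ⌋₊ with hk
  have hnn : 0 ≤ (η + aSeq n) / δ := div_nonneg (by linarith [hη.1]) hδ.le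
  have hle : k * δ ≤ η + aSeq n := (le_div_iff₀ hδ).1 (Nat.floor_le hnn)
  have hlt : η + aSeq n < (k + 1) * δ := (div_lt_iff₀ hδ).1 (Nat.lt_floor_add_one _)
  rcases le_or_gt m₁ (-aSeq n + k * δ) with h | h
  · have hb : -aSeq n + k * δ ≤ m₂ := by linarith [hη.2]
    refine ⟨-aSeq n + k * δ, ⟨⟨⟨by linarith, by linarith⟩, k, rfl⟩, h, hb⟩, ?_⟩
    rw [abs_le]; constructor <;> linarith
  · have hb1 : m₁ ≤ -aSeq n + (k + 1) * δ := by linarith [hη.1]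
    have hb2 : -aSeq n + (k + 1) * δ ≤ m₂ := by linarith
    refine ⟨-aSeq n + (k + 1) * δ, ⟨⟨⟨by linarith, by linarith⟩, k + 1, by push_cast; rfl⟩,
      hb1, hb2⟩, ?_⟩
    rw [abs_le]; constructor <;> linarith

lemma exists_grid2_near {n : ℕ} (ha : 0 < aSeq n) (τ : ℝ≥0∞) :
    ∃ τ' ∈ C.grid2 n, |scaleVar τ - scaleVar τ'| ≤ C.mesh2 n := by
  have hδ := C.mesh2_pos ha
  set δ := C.mesh2 n with hδdef
  have h0 := scaleVar_nonneg τ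
  have h1 := scaleVar_le_one τ
  set u := scaleVar τ
  obtain ⟨k, hk, hk1, hk2, hk3⟩ : ∃ k : ℕ, k < ⌈1 / δ⌉₊ ∧ k * δ < 1 ∧ k * δ ≤ u ∧
      u ≤ k * δ + δ := by
    -- The index ⌈u/δ⌉ - 1 rather than a floor keeps kδ strictly below u, hence below 1 even for τ =
    -- ∞; u = 0 takes k = 0.
    rcases h0.eq_or_lt with h | h
    · exact ⟨0, Nat.ceil_pos.2 (by positivity), by simp, by simp [← h], by simp [← h, hδ.le]⟩
    · have hpos : 0 < ⌈u / δ⌉₊ := Nat.ceil_pos.2 (by positivity)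
      have hc : ((⌈u / δ⌉₊ - 1 : ℕ) : ℝ) = ⌈u / δ⌉₊ - 1 := by
        rw [Nat.cast_sub hpos]; simp
      have hlt : ((⌈u / δ⌉₊ - 1 : ℕ) : ℝ) * δ < u := by
        rw [hc, ← lt_div_iff₀ hδ]
        linarith [Nat.ceil_lt_add_one (div_nonneg h0 hδ.le)]
      have hge : u ≤ ((⌈u / δ⌉₊ - 1 : ℕ) : ℝ) * δ + δ := by
        rw [hc]
        have := (div_le_iff₀ hδ).1 (Nat.le_ceil (u / δ))
        linarith
      refine ⟨⌈u / δ⌉₊ - 1, ?_, hlt.trans_le h1, hlt.le, hge⟩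
      have : ⌈u / δ⌉₊ ≤ ⌈1 / δ⌉₊ := Nat.ceil_le_ceil (by gcongr)
      lia
  refine ⟨ENNReal.ofReal (k * δ / (1 - k * δ)), ⟨k, hk, rfl⟩, ?_⟩
  rw [scaleVar_ofReal (by positivity) hk1, abs_le]
  constructor <;> linarith

/-- A bound for the number of grid points, as a function of `a_n`. -/
noncomputable def gridBound (a : ℝ) : ℝ :=
  (4 * C.C₁ * a ^ 2 + 1) *
    (2 * C.C₁ * C.C₂ * (2 * phi 0 + C.C₃ + √a * C.C₄ + a + a ^ 2) + 1)

lemma exists_finset_grid {n : ℕ} (ha : 0 < aSeq n) : ∃ s : Finset (ℝ × ℝ≥0∞),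
    C.grid1 n ×ˢ C.grid2 n ⊆ s ∧ (s.card : ℝ) ≤ C.gridBound (aSeq n) := by
  classical
  have hC₁ := C.C₁_pos
  have hδ := C.mesh1_pos ha
  have hδ2 := C.mesh2_pos ha
  set s₁ := (Finset.range (⌊2 * aSeq n / C.mesh1 n⌋₊ + 1)).image
    fun k : ℕ => -aSeq n + k * C.mesh1 n with hs₁
  set s₂ := (Finset.range ⌈1 / C.mesh2 n⌉₊).image
    fun k : ℕ => ENNReal.ofReal (k * C.mesh2 n / (1 - k * C.mesh2 n)) with hs₂
  refine ⟨s₁ ×ˢ s₂, ?_, ?_⟩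
  · rintro ⟨η, τ⟩ ⟨⟨hη, k, hk⟩, k', hk', hτ⟩
    simp only [Finset.coe_product, Set.mem_prod, Finset.mem_coe]
    refine ⟨Finset.mem_image.2 ⟨k, Finset.mem_range.2 ?_, hk.symm⟩,
      Finset.mem_image.2 ⟨k', Finset.mem_range.2 hk', hτ.symm⟩⟩
    refine Nat.lt_succ_of_le (Nat.le_floor ?_)
    rw [le_div_iff₀ hδ]
    simp only at hη hk
    linarith [hη.2]
  · rw [Finset.card_product, Nat.cast_mul, gridBound]
    have h1 : (s₁.card : ℝ) ≤ 4 * C.C₁ * aSeq n ^ 2 + 1 := by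
      have h2 : s₁.card ≤ ⌊2 * aSeq n / C.mesh1 n⌋₊ + 1 := by
        simpa using Finset.card_image_le (s := Finset.range (⌊2 * aSeq n / C.mesh1 n⌋₊ + 1))
          (f := fun k : ℕ => -aSeq n + k * C.mesh1 n)
      have h3 : 2 * aSeq n / C.mesh1 n = 4 * C.C₁ * aSeq n ^ 2 := by
        rw [mesh1]; field_simp; ring
      have h4 := Nat.floor_le (by positivity : 0 ≤ 2 * aSeq n / C.mesh1 n)
      rw [h3] at h2 h4
      have h5 : (s₁.card : ℝ) ≤ (⌊4 * C.C₁ * aSeq n ^ 2⌋₊ : ℝ) + 1 := by exact_mod_cast h2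
      linarith
    have h6 : (s₂.card : ℝ) ≤ 2 * C.C₁ * C.C₂ *
        (2 * phi 0 + C.C₃ + √(aSeq n) * C.C₄ + aSeq n + aSeq n ^ 2) + 1 := by
      have h2 : s₂.card ≤ ⌈1 / C.mesh2 n⌉₊ := by
        rw [hs₂]
        exact Finset.card_image_le.trans (Finset.card_range _).le
      have h3 : 1 / C.mesh2 n = 2 * C.C₁ * C.C₂ *
        (2 * phi 0 + C.C₃ + √(aSeq n) * C.C₄ + aSeq n + aSeq n ^ 2) := by
        rw [mesh2, one_div, inv_inv]
      have h4 := (Nat.ceil_lt_add_one (by positivity : 0 ≤ 1 / C.mesh2 n)).le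
      rw [h3] at h2 h4
      exact le_trans (by exact_mod_cast h2) h4
    exact mul_le_mul h1 h6 (Nat.cast_nonneg _) (by positivity)

end GridConstants

end Model

/-! ### Asymptotics of the rates -/

lemma tendsto_sqrt_two_log : Tendsto (fun n : ℕ => √(2 * Real.log n)) atTop atTop :=
  Real.tendsto_sqrt_atTop.comp
    ((Real.tendsto_log_atTop.comp tendsto_natCast_atTop_atTop).const_mul_atTop two_pos)

lemma tendsto_aSeq : Tendsto aSeq atTop atTop :=
  Real.tendsto_log_atTop.comp (Real.tendsto_log_atTop.comp tendsto_natCast_atTop_atTop)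

lemma hermiteSeq_mul_le {L : ℝ} (hL : 1 ≤ L) :
    hermiteSeq L * L ≤ 13824 * Real.exp (L ^ 2 / 2) := by
  have h4 : 1 ≤ L ^ 2 := one_le_pow₀ hL
  have h1 : L ^ 2 + 2 + (2 * L ^ 2 + 1) ^ 2 ≤ 12 * (L ^ 2) ^ 2 := by nlinarith
  -- Here 384 = 3! · 4³, from the cubic term of the exponential series.
  have h2 : (L ^ 2) ^ 3 ≤ 384 * Real.exp (L ^ 2 / 4) := by
    have := Real.pow_div_factorial_le_exp (L ^ 2 / 4) (by positivity) 3
    norm_num [Nat.factorial] at this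
    linarith
  have h3 : Real.exp (L ^ 2 / 2) = Real.exp (L ^ 2 / 4) * Real.exp (L ^ 2 / 4) := by
    rw [← Real.exp_add]; ring_nf
  have h5 : L ≤ L ^ 2 := by nlinarith
  rw [hermiteSeq, h3]
  calc _ ≤ 3 * (12 * (L ^ 2) ^ 2) * Real.exp (L ^ 2 / 4) * L ^ 2 := by gcongr
    _ = 36 * (L ^ 2) ^ 3 * Real.exp (L ^ 2 / 4) := by ring
    _ ≤ 36 * (384 * Real.exp (L ^ 2 / 4)) * Real.exp (L ^ 2 / 4) := by gcongr
    _ = _ := by ring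

lemma secondSeq_le {L : ℝ} (hL : 1 ≤ L) :
    secondSeq L ≤ 27842 * Real.exp (L ^ 2 / 2) / L := by
  have hL0 : 0 < L := by linarith
  rw [le_div_iff₀ hL0, secondSeq]
  have h1 := hermiteSeq_mul_le hL
  have h2 : (L ^ 2) ^ 2 ≤ 8 * Real.exp (L ^ 2 / 2) := by
    have := Real.pow_div_factorial_le_exp (L ^ 2 / 2) (by positivity) 2
    norm_num [Nat.factorial] at this
    linarith
  have h3 : (3 + L ^ 2) * L ≤ 4 * (L ^ 2) ^ 2 := by
    have h4 : 1 ≤ L ^ 2 := one_le_pow₀ hL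
    have h5 : L ≤ L ^ 2 := by nlinarith
    calc (3 + L ^ 2) * L ≤ (4 * L ^ 2) * L ^ 2 := by gcongr; linarith
      _ = _ := by ring
  have h6 : (6 * (3 + L ^ 2) + 2 * (hermiteSeq L + Real.exp (L ^ 2 / 2) / L)) * L =
      6 * ((3 + L ^ 2) * L) + 2 * (hermiteSeq L * L) + 2 * Real.exp (L ^ 2 / 2) := by
    field_simp
    ring
  rw [h6]
  -- The constant collects 6 · 4 · 8 + 2 · 13824 + 2 = 27842.
  linarith

lemma biasSeq_le {γ₀ s₀ L : ℝ} (hγ₀ : 0 < γ₀) (hs₀ : 0 < s₀) (hL : 1 ≤ L) :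
    biasSeq γ₀ s₀ L ≤ (6 / γ₀ + 13824 + 8 / γ₀ ^ 2 + 1 + 2 / s₀ ^ 2 + 1 / s₀) / L := by
  have hL0 : 0 < L := by linarith
  have h1 : hermiteSeq L / Real.exp (L ^ 2 / 2) ≤ 13824 / L := by
    rw [div_le_div_iff₀ (Real.exp_pos _) hL0]
    exact hermiteSeq_mul_le hL
  have h2 : 8 / (γ₀ * L) ^ 2 ≤ 8 / γ₀ ^ 2 / L := by
    rw [mul_pow, div_div]
    gcongr
    nlinarith
  have h3 : (1 + L) / (s₀ * L) ^ 2 ≤ 2 / s₀ ^ 2 / L := by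
    rw [div_div, div_le_div_iff₀ (by positivity) (by positivity)]
    have : (1 + L) * L ≤ 2 * L ^ 2 := by nlinarith
    calc (1 + L) * (s₀ ^ 2 * L) = s₀ ^ 2 * ((1 + L) * L) := by ring
      _ ≤ s₀ ^ 2 * (2 * L ^ 2) := by gcongr
      _ = _ := by ring
  have h4 : 6 / (γ₀ * L) = 6 / γ₀ / L := by rw [div_div]
  have h5 : 1 / (s₀ * L) = 1 / s₀ / L := by rw [div_div]
  rw [biasSeq, h4, h5]
  rw [add_div] at h3
  simp only [add_div]
  linarith

lemma eventually_biasSeq_le {γ₀ s₀ : ℝ} (hγ₀ : 0 < γ₀) (hs₀ : 0 < s₀) (c : ℝ) (hc : 0 ≤ c) {ε : ℝ}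
    (hε : 0 < ε) : ∀ᶠ n : ℕ in atTop, c * biasSeq γ₀ s₀ √(2 * Real.log n) ≤ ε := by
  have h := (tendsto_const_nhds (x := c * (6 / γ₀ + 13824 + 8 / γ₀ ^ 2 + 1 + 2 / s₀ ^ 2 +
    1 / s₀))).div_atTop tendsto_sqrt_two_log
  filter_upwards [h.eventually (gt_mem_nhds hε), tendsto_sqrt_two_log.eventually_ge_atTop 1]
    with n h1 h2
  refine le_trans ?_ h1.le
  rw [mul_div_assoc]
  exact mul_le_mul_of_nonneg_left (biasSeq_le hγ₀ hs₀ h2) hc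

/-- As a_n = log log n, L equals √2 exp(a_n/2): a gain of 1/L is exponentially small in a_n, whereas
the grid is only polynomial in it. -/
lemma sqrt_two_log_facts {n : ℕ} (ha : 0 < aSeq n) (hL : 1 ≤ √(2 * Real.log n)) :
    Real.exp (√(2 * Real.log n) ^ 2 / 2) = n ∧ √(2 * Real.log n) ≤ n ∧
      Real.exp (aSeq n / 2) ≤ √(2 * Real.log n) := by
  have hl : 0 < 2 * Real.log n := by
    by_contra h
    rw [Real.sqrt_eq_zero_of_nonpos (not_lt.1 h)] at hL
    linarith
  have hn : (0 : ℝ) < n := by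
    rcases Nat.eq_zero_or_pos n with rfl | h
    · simp at hl
    · exact_mod_cast h
  have h1 : Real.exp (√(2 * Real.log n) ^ 2 / 2) = n := by
    rw [Real.sq_sqrt hl.le, mul_div_cancel_left₀ _ two_ne_zero, Real.exp_log hn]
  refine ⟨h1, ?_, ?_⟩
  · have h2 := Real.add_one_le_exp (√(2 * Real.log n) ^ 2 / 2)
    nlinarith [sq_nonneg (√(2 * Real.log n) - 1)]
  · refine Real.le_sqrt_of_sq_le ?_
    rw [← Real.exp_nat_mul, Nat.cast_ofNat, mul_div_cancel₀ _ two_ne_zero, aSeq,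
      Real.exp_log (by linarith)]
    linarith

namespace Model.GridConstants

variable {M : Model} (C : M.GridConstants)

lemma tendsto_mesh1 : Tendsto C.mesh1 atTop (𝓝 0) :=
  tendsto_inv_atTop_zero.comp
    (tendsto_aSeq.const_mul_atTop (mul_pos two_pos C.C₁_pos))

/-- The mesh has order a_n⁻², which absorbs the factor of order a_n contributed by the data and by η
in the Lipschitz bound. -/
lemma tendsto_mesh2 (c d : ℝ) :
    Tendsto (fun n => C.mesh2 n * (c * aSeq n + d)) atTop (𝓝 0) := by
  have hC₁ := C.C₁_pos
  have hC₂ := C.C₂_pos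
  have hC₃ := C.C₃_nonneg
  have hC₄ := C.C₄_pos
  have h := (tendsto_const_nhds (x := (2 * C.C₁ * C.C₂)⁻¹ * (|c| + |d|))).div_atTop tendsto_aSeq
  refine squeeze_zero_norm' ?_ h
  filter_upwards [tendsto_aSeq.eventually_ge_atTop 1] with n ha
  have ha0 : 0 < aSeq n := by linarith
  have h1 : C.mesh2 n ≤ (2 * C.C₁ * C.C₂ * aSeq n ^ 2)⁻¹ := by
    rw [mesh2]
    have := phi_pos 0
    gcongr
    have : 0 ≤ √(aSeq n) * C.C₄ := by positivity
    linarith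
  have h2 : |c * aSeq n + d| ≤ (|c| + |d|) * aSeq n := by
    refine (abs_add_le _ _).trans ?_
    rw [abs_mul, abs_of_pos ha0, add_mul]
    gcongr
    exact le_mul_of_one_le_right (abs_nonneg _) ha
  rw [Real.norm_eq_abs, abs_mul, abs_of_pos (C.mesh2_pos ha0)]
  calc _ ≤ (2 * C.C₁ * C.C₂ * aSeq n ^ 2)⁻¹ * ((|c| + |d|) * aSeq n) := by gcongr
    _ = _ := by field_simp

lemma gridBound_le {a : ℝ} (ha : 1 ≤ a) : C.gridBound a ≤
    (4 * C.C₁ + 1) * (2 * C.C₁ * C.C₂ * (2 * phi 0 + C.C₃ + C.C₄ + 2) + 1) * a ^ 4 := by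
  have hC₁ := C.C₁_pos
  have hC₂ := C.C₂_pos
  have hC₃ := C.C₃_nonneg
  have hC₄ := C.C₄_pos
  have hφ := phi_pos 0
  have h1 : 1 ≤ a ^ 2 := one_le_pow₀ ha
  have h2 : a ≤ a ^ 2 := by nlinarith
  have h3 : √a ≤ a ^ 2 := (Real.sqrt_le_left (by linarith)).2 (by nlinarith [one_le_pow₀ (n := 4) ha])
  have h4 : 4 * C.C₁ * a ^ 2 + 1 ≤ (4 * C.C₁ + 1) * a ^ 2 := by linarith
  have h5 : 2 * phi 0 + C.C₃ + √a * C.C₄ + a + a ^ 2 ≤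
      (2 * phi 0 + C.C₃ + C.C₄ + 2) * a ^ 2 := by
    nlinarith [mul_le_mul_of_nonneg_right h3 hC₄.le]
  have h6 : 2 * C.C₁ * C.C₂ * (2 * phi 0 + C.C₃ + √a * C.C₄ + a + a ^ 2) + 1 ≤
      (2 * C.C₁ * C.C₂ * (2 * phi 0 + C.C₃ + C.C₄ + 2) + 1) * a ^ 2 := by
    calc _ ≤ 2 * C.C₁ * C.C₂ * ((2 * phi 0 + C.C₃ + C.C₄ + 2) * a ^ 2) + a ^ 2 := by gcongr
      _ = _ := by ring
  calc C.gridBound a ≤ ((4 * C.C₁ + 1) * a ^ 2) *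
      ((2 * C.C₁ * C.C₂ * (2 * phi 0 + C.C₃ + C.C₄ + 2) + 1) * a ^ 2) :=
        mul_le_mul h4 h6 (by positivity) (by positivity)
    _ = _ := by ring

/-- At most a constant times a_n⁴ grid points, each with Chebyshev probability O(1/L), give a total
of order a_n⁴ exp(-a_n/2). -/
lemma tendsto_gridBound_mul {V P B ε : ℝ} (hV : 0 ≤ V) (hP : 0 ≤ P) :
    Tendsto (fun n : ℕ => C.gridBound (aSeq n) *
      (4 * (2 * B ^ 2 * (V * secondSeq √(2 * Real.log n) + P)) / (n * ε ^ 2))) atTop (𝓝 0) := by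
  set D := (4 * C.C₁ + 1) * (2 * C.C₁ * C.C₂ * (2 * phi 0 + C.C₃ + C.C₄ + 2) + 1) with hD
  have hC₁ := C.C₁_pos
  have hC₂ := C.C₂_pos
  have hC₃ := C.C₃_nonneg
  have hC₄ := C.C₄_pos
  have hφ := phi_pos 0
  have hD0 : 0 ≤ D := by positivity
  set E := 8 * B ^ 2 * (27842 * V + P) / ε ^ 2 with hE
  have hE0 : 0 ≤ E := by positivity
  have hlim : Tendsto (fun n => D * E * 16 * ((aSeq n / 2) ^ 4 * Real.exp (-(aSeq n / 2)))) atTop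
      (𝓝 0) := by
    have h := ((Real.tendsto_pow_mul_exp_neg_atTop_nhds_zero 4).comp
      (tendsto_aSeq.atTop_div_const two_pos)).const_mul (D * E * 16)
    rwa [mul_zero] at h
  refine squeeze_zero' ?_ ?_ hlim
  · filter_upwards [tendsto_aSeq.eventually_ge_atTop 1] with n ha
    have : 0 ≤ secondSeq √(2 * Real.log n) := by
      unfold secondSeq hermiteSeq
      positivity
    unfold gridBound
    have : 0 ≤ aSeq n := by linarith
    positivity
  · filter_upwards [tendsto_aSeq.eventually_ge_atTop 1,
      tendsto_sqrt_two_log.eventually_ge_atTop 1] with n ha hL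
    obtain ⟨f1, f2, f3⟩ := sqrt_two_log_facts (by linarith) hL
    set L := √(2 * Real.log n) with hLdef
    have hL0 : 0 < L := by linarith
    have hn : (0 : ℝ) < n := by linarith
    have h1 := secondSeq_le hL
    rw [f1] at h1
    have h2 : V * secondSeq L + P ≤ (27842 * V + P) * n / L := by
      have : P ≤ P * n / L := by
        rw [le_div_iff₀ hL0]; gcongr
      calc V * secondSeq L + P ≤ V * (27842 * n / L) + P * n / L := by gcongr
        _ = _ := by ring
    have h3 : 4 * (2 * B ^ 2 * (V * secondSeq L + P)) / (n * ε ^ 2) ≤ E / L := by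
      calc _ ≤ 4 * (2 * B ^ 2 * ((27842 * V + P) * n / L)) / (n * ε ^ 2) := by gcongr
        _ = _ := by rw [hE]; field_simp; ring
    have h4 : E / L ≤ E * Real.exp (-(aSeq n / 2)) := by
      rw [Real.exp_neg, ← div_eq_mul_inv]
      gcongr
    calc _ ≤ D * aSeq n ^ 4 * (E * Real.exp (-(aSeq n / 2))) := by
          refine mul_le_mul (C.gridBound_le ha) (h3.trans h4) ?_ (by positivity)
          have : 0 ≤ secondSeq L := by
            unfold secondSeq hermiteSeq
            positivity
          positivity
      _ = _ := by ring

end Model.GridConstants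

/-! ### Uniform constants and the comparison on a good event -/

/-- Uniform bounds on the quantities of a model. -/
structure UniformBounds (M : Model) where
  B : ℝ
  V : ℝ
  P : ℝ
  Q : ℝ
  s : ℝ
  s₀ : ℝ
  β₀ : ℝ
  β₁ : ℝ
  weight_le : ∀ i, M.b i + M.h i ≤ B
  var_le : ∀ i, M.varF i + M.varP i ≤ V
  varP_le : ∀ i, M.varP i ≤ P
  quantile_le : ∀ i, |PhiInv (M.bt i)| ≤ Q
  varP_le_varF : ∀ i, M.varP i ≤ M.varF i
  s_pos : 0 < s
  s_le : ∀ i, s ≤ M.varP i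
  s₀_pos : 0 < s₀
  s₀_le : ∀ i, s₀ ≤ √(2 * M.varP i / M.varF i)
  β₀_pos : 0 < β₀
  le_bt : ∀ i, β₀ ≤ M.bt i
  bt_le : ∀ i, M.bt i ≤ β₁
  β₁_lt_one : β₁ < 1

lemma Model.GridConstants.nonempty_uniformBounds {M : Model} (C : M.GridConstants)
    (hA1 : M.AssumptionA1) (hA3 : M.AssumptionA3) : Nonempty (UniformBounds M) := by
  obtain ⟨⟨β₀, hβ₀, hb0⟩, ⟨β₁, hβ₁, hb1⟩, -⟩ := hA1
  obtain ⟨⟨ρ, hρ, hr⟩, ⟨F, hF⟩, s, hs, hsP⟩ := hA3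
  have hF0 : 0 < F := (M.varF_pos 0).trans_le (hF 0)
  have hρ1 : ρ < 1 := by
    refine hρ.trans_le ?_
    rw [div_le_one (by positivity)]
    linarith [Real.add_one_le_exp 1]
  have hratio : ∀ i, s / F ≤ M.varP i / M.varF i := fun i =>
    div_le_div₀ (M.varP_pos i).le (hsP i) (M.varF_pos i) (hF i)
  have hsF : 0 < s / F := by positivity
  refine ⟨⟨C.C₁, F + C.C₂, C.C₂, C.C₃ / (s / F), s, √(2 * (s / F)), β₀, β₁, C.weight_le,
    fun i => add_le_add (hF i) (C.varP_le i), C.varP_le, fun i => ?_, fun i => ?_, hs, hsP,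
    by positivity, fun i => ?_, hβ₀, hb0, hb1, hβ₁⟩⟩
  -- The bound C₃ on ratio times quantile bounds the quantiles themselves, because the variance
  -- ratio is at least s/F.
  · rw [le_div_iff₀ hsF, mul_comm]
    exact (mul_le_mul_of_nonneg_right (hratio 0) (abs_nonneg _)).trans (C.ratio_le 0 i)
  · have := (hr i).trans hρ1.le
    rwa [div_le_one (M.varF_pos i)] at this
  · rw [mul_div_assoc]
    exact Real.sqrt_le_sqrt (mul_le_mul_of_nonneg_left (hratio i) two_pos.le)

namespace UniformBounds

variable {M : Model} (D : UniformBounds M)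

/-- The factor that bounds the sample quantiles by the average absolute value of the data. -/
noncomputable def κ : ℝ := 1 / D.β₀ + 1 / (1 - D.β₁)

lemma β₀_lt_one : D.β₀ < 1 := (D.le_bt 0).trans_lt (M.bt_lt_one 0)

lemma one_le_κ : 1 ≤ D.κ := by
  have h1 : 1 ≤ 1 / D.β₀ := (one_le_div D.β₀_pos).2 D.β₀_lt_one.le
  have h2 : 0 < 1 / (1 - D.β₁) := one_div_pos.2 (by linarith [D.β₁_lt_one])
  rw [κ]; linarith

lemma B_pos : 0 < D.B := (M.sum_pos 0).trans_le (D.weight_le 0)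

lemma V_pos : 0 < D.V := (add_pos (M.varF_pos 0) (M.varP_pos 0)).trans_le (D.var_le 0)

lemma P_pos : 0 < D.P := (M.varP_pos 0).trans_le (D.varP_le 0)

lemma Q_nonneg : 0 ≤ D.Q := (abs_nonneg _).trans (D.quantile_le 0)

lemma iInf_iSup_bt_bounds {n : ℕ} (hn : 0 < n) :
    D.β₀ ≤ ⨅ i : Fin n, M.bt i ∧ ⨆ i : Fin n, M.bt i ≤ D.β₁ ∧
      ∀ i j : Fin n, M.bt i - M.bt j ≤ (⨆ i : Fin n, M.bt i) - ⨅ i : Fin n, M.bt i := by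
  have : Nonempty (Fin n) := ⟨⟨0, hn⟩⟩
  refine ⟨le_ciInf fun i => D.le_bt i, ciSup_le fun i => D.bt_le i, fun i j => ?_⟩
  have h1 : M.bt i ≤ ⨆ i : Fin n, M.bt i :=
    le_ciSup (f := fun i : Fin n => M.bt i) (Set.finite_range _).bddAbove i
  have h2 : ⨅ i : Fin n, M.bt i ≤ M.bt j :=
    ciInf_le (f := fun i : Fin n => M.bt i) (Set.finite_range _).bddBelow j
  linarith

lemma abs_endpoints_le {n : ℕ} (hn : 0 < n) (x : Fin n → ℝ) :
    |Model.sampleQuantile x (⨅ i : Fin n, M.bt i)| ≤ D.κ * meanAbs x ∧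
      |Model.sampleQuantile x (⨆ i : Fin n, M.bt i)| ≤ D.κ * meanAbs x := by
  obtain ⟨h1, h2, h3⟩ := D.iInf_iSup_bt_bounds hn
  have h4 := h3 ⟨0, hn⟩ ⟨0, hn⟩
  exact ⟨Model.abs_sampleQuantile_le hn x D.β₀_pos D.β₁_lt_one h1 (by linarith),
    Model.abs_sampleQuantile_le hn x D.β₀_pos D.β₁_lt_one (by linarith) h2⟩

lemma abs_le_of_mem {n : ℕ} (hn : 0 < n) {x : Fin n → ℝ} {η : ℝ}
    (hη : η ∈ M.quantileInterval x) : |η| ≤ D.κ * meanAbs x := by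
  obtain ⟨h1, h2⟩ := D.abs_endpoints_le hn x
  rw [abs_le] at *
  exact ⟨h1.1.trans hη.1, hη.2.trans h2.2⟩

/-- A deterministic chain: tuned loss ≈ tuned estimate ≤ estimate at a search point near (η, τ) ≈
loss there ≈ loss at (η, τ). Each of the three approximations costs at most ε/4. -/
lemma loss_lt_of_isTuned (C : M.GridConstants) {γ : ℕ → ℝ} {ηD : ∀ n : ℕ, (Fin n → ℝ) → ℝ}
    {τD : ∀ n : ℕ, (Fin n → ℝ) → ℝ≥0∞} (htuned : C.IsTuned γ ηD τD) (θ : ℕ → ℝ) {n : ℕ}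
    (hn : 0 < n) (ha : 0 < aSeq n) {ε : ℝ}
    (hdisc : D.B * (D.P / min 1 D.s ^ 2 * (C.mesh2 n * (2 * aSeq n + √D.V * D.Q)) + C.mesh1 n) ≤
      ε / 4) {x : Fin n → ℝ} (hx : D.κ * meanAbs x ≤ aSeq n)
    (hwidth : 2 * C.mesh1 n < Model.sampleQuantile x (⨆ i : Fin n, M.bt i) -
      Model.sampleQuantile x (⨅ i : Fin n, M.bt i))
    (hgrid : ∀ p ∈ C.grid1 n ×ˢ C.grid2 n,
      |M.ARED γ n p.1 p.2 x - M.loss θ n (M.qhat p.1 p.2 x)| < ε / 4)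
    {η : ℝ} (hη : η ∈ M.quantileInterval x) (τ : ℝ≥0∞) :
    M.loss θ n (M.qhat (ηD n x) (τD n x) x) < M.loss θ n (M.qhat η τ x) + ε := by
  obtain ⟨e1, e2⟩ := D.abs_endpoints_le hn x
  obtain ⟨η', hη', hd1⟩ := C.exists_grid1_near ha (abs_le.1 (e1.trans hx)).1
    (abs_le.1 (e2.trans hx)).2 hwidth.le hη
  obtain ⟨τ', hτ', hd2⟩ := C.exists_grid2_near ha τ
  have hmem : (η', τ') ∈ C.searchSet x := ⟨hη', hτ'⟩
  obtain ⟨hDmem, hmin⟩ := (htuned n x).2 ⟨_, hmem⟩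
  have g1 := hgrid (ηD n x, τD n x) ⟨hDmem.1.1, hDmem.2⟩
  have g2 := hgrid (η', τ') ⟨hη'.1, hτ'⟩
  have g3 := hmin _ hmem
  have hmx : meanAbs x ≤ aSeq n :=
    (le_mul_of_one_le_left (meanAbs_nonneg x) D.one_le_κ).trans hx
  have hηa : |η| ≤ aSeq n := (D.abs_le_of_mem hn hη).trans hx
  have g4 := M.abs_loss_sub_loss_le (θ := θ) hn D.weight_le D.var_le D.quantile_le D.varP_le_varF
    D.s_pos D.s_le D.varP_le η η' τ τ' x
  have hm : 0 < min 1 D.s := lt_min one_pos D.s_pos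
  have hB := D.B_pos
  have hP := D.P_pos
  have hQ := D.Q_nonneg
  have g5 : |M.loss θ n (M.qhat η τ x) - M.loss θ n (M.qhat η' τ' x)| ≤ ε / 4 := by
    refine g4.trans (le_trans ?_ hdisc)
    rw [mul_assoc (D.P / min 1 D.s ^ 2)]
    have := C.mesh2_pos ha
    have h0 := meanAbs_nonneg x
    have h1 : meanAbs x + (|η| + √D.V * D.Q) ≤ 2 * aSeq n + √D.V * D.Q := by linarith
    gcongr D.B * (D.P / min 1 D.s ^ 2 * (?_ * ?_) + ?_)
  rw [abs_lt] at g1 g2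
  rw [abs_le] at g5
  simp only at g1 g2 g3
  linarith [g1.1, g2.2, g5.1]

end UniformBounds

/-! ### Bad events and convergence in probability -/

/-- The average squared deviation of the data from the means. -/
noncomputable def meanSqDev (θ : ℕ → ℝ) {n : ℕ} (x : Fin n → ℝ) : ℝ :=
  (1 / (n : ℝ)) * ∑ i, (x i - θ i) ^ 2

lemma meanSqDev_nonneg (θ : ℕ → ℝ) {n : ℕ} (x : Fin n → ℝ) : 0 ≤ meanSqDev θ x := by
  unfold meanSqDev; positivity

lemma sqrt_le_one_add {t : ℝ} (ht : 0 ≤ t) : √t ≤ 1 + t :=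
  (Real.sqrt_le_left (by linarith)).2 (by nlinarith)

lemma meanAbs_le (θ : ℕ → ℝ) {n : ℕ} (x : Fin n → ℝ) :
    meanAbs x ≤ meanAbs (fun i : Fin n => θ i) + √(meanSqDev θ x) := by
  have h1 : meanAbs x ≤ meanAbs (fun i : Fin n => θ i) +
      (1 / (n : ℝ)) * ∑ i, |x i - θ i| := by
    rw [meanAbs, meanAbs, ← mul_add, ← Finset.sum_add_distrib]
    gcongr with i
    have := abs_add_le (θ i) (x i - θ i)
    rwa [add_sub_cancel] at this
  refine h1.trans (add_le_add le_rfl (Real.le_sqrt_of_sq_le ?_))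
  have h2 := sq_sum_le_card_mul_sum_sq (s := Finset.univ) (f := fun i : Fin n => |x i - θ i|)
  simp only [Finset.card_univ, Fintype.card_fin, sq_abs] at h2
  rcases Nat.eq_zero_or_pos n with rfl | hn
  · simp [meanSqDev]
  · have hnr : (0 : ℝ) < n := by exact_mod_cast hn
    rw [meanSqDev, mul_pow]
    calc _ ≤ (1 / (n : ℝ)) ^ 2 * (n * ∑ i, (x i - θ i) ^ 2) := by gcongr
      _ = _ := by field_simp

namespace UniformBounds

variable {M : Model}

lemma integrable_meanSqDev (M : Model) (θ : ℕ → ℝ) (n : ℕ) :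
    Integrable (fun x : Fin n → ℝ => meanSqDev θ x) (M.dataLaw θ n) := by
  unfold meanSqDev
  refine Integrable.const_mul (integrable_finsetSum _ fun i _ => ?_) _
  exact (measurePreserving_eval (fun i : Fin n => gaussianReal (θ i) (M.varP i).toNNReal)
    i).integrable_comp_of_integrable (M.integral_sub_mean_sq θ i).1

lemma integral_meanSqDev_le (D : UniformBounds M) (θ : ℕ → ℝ) (n : ℕ) :
    ∫ x : Fin n → ℝ, meanSqDev θ x ∂(M.dataLaw θ n) ≤ D.P := by
  have hmp := fun i : Fin n => measurePreserving_eval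
    (fun i : Fin n => gaussianReal (θ i) (M.varP i).toNNReal) i
  unfold meanSqDev
  rw [integral_const_mul, integral_finsetSum]
  · have h : ∀ i : Fin n, ∫ x : Fin n → ℝ, (x i - θ i) ^ 2 ∂(M.dataLaw θ n) = M.varP i :=
      fun i => by
        rw [← (M.integral_sub_mean_sq θ i).2, ← (hmp i).map_eq,
          integral_map (hmp i).measurable.aemeasurable (by fun_prop)]
        rfl
    simp only [h]
    calc (1 / (n : ℝ)) * ∑ i : Fin n, M.varP i ≤ (1 / (n : ℝ)) * ∑ _i : Fin n, D.P := by
          gcongr with i; exact D.varP_le i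
      _ ≤ D.P := by
          rcases Nat.eq_zero_or_pos n with rfl | hn
          · simpa using D.P_pos.le
          · have hnr : (0 : ℝ) < n := by exact_mod_cast hn
            simp only [Finset.sum_const, Finset.card_univ, Fintype.card_fin, nsmul_eq_mul]
            field_simp
            exact le_rfl
  · exact fun i _ => (hmp i).integrable_comp_of_integrable (M.integral_sub_mean_sq θ i).1

lemma _root_.CheckLoss.AssumptionA2.exists_meanAbs_le {θ : ℕ → ℝ} (hA2 : AssumptionA2 θ) :
    ∃ T : ℝ, 0 ≤ T ∧ ∀ᶠ n : ℕ in atTop, meanAbs (fun i : Fin n => θ i) ≤ T := by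
  obtain ⟨T, hT⟩ := hA2
  refine ⟨max T 0, le_max_right _ _, hT.mono fun n h => ?_⟩
  rw [meanAbs, Fin.sum_univ_eq_sum_range (fun i => |θ i|) n]
  exact h.trans (le_max_left _ _)

lemma tendsto_measure_meanAbs_gt (D : UniformBounds M)
    {θ : ℕ → ℝ} (hA2 : AssumptionA2 θ) :
    Tendsto (fun n : ℕ => M.dataLaw θ n {x | aSeq n < D.κ * meanAbs x}) atTop (𝓝 0) := by
  obtain ⟨T, hT0, hT⟩ := hA2.exists_meanAbs_le
  have hκ : 0 < D.κ := by linarith [D.one_le_κ]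
  -- T bounds the average of |θ_i|, and the 1 comes from √t ≤ 1 + t.
  have hlin : Tendsto (fun n => aSeq n / D.κ + -(T + 1)) atTop atTop :=
    tendsto_atTop_add_const_right _ _ (tendsto_aSeq.atTop_div_const hκ)
  have hlim : Tendsto (fun n => ENNReal.ofReal (D.P / (aSeq n / D.κ + -(T + 1)))) atTop (𝓝 0) := by
    have := ENNReal.tendsto_ofReal ((tendsto_const_nhds (x := D.P)).div_atTop hlin)
    rwa [ENNReal.ofReal_zero] at this
  refine tendsto_of_tendsto_of_tendsto_of_le_of_le' tendsto_const_nhds hlim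
    (Eventually.of_forall fun _ => zero_le) ?_
  filter_upwards [hT, hlin.eventually_gt_atTop 0] with n h1 h2
  set t := aSeq n / D.κ + -(T + 1) with ht
  have hM := mul_meas_ge_le_integral_of_nonneg
    (Eventually.of_forall fun x => meanSqDev_nonneg θ x) (integrable_meanSqDev M θ n) t
  refine (measure_mono (t := {x | t ≤ meanSqDev θ x}) fun x hx => ?_).trans ?_
  · have h3 := meanAbs_le θ x
    have h4 := sqrt_le_one_add (meanSqDev_nonneg θ x)
    have h5 : aSeq n / D.κ < meanAbs x := by
      rw [div_lt_iff₀ hκ, mul_comm]; exact hx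
    rw [Set.mem_ofPred_eq, ht]
    linarith
  · rw [← ofReal_measureReal (measure_ne_top _ _)]
    refine ENNReal.ofReal_le_ofReal ?_
    rw [le_div_iff₀ h2, mul_comm]
    exact hM.trans (D.integral_meanSqDev_le θ n)

/-- Two coordinates with different critical ratios keep the two quantile levels a fixed δ apart for
all large n, while the mesh tends to 0. With equal ratios the interval would be a single point. -/
lemma tendsto_measure_short_interval (D : UniformBounds M)
    (C : M.GridConstants) (hratio : ∃ i j, M.bt i ≠ M.bt j)
    (θ : ℕ → ℝ) : Tendsto (fun n : ℕ => M.dataLaw θ n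
      {x | Model.sampleQuantile x (⨆ i : Fin n, M.bt i) - Model.sampleQuantile x (⨅ i : Fin n, M.bt i) ≤
        2 * C.mesh1 n}) atTop (𝓝 0) := by
  obtain ⟨i, j, hij⟩ : ∃ i j, 0 < M.bt i - M.bt j := by
    obtain ⟨i, j, h⟩ := hratio
    rcases lt_or_gt_of_ne h with h | h
    · exact ⟨j, i, sub_pos.2 h⟩
    · exact ⟨i, j, sub_pos.2 h⟩
  set δ := M.bt i - M.bt j
  have hlim : Tendsto (fun n : ℕ => ENNReal.ofReal
      ((1 / n + 4 * (2 * C.mesh1 n) / √D.s) / δ ^ 2)) atTop (𝓝 0) := by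
    have h := ENNReal.tendsto_ofReal (((tendsto_one_div_atTop_nhds_zero_nat (𝕜 := ℝ)).add
      (((C.tendsto_mesh1.const_mul 2).const_mul 4).div_const (√D.s))).div_const (δ ^ 2))
    simpa using h
  refine tendsto_of_tendsto_of_tendsto_of_le_of_le' tendsto_const_nhds hlim
    (Eventually.of_forall fun _ => zero_le) ?_
  filter_upwards [eventually_gt_atTop i, eventually_gt_atTop j,
    tendsto_aSeq.eventually_gt_atTop 0] with n hi hj ha
  have hn : 0 < n := by lia
  obtain ⟨h1, h2, h3⟩ := D.iInf_iSup_bt_bounds hn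
  have h4 := h3 ⟨i, hi⟩ ⟨j, hj⟩
  exact M.measure_short_interval_le θ hn D.s_pos D.s_le (D.β₀_pos.trans_le h1)
    (h2.trans D.β₁_lt_one.le) hij (by simp only at h4; linarith)
    (mul_pos two_pos (C.mesh1_pos ha))

/-- The union bound runs over the deterministic product grid, not the random search set, so
concentration at fixed hyperparameters suffices. -/
lemma tendsto_measure_grid (D : UniformBounds M)
    (C : M.GridConstants) {γ : ℕ → ℝ} (hγ : M.AdmissibleGamma γ)
    (θ : ℕ → ℝ) {ε : ℝ} (hε : 0 < ε) : Tendsto (fun n : ℕ => M.dataLaw θ n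
      {x | ∃ p ∈ C.grid1 n ×ˢ C.grid2 n,
        ε ≤ |M.ARED γ n p.1 p.2 x - M.loss θ n (M.qhat p.1 p.2 x)|}) atTop (𝓝 0) := by
  obtain ⟨⟨γ₀, hγ₀, h1⟩, h2⟩ := hγ
  have hlim := ENNReal.tendsto_ofReal
    (C.tendsto_gridBound_mul (B := D.B) (ε := ε) D.V_pos.le D.P_pos.le)
  rw [ENNReal.ofReal_zero] at hlim
  refine tendsto_of_tendsto_of_tendsto_of_le_of_le' tendsto_const_nhds hlim
    (Eventually.of_forall fun _ => zero_le) ?_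
  filter_upwards [eventually_ge_atTop 2, tendsto_aSeq.eventually_gt_atTop 0,
    eventually_biasSeq_le hγ₀ D.s₀_pos (D.B * √D.V) (mul_nonneg D.B_pos.le (Real.sqrt_nonneg _))
      (half_pos hε)] with n hn ha hb
  obtain ⟨s, hs, hcard⟩ := C.exists_finset_grid ha
  refine (measure_mono (t := ⋃ p ∈ s, {x |
    ε ≤ |M.ARED γ n p.1 p.2 x - M.loss θ n (M.qhat p.1 p.2 x)|}) ?_).trans ?_
  · rintro x ⟨p, hp, hx⟩
    exact Set.mem_biUnion (hs hp) hx
  · refine (measure_biUnion_finset_le _ _).trans ((Finset.sum_le_sum fun p _ =>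
      M.measure_ARED_sub_loss_ge_le θ γ hγ₀ D.s₀_pos h1 h2 D.s₀_le hn D.weight_le D.var_le
        D.varP_le p.1 p.2 hε hb).trans ?_)
    have hnn : 0 ≤ 4 * (2 * D.B ^ 2 * (D.V * secondSeq √(2 * Real.log n) + D.P)) /
        (n * ε ^ 2) := by
      have h3 : 0 ≤ secondSeq √(2 * Real.log n) := by
        unfold secondSeq hermiteSeq; positivity
      have := D.V_pos
      have := D.P_pos
      positivity
    rw [Finset.sum_const, nsmul_eq_mul, ← ENNReal.ofReal_natCast,
      ← ENNReal.ofReal_mul (Nat.cast_nonneg _)]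
    gcongr

lemma tendsto_measure_loss_ge (D : UniformBounds M)
    (C : M.GridConstants) (hratio : ∃ i j, M.bt i ≠ M.bt j)
    {γ : ℕ → ℝ} (hγ : M.AdmissibleGamma γ) {ηD : ∀ n : ℕ, (Fin n → ℝ) → ℝ}
    {τD : ∀ n : ℕ, (Fin n → ℝ) → ℝ≥0∞} (htuned : C.IsTuned γ ηD τD) {θ : ℕ → ℝ}
    (hA2 : AssumptionA2 θ) {ηhat : ∀ n : ℕ, (Fin n → ℝ) → ℝ}
    {τhat : ∀ n : ℕ, (Fin n → ℝ) → ℝ≥0∞}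
    (hmem : ∀ (n : ℕ) (x : Fin n → ℝ), ηhat n x ∈ M.quantileInterval x) {ε : ℝ} (hε : 0 < ε) :
    Tendsto (fun n : ℕ => M.dataLaw θ n
        {x | M.loss θ n (M.qhat (ηD n x) (τD n x) x) ≥
          M.loss θ n (M.qhat (ηhat n x) (τhat n x) x) + ε}) atTop (𝓝 0) := by
  have hlim := ((D.tendsto_measure_meanAbs_gt hA2).add
    (D.tendsto_measure_short_interval C hratio θ)).add
    (D.tendsto_measure_grid C hγ θ (by linarith : 0 < ε / 4))
  rw [add_zero, add_zero] at hlim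
  have hdisc : Tendsto (fun n => D.B * (D.P / min 1 D.s ^ 2 *
      (C.mesh2 n * (2 * aSeq n + √D.V * D.Q)) + C.mesh1 n)) atTop (𝓝 0) := by
    have := (((C.tendsto_mesh2 2 (√D.V * D.Q)).const_mul (D.P / min 1 D.s ^ 2)).add
      C.tendsto_mesh1).const_mul D.B
    simpa using this
  refine tendsto_of_tendsto_of_tendsto_of_le_of_le' tendsto_const_nhds hlim
    (Eventually.of_forall fun _ => zero_le) ?_
  filter_upwards [eventually_gt_atTop 0, tendsto_aSeq.eventually_gt_atTop 0,
    hdisc.eventually (ge_mem_nhds (by linarith : 0 < ε / 4))] with n hn ha hd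
  refine (measure_mono fun x hx => ?_).trans
    ((measure_union_le _ _).trans (add_le_add (measure_union_le _ _) le_rfl))
  by_contra hc
  simp only [Set.mem_union, Set.mem_ofPred_eq, not_or, not_lt, not_le, not_exists, not_and] at hc
  exact absurd (D.loss_lt_of_isTuned C htuned θ hn ha hd hc.1.1 hc.1.2 hc.2 (hmem n x) (τhat n x))
    (not_lt.2 hx)

end UniformBounds

/-! ### From convergence in probability to risk -/

/-- Where f ≥ ε, use f ≤ δf² + 1/(4δ); elsewhere f ≤ ε. For fixed small δ a vanishing probability
makes the last term vanish, which replaces an appeal to uniform integrability. -/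
lemma integral_le_of_sq_le {Ω : Type*} [MeasurableSpace Ω] {μ : Measure Ω}
    [IsProbabilityMeasure μ] {f g : Ω → ℝ} (hf : Integrable f μ) (hfm : Measurable f)
    (hg : Integrable g μ) {p q P ε δ : ℝ} (hq : 0 ≤ q) (h : ∀ x, f x ^ 2 ≤ p + q * g x)
    (hP : ∫ x, g x ∂μ ≤ P) (hε : 0 ≤ ε) (hδ : 0 < δ) :
    ∫ x, f x ∂μ ≤ ε + δ * (p + q * P) + μ.real {x | ε ≤ f x} / (4 * δ) := by
  have hS : MeasurableSet {x | ε ≤ f x} := measurableSet_le measurable_const hfm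
  set r : Ω → ℝ := {x | ε ≤ f x}.indicator fun _ => 1 / (4 * δ) with hr
  have hri : Integrable r μ := (integrable_const _).indicator hS
  have hle : ∀ x, f x ≤ ε + δ * (p + q * g x) + r x := fun x => by
    have h1 := mul_le_mul_of_nonneg_left (h x) hδ.le
    by_cases hx : ε ≤ f x
    · have h2 : r x = 1 / (4 * δ) := Set.indicator_of_mem (s := {x | ε ≤ f x}) hx _
      have h3 : f x ≤ δ * f x ^ 2 + 1 / (4 * δ) := by
        have h4 : δ * f x ^ 2 + 1 / (4 * δ) - f x = (2 * δ * f x - 1) ^ 2 / (4 * δ) := by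
          field_simp; ring
        have h5 : 0 ≤ (2 * δ * f x - 1) ^ 2 / (4 * δ) := by positivity
        linarith
      rw [h2]; linarith
    · have h2 : r x = 0 := Set.indicator_of_notMem (s := {x | ε ≤ f x}) hx _
      have h3 : 0 ≤ δ * f x ^ 2 := by positivity
      rw [h2]; linarith
  have hpq : Integrable (fun x => p + q * g x) μ := (integrable_const _).add (hg.const_mul q)
  have hl : Integrable (fun x => ε + δ * (p + q * g x)) μ :=
    (integrable_const _).add (hpq.const_mul δ)
  refine (integral_mono hf (hl.add hri) hle).trans ?_
  have e1 : ∫ x, (ε + δ * (p + q * g x)) ∂μ = ε + δ * (p + q * ∫ x, g x ∂μ) := by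
    rw [integral_add (integrable_const _) (hpq.const_mul δ), integral_const_mul,
      integral_add (integrable_const _) (hg.const_mul q), integral_const_mul]
    simp
  have e2 : ∫ x, r x ∂μ = μ.real {x | ε ≤ f x} / (4 * δ) := by
    rw [hr, integral_indicator_const _ hS, smul_eq_mul, mul_one_div]
  have e3 : ∫ x, ((fun x => ε + δ * (p + q * g x)) + r) x ∂μ =
      ε + δ * (p + q * ∫ x, g x ∂μ) + μ.real {x | ε ≤ f x} / (4 * δ) := by
    rw [← e1, ← e2]
    exact integral_add hl hri
  rw [e3]
  gcongr

namespace Model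

variable (M : Model)

lemma measurable_shrink (i : ℕ) : Measurable (M.shrink i) := by
  unfold shrink
  exact Measurable.ite (measurableSet_singleton _) measurable_const
    (ENNReal.measurable_toReal.div (ENNReal.measurable_toReal.add_const _))

lemma measurable_loss_qhat (θ : ℕ → ℝ) {n : ℕ} {η : (Fin n → ℝ) → ℝ} {τ : (Fin n → ℝ) → ℝ≥0∞}
    (hη : Measurable η) (hτ : Measurable τ) :
    Measurable fun x => M.loss θ n (M.qhat (η x) (τ x) x) := by
  unfold loss
  refine Measurable.const_mul (Finset.measurable_sum _ fun i _ => ?_) _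
  refine (M.continuous_coordLoss i (θ i)).measurable.comp ?_
  have hs : Measurable fun x => M.shrink i (τ x) := (M.measurable_shrink i).comp hτ
  unfold qhat
  fun_prop

end Model

namespace UniformBounds

variable {M : Model} (D : UniformBounds M)

lemma abs_loss_le {θ : ℕ → ℝ} {n : ℕ} (hn : 0 < n) {x : Fin n → ℝ} {η : ℝ}
    (hη : η ∈ M.quantileInterval x) (τ : ℝ≥0∞) : |M.loss θ n (M.qhat η τ x)| ≤
      D.B * ((2 + D.κ) * meanAbs (fun i : Fin n => θ i) + √D.V * (1 + D.Q)) +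
        D.B * (1 + D.κ) * √(meanSqDev θ x) := by
  have h1 := M.abs_loss_le (θ := θ) hn D.weight_le D.var_le D.quantile_le η τ x
  have h2 := D.abs_le_of_mem hn hη
  have h3 := meanAbs_le θ x
  have hB := D.B_pos
  have hκ := D.one_le_κ
  have h4 := mul_le_mul_of_nonneg_left h3 (by linarith : 0 ≤ 1 + D.κ)
  calc _ ≤ _ := h1
    _ ≤ D.B * ((1 + D.κ) * (meanAbs (fun i : Fin n => θ i) + √(meanSqDev θ x)) +
        (meanAbs (fun i : Fin n => θ i) + √D.V * (1 + D.Q))) := by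
      refine mul_le_mul_of_nonneg_left ?_ hB.le
      linarith
    _ = _ := by ring

lemma integrable_loss (D : UniformBounds M) (θ : ℕ → ℝ) {n : ℕ} {η : (Fin n → ℝ) → ℝ}
    {τ : (Fin n → ℝ) → ℝ≥0∞} (hη : Measurable η) (hτ : Measurable τ)
    (hmem : ∀ x, η x ∈ M.quantileInterval x) :
    Integrable (fun x => M.loss θ n (M.qhat (η x) (τ x) x)) (M.dataLaw θ n) := by
  rcases Nat.eq_zero_or_pos n with rfl | hn
  · simp [Model.loss]
  · have hB := D.B_pos
    have hκ := D.one_le_κ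
    refine Integrable.mono' ((integrable_const (D.B * ((2 + D.κ) * meanAbs (fun i : Fin n => θ i) +
      √D.V * (1 + D.Q)))).add (((integrable_const 1).add
        (integrable_meanSqDev M θ n)).const_mul (D.B * (1 + D.κ))))
      (M.measurable_loss_qhat θ hη hτ).aestronglyMeasurable (Eventually.of_forall fun x => ?_)
    refine (D.abs_loss_le hn (hmem x) (τ x)).trans ?_
    exact add_le_add le_rfl (mul_le_mul_of_nonneg_left
      (sqrt_le_one_add (meanSqDev_nonneg θ x)) (by positivity))

lemma eventually_risk_sub_le (D : UniformBounds M) {θ : ℕ → ℝ} (hA2 : AssumptionA2 θ)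
    {η η' : ∀ n : ℕ, (Fin n → ℝ) → ℝ} {τ τ' : ∀ n : ℕ, (Fin n → ℝ) → ℝ≥0∞}
    (hη : ∀ n, Measurable (η n)) (hτ : ∀ n, Measurable (τ n))
    (hη' : ∀ n, Measurable (η' n)) (hτ' : ∀ n, Measurable (τ' n))
    (hmem : ∀ n x, η n x ∈ M.quantileInterval x) (hmem' : ∀ n x, η' n x ∈ M.quantileInterval x)
    (hprob : ∀ ε : ℝ, 0 < ε → Tendsto (fun n : ℕ => M.dataLaw θ n
        {x | M.loss θ n (M.qhat (η n x) (τ n x) x) ≥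
          M.loss θ n (M.qhat (η' n x) (τ' n x) x) + ε}) atTop (𝓝 0)) {ε : ℝ} (hε : 0 < ε) :
    ∀ᶠ n : ℕ in atTop, M.risk θ n (fun x => M.qhat (η n x) (τ n x) x) -
      M.risk θ n (fun x => M.qhat (η' n x) (τ' n x) x) ≤ 3 * ε := by
  obtain ⟨T, hT0, hT⟩ := hA2.exists_meanAbs_le
  have hB := D.B_pos
  have hκ := D.one_le_κ
  have hQ := D.Q_nonneg
  have hP := D.P_pos
  set A := D.B * ((2 + D.κ) * T + √D.V * (1 + D.Q)) with hA
  set b := D.B * (1 + D.κ) with hb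
  have hb0 : 0 ≤ b := by positivity
  -- K exceeds the second moment of the loss difference, so δ = ε/K makes the quadratic term at most
  -- ε; the probability term is eventually at most ε as well.
  set K := 8 * A ^ 2 + 8 * b ^ 2 * D.P + 1 with hK
  have hK0 : 0 < K := by positivity
  have hδ : 0 < ε / K := by positivity
  have hreal : Tendsto (fun n : ℕ => (M.dataLaw θ n).real
        {x | M.loss θ n (M.qhat (η n x) (τ n x) x) ≥
          M.loss θ n (M.qhat (η' n x) (τ' n x) x) + ε}) atTop (𝓝 0) := by
    have := (ENNReal.tendsto_toReal ENNReal.zero_ne_top).comp (hprob ε hε)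
    rwa [ENNReal.toReal_zero] at this
  filter_upwards [hT, eventually_gt_atTop 0,
    hreal.eventually (ge_mem_nhds (by positivity : 0 < ε * (4 * (ε / K))))] with n h1 hn h2
  have hi := D.integrable_loss θ (hη n) (hτ n) (hmem n)
  have hi' := D.integrable_loss θ (hη' n) (hτ' n) (hmem' n)
  have hm := M.measurable_loss_qhat θ (hη n) (hτ n)
  have hm' := M.measurable_loss_qhat θ (hη' n) (hτ' n)
  rw [Model.risk, Model.risk, ← integral_sub hi hi']
  have hsq : ∀ x, (M.loss θ n (M.qhat (η n x) (τ n x) x) -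
      M.loss θ n (M.qhat (η' n x) (τ' n x) x)) ^ 2 ≤
        8 * A ^ 2 + 8 * b ^ 2 * meanSqDev θ x := fun x => by
    have hA' : D.B * ((2 + D.κ) * meanAbs (fun i : Fin n => θ i) + √D.V * (1 + D.Q)) ≤ A := by
      rw [hA]; gcongr
    have u1 := D.abs_loss_le (θ := θ) hn (hmem n x) (τ n x)
    have u2 := D.abs_loss_le (θ := θ) hn (hmem' n x) (τ' n x)
    have u3 := abs_sub (M.loss θ n (M.qhat (η n x) (τ n x) x))
      (M.loss θ n (M.qhat (η' n x) (τ' n x) x))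
    have u4 : |M.loss θ n (M.qhat (η n x) (τ n x) x) -
      M.loss θ n (M.qhat (η' n x) (τ' n x) x)| ≤ 2 * (A + b * √(meanSqDev θ x)) := by
      linarith
    have u5 := Real.sq_sqrt (meanSqDev_nonneg θ x)
    rw [← sq_abs]
    calc _ ≤ (2 * (A + b * √(meanSqDev θ x))) ^ 2 := by gcongr
      _ ≤ 8 * A ^ 2 + 8 * b ^ 2 * √(meanSqDev θ x) ^ 2 := by
        nlinarith [sq_nonneg (A - b * √(meanSqDev θ x))]
      _ = _ := by rw [u5]
  have hmain := integral_le_of_sq_le (hi.sub hi') (hm.sub hm') (integrable_meanSqDev M θ n)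
    (by positivity) hsq (D.integral_meanSqDev_le θ n) hε.le hδ
  have hset : {x | ε ≤ ((fun x => M.loss θ n (M.qhat (η n x) (τ n x) x)) -
      fun x => M.loss θ n (M.qhat (η' n x) (τ' n x) x)) x} =
      {x | M.loss θ n (M.qhat (η n x) (τ n x) x) ≥
          M.loss θ n (M.qhat (η' n x) (τ' n x) x) + ε} := by
    ext x
    simp only [Set.mem_ofPred_eq, Pi.sub_apply, ge_iff_le, le_sub_iff_add_le, add_comm]
  rw [hset] at hmain
  have h3 : (M.dataLaw θ n).real {x | M.loss θ n (M.qhat (η n x) (τ n x) x) ≥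
      M.loss θ n (M.qhat (η' n x) (τ' n x) x) + ε} / (4 * (ε / K)) ≤ ε :=
    (div_le_iff₀ (by positivity)).2 h2
  have h4 : ε / K * (8 * A ^ 2 + 8 * b ^ 2 * D.P) ≤ ε := by
    rw [div_mul_eq_mul_div, div_le_iff₀ hK0]
    gcongr
    linarith
  simp only [Pi.sub_apply] at hmain
  linarith

end UniformBounds

end CheckLoss

/-- In `EReal` the limsup needs no boundedness, so upper bounds alone decide it. -/
lemma EReal.limsup_coe_nonpos {u : ℕ → ℝ} (h : ∀ ε : ℝ, 0 < ε → ∀ᶠ n in atTop, u n ≤ ε) :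
    limsup (fun n => (u n : EReal)) atTop ≤ 0 := by
  refine le_of_forall_gt_imp_ge_of_dense fun c hc => ?_
  obtain ⟨ε, h0, h1⟩ := EReal.lt_iff_exists_real_btwn.1 hc
  refine (limsup_le_of_le (h := (h ε (by exact_mod_cast h0)).mono fun n hn => ?_)).trans h1.le
  exact_mod_cast hn

theorem mainTheorem10 (M : CheckLoss.Model) (hA1 : M.AssumptionA1) (hA3 : M.AssumptionA3)
    (hratio : ∃ i j, M.bt i ≠ M.bt j)
    (γ : ℕ → ℝ) (hγ : M.AdmissibleGamma γ) (C : M.GridConstants)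
    (ηD : ∀ n : ℕ, (Fin n → ℝ) → ℝ) (τD : ∀ n : ℕ, (Fin n → ℝ) → ℝ≥0∞)
    (hηD : ∀ n, Measurable (ηD n)) (hτD : ∀ n, Measurable (τD n))
    (htuned : C.IsTuned γ ηD τD)
    (θ : ℕ → ℝ) (hA2 : CheckLoss.AssumptionA2 θ)
    (ηhat : ∀ n : ℕ, (Fin n → ℝ) → ℝ) (τhat : ∀ n : ℕ, (Fin n → ℝ) → ℝ≥0∞)
    (hηhat : ∀ n, Measurable (ηhat n)) (hτhat : ∀ n, Measurable (τhat n))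
    (hmem : ∀ (n : ℕ) (x : Fin n → ℝ), ηhat n x ∈ M.quantileInterval x) :
    (∀ ε : ℝ, 0 < ε →
      Tendsto (fun n : ℕ => M.dataLaw θ n
        {x | M.loss θ n (M.qhat (ηD n x) (τD n x) x) ≥
          M.loss θ n (M.qhat (ηhat n x) (τhat n x) x) + ε}) atTop (𝓝 0)) ∧
    ((∀ n : ℕ,
        Integrable (fun x => M.loss θ n (M.qhat (ηD n x) (τD n x) x)) (M.dataLaw θ n) ∧
        Integrable (fun x => M.loss θ n (M.qhat (ηhat n x) (τhat n x) x)) (M.dataLaw θ n)) ∧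
      limsup (fun n : ℕ =>
        ((M.risk θ n (fun x => M.qhat (ηD n x) (τD n x) x) -
          M.risk θ n (fun x => M.qhat (ηhat n x) (τhat n x) x) : ℝ) : EReal)) atTop ≤ 0) := by
  obtain ⟨D⟩ := C.nonempty_uniformBounds hA1 hA3
  have hmemD := fun n x => (htuned n x).1
  have hprob := fun (ε : ℝ) (hε : 0 < ε) =>
    D.tendsto_measure_loss_ge (τhat := τhat) C hratio hγ htuned hA2 hmem hε
  refine ⟨hprob, fun n => ⟨D.integrable_loss θ (hηD n) (hτD n) (hmemD n),
    D.integrable_loss θ (hηhat n) (hτhat n) (hmem n)⟩, EReal.limsup_coe_nonpos fun ε hε => ?_⟩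
  filter_upwards [D.eventually_risk_sub_le hA2 hηD hτD hηhat hτhat hmemD hmem hprob
    (by linarith : 0 < ε / 3)] with n hn
  linarith
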